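/- Let $\mu,m,T>0$. Let $q:[-T,T]\to\mathbb{C}$ be a collision Kepler motion: $q$ is continuous, $q(0)=0$, $q(t)\neq 0$ for $t\in[-T,T]\setminus\{0\}$, $q(t)\in(-\infty,0]\subset\mathbb{R}$ for all $t\in[-T,T]$, and $\ddot q=-\mu q/|q|^3$ on $[-T,0)\cup(0,T]$ (with one-sided derivatives at $\pm T$). Put $$U(z,t)=\frac{\mu}{|z|}+\frac{m}{|z-q(t)|}\in(0,\infty],\qquad \mathcal{A}_{-T,0}(x)=\int_{-T}^{0}\Big(\tfrac12|\dot x(t)|^2+U(x(t),t)\Big)\,dt\in[0,\infty],$$ where $U(z,t)=\infty$ if $z=0$ or $z=q(t)$. Let $A,A_0$ be disjoint closed subsets of $\{x+iy\in\mathbb{C}:y\ge 0\}$ with $0\in A_0$, and let $$\Omega=\{x\in H^1([-T,0],\mathbb{C}):x(-T)\in A,\ x(0)\in A_0\}.$$ Let $z\in\Omega$ satisfy $\mathcal{A}_{-T,0}(z)\le\mathcal{A}_{-T,0}(x)$ for all $x\in\Omega$, and suppose that $z(0)=0$ (a three-body collision at $t=0$). Then $z(t)\neq 0$ for all $t\in[-T,0)$.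 Let $\theta(t)=\arg z(t)\in(-\pi,\pi]$ for $t\in[-T,0)$, so that $z(t)=|z(t)|e^{i\theta(t)}$. Then $\theta$ is continuous on $(-T,0)$, the limit $\theta_*^-=\lim_{t\to0^-}\theta(t)$ exists, and $\theta_*^-\in\{0,\pi\}$. More precisely, $\theta_*^-=\pi$ if $\theta(t)=\pi$ for all $t\in[-T,0)$, and $\theta_*^-=0$ otherwise. -/

import Mathlib

open MeasureTheory Set Filter Topology
open scoped ENNReal

noncomputable section

/-- A collision Kepler system on `[-T, T]` with the centre (of mass `μ`) fixed at the origin: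
`q` is continuous on `[-T, T]`, vanishes exactly at `t = 0`, stays on the ray `(-∞, 0]`, and is a
classical solution of `q'' = - μ q / |q|³` on `[-T, 0) ∪ (0, T]` (one-sided derivatives at `±T`);
`v` is the velocity of `q`. -/
structure IsCollisionKepler (μ T : ℝ) (q : ℝ → ℂ) : Prop where
  continuousOn : ContinuousOn q (Icc (-T) T)
  collision : q 0 = 0
  no_other_collision : ∀ t ∈ Icc (-T) T, t ≠ 0 → q t ≠ 0
  negative_real : ∀ t ∈ Icc (-T) T, (q t).im = 0 ∧ (q t).re ≤ 0
  newton : ∃ v : ℝ → ℂ, ∀ t ∈ Icc (-T) T, t ≠ 0 →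
    HasDerivWithinAt q (v t) (Icc (-T) T) t ∧
    HasDerivWithinAt v (-(μ / ‖q t‖ ^ 3) • q t) (Icc (-T) T) t

/-- The potential `U(z, t) = μ / |z| + m / |z - q(t)|` (here `p = q(t)`), with values in `[0, ∞]`;
it equals `∞` at a collision `z = 0` or `z = p`. -/
def potential (μ m : ℝ) (p z : ℂ) : ℝ≥0∞ :=
  ENNReal.ofReal μ / ‖z‖ₑ + ENNReal.ofReal m / ‖z - p‖ₑ

/-- The action `∫_a^b (|x'|² / 2 + U(x, t)) dt`, with values in `[0, ∞]`. -/
def action (μ m : ℝ) (q : ℝ → ℂ) (a b : ℝ) (x : ℝ → ℂ) : ℝ≥0∞ :=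
  ∫⁻ t in Icc a b, (‖deriv x t‖ₑ ^ 2 / 2 + potential μ m (q t) (x t))

/-- Membership in `H¹([a, b], ℂ)` of the restriction of `x` to `[a, b]`: `x` is absolutely
continuous on `[a, b]` and its (almost everywhere defined) derivative is square integrable. -/
def IsH1Path (a b : ℝ) (x : ℝ → ℂ) : Prop :=
  AbsolutelyContinuousOnInterval x a b ∧ MemLp (deriv x) 2 (volume.restrict (Icc a b))

/-- The path space `{x ∈ H¹([a, b], ℂ) : x(a) ∈ A, x(b) ∈ B}`. -/
def pathSpace (a b : ℝ) (A B : Set ℂ) : Set (ℝ → ℂ) :=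
  {x | IsH1Path a b x ∧ x a ∈ A ∧ x b ∈ B}

/-- `z` minimizes the action over all paths in `pathSpace a b A B`. -/
def IsActionMinimizer (μ m : ℝ) (q : ℝ → ℂ) (a b : ℝ) (A B : Set ℂ) (z : ℝ → ℂ) : Prop :=
  z ∈ pathSpace a b A B ∧ IsMinOn (action μ m q a b) (pathSpace a b A B) z

end

/-! The minimizer is first shown to be a collision-free solution of Newton's equation on (-T, 0). It
is then placed on one side of the real axis, where its angular momentum controls the argument.

Regularity. The collision can be reached with finite action by a path whose height above the real
axis is of order (-t)^(2/3), so `z` has finite action. Replacing `z` on subintervals shows that it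
is minimal with fixed ends (`IsActionMinimizer.isTwoCenterMinimizer`). Away from the centres the du
Bois-Reymond argument gives the equation of motion (`IsTwoCenterMinimizer.euler_lagrange`). Interior
collisions are excluded locally (`ne_center_of_left`, `ne_centers`). On a disc of small radius ε
about the centre hit first, in coordinates moving with it, the other centre and the acceleration of
the frame cost only O(ε), whereas the Kepler action is of order √(κε). What remains is a
scale-invariant comparison. Calibrations by functions of the radius bound the action of a colliding
path from below, an explicit arc around the centre bounds the minimum from above, and
`collision_bounds_false` shows numerically that the two are incompatible.

Position. Both centres are real, so reflecting a piece of the path in the real axis preserves the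
action. If Im z(a) = 0 at an interior time, the path reflected after a is again a minimizer, hence
differentiable at a, and so Im z'(a) = 0. As Im z solves a linear equation y'' = -k y, it vanishes
identically. Thus on (-T, 0) the path is real, or lies in one open half plane (`im_trichotomy`). A
real path without collisions has constant argument 0 or π. In the lower case z(-T) must be real, and
conjugation reduces to the upper case.

Limit in the upper half plane. Write q = -ρ. The centre at 0 exerts no torque and the one on the
negative axis exerts a positive torque, so the angular momentum about 0 increases. It can never be
nonnegative: it would then stay above a positive constant, giving speed at least a multiple of
(-t)^(-1/2), which is not square integrable (`angularMomentum_neg`). So the argument strictly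
decreases. If it stayed above some η > 0, the orbit would be seen from both centres under angles
bounded away from 0 and π. The energy would give |z'|² ≤ C(1/ρ + 1/|z|), then |z| ≤ Kρ and angular
momentum of size at most B√ρ, while the torque would be at least a multiple of |z|/ρ². These rates
force the argument to drop by a fixed amount on every interval [s, s/2], which is impossible
(`angle_not_bounded`, `exists_arg_lt`). Hence the limit is 0. -/

noncomputable section

open scoped InnerProductSpace

/-! ### Paths with square integrable derivative -/

/-- `x` is a primitive on `[a, b]` of the square integrable function `g`. -/
structure HasL2Deriv (x g : ℝ → ℂ) (a b : ℝ) : Prop where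
  memLp : MemLp g 2 (volume.restrict (Icc a b))
  eq_add_integral : ∀ t ∈ Icc a b, x t = x a + ∫ s in a..t, g s

namespace HasL2Deriv

variable {x y g h : ℝ → ℂ} {a b c : ℝ}

theorem integrableOn (hx : HasL2Deriv x g a b) : IntegrableOn g (Icc a b) :=
  hx.memLp.integrable (by norm_num)

theorem intervalIntegrable (hx : HasL2Deriv x g a b) {s t : ℝ} (hs : s ∈ Icc a b)
    (ht : t ∈ Icc a b) : IntervalIntegrable g volume s t :=
  (hx.integrableOn.mono_set (uIcc_subset_Icc hs ht)).intervalIntegrable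

theorem sub_eq_integral (hx : HasL2Deriv x g a b) {s t : ℝ} (hs : s ∈ Icc a b)
    (ht : t ∈ Icc a b) : x t - x s = ∫ u in s..t, g u := by
  have ha : a ∈ Icc a b := ⟨le_rfl, hs.1.trans hs.2⟩
  rw [hx.eq_add_integral t ht, hx.eq_add_integral s hs,
    ← intervalIntegral.integral_interval_sub_left (hx.intervalIntegrable ha ht)
      (hx.intervalIntegrable ha hs)]
  ring

theorem mono (hx : HasL2Deriv x g a b) {s t : ℝ} (hs : a ≤ s) (ht : t ≤ b) :
    HasL2Deriv x g s t where
  memLp := hx.memLp.mono_measure (Measure.restrict_mono (Icc_subset_Icc hs ht) le_rfl)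
  eq_add_integral u hu := by
    rw [← hx.sub_eq_integral ⟨hs, (hu.1.trans hu.2).trans ht⟩ ⟨hs.trans hu.1, hu.2.trans ht⟩]
    ring

theorem continuousOn (hx : HasL2Deriv x g a b) : ContinuousOn x (Icc a b) := by
  rcases le_or_gt a b with hab | hab
  · have h1 : ContinuousOn (fun t => x a + ∫ s in a..t, g s) (Icc a b) := by
      have := intervalIntegral.continuousOn_primitive_interval (a := a) (b := b) (f := g)
        (μ := volume) (by rw [uIcc_of_le hab]; exact hx.integrableOn)
      rw [uIcc_of_le hab] at this
      exact continuousOn_const.add this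
    exact h1.congr hx.eq_add_integral
  · simp [hab]

theorem congr_deriv (hx : HasL2Deriv x g a b) (hgh : g =ᵐ[volume.restrict (Icc a b)] h) :
    HasL2Deriv x h a b where
  memLp := hx.memLp.ae_eq hgh
  eq_add_integral t ht := by
    rw [hx.eq_add_integral t ht]
    congr 1
    refine intervalIntegral.integral_congr_ae ?_
    rw [Filter.EventuallyEq, ae_restrict_iff' measurableSet_Icc] at hgh
    filter_upwards [hgh] with u hu hut
    rw [uIoc_of_le ht.1] at hut
    exact hu ⟨hut.1.le, hut.2.trans ht.2⟩

theorem add (hx : HasL2Deriv x g a b) (hy : HasL2Deriv y h a b) :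
    HasL2Deriv (fun t => x t + y t) (fun t => g t + h t) a b where
  memLp := hx.memLp.add hy.memLp
  eq_add_integral t ht := by
    have ha : a ∈ Icc a b := ⟨le_rfl, ht.1.trans ht.2⟩
    rw [intervalIntegral.integral_add (hx.intervalIntegrable ha ht) (hy.intervalIntegrable ha ht),
      hx.eq_add_integral t ht, hy.eq_add_integral t ht]
    ring

theorem const_smul (hx : HasL2Deriv x g a b) (r : ℝ) :
    HasL2Deriv (fun t => r • x t) (fun t => r • g t) a b where
  memLp := hx.memLp.const_smul r
  eq_add_integral t ht := by
    rw [intervalIntegral.integral_smul, hx.eq_add_integral t ht, smul_add]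

theorem sub (hx : HasL2Deriv x g a b) (hy : HasL2Deriv y h a b) :
    HasL2Deriv (fun t => x t - y t) (fun t => g t - h t) a b := by
  simpa [sub_eq_add_neg] using hx.add (hy.const_smul (-1))

theorem conj (hx : HasL2Deriv x g a b) :
    HasL2Deriv (fun t => (starRingEnd ℂ) (x t)) (fun t => (starRingEnd ℂ) (g t)) a b where
  memLp := by
    refine (memLp_congr_norm ?_ hx.memLp.1 (by simp)).2 hx.memLp
    exact Complex.continuous_conj.comp_aestronglyMeasurable hx.memLp.1
  eq_add_integral t ht := by
    rw [hx.eq_add_integral t ht, map_add, intervalIntegral.integral_of_le ht.1,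
      intervalIntegral.integral_of_le ht.1, integral_conj]

theorem of_hasDerivAt (hc : ContinuousOn x (Icc a b))
    (hd : ∀ t ∈ Ioo a b, HasDerivAt x (g t) t) (hg : MemLp g 2 (volume.restrict (Icc a b))) :
    HasL2Deriv x g a b where
  memLp := hg
  eq_add_integral t ht := by
    have hi : IntegrableOn g (Icc a b) := hg.integrable (by norm_num)
    rw [intervalIntegral.integral_eq_sub_of_hasDerivAt_of_le ht.1
      (hc.mono (Icc_subset_Icc_right ht.2)) (fun u hu => hd u ⟨hu.1, hu.2.trans_le ht.2⟩)
      ((hi.mono_set (by rw [uIcc_of_le ht.1]; exact Icc_subset_Icc_right ht.2)).intervalIntegrable)]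
    ring

theorem of_continuousOn (hc : ContinuousOn x (Icc a b))
    (hd : ∀ t ∈ Ioo a b, HasDerivAt x (g t) t) (hg : ContinuousOn g (Icc a b)) :
    HasL2Deriv x g a b := by
  refine of_hasDerivAt hc hd ?_
  obtain ⟨C, hC⟩ := isCompact_Icc.exists_bound_of_continuousOn hg
  have : MemLp g ∞ (volume.restrict (Icc a b)) :=
    memLp_top_of_bound (hg.aestronglyMeasurable measurableSet_Icc) C
      ((ae_restrict_iff' measurableSet_Icc).2 (Eventually.of_forall hC))
  exact this.mono_exponent le_top

/-- Concatenation of two paths. -/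
theorem glue (hab : a ≤ b) (hbc : b ≤ c) (hx : HasL2Deriv x g a b) (hy : HasL2Deriv y h b c)
    (hxy : x b = y b) :
    HasL2Deriv (fun t => if t ≤ b then x t else y t) (fun t => if t ≤ b then g t else h t) a c := by
  classical
  have hm1 : MemLp (fun t => if t ≤ b then g t else h t) 2 (volume.restrict (Icc a b)) :=
    hx.memLp.ae_eq ((ae_restrict_iff' measurableSet_Icc).2 (Eventually.of_forall fun t ht => by
      simp [ht.2]))
  have hm2 : MemLp (fun t => if t ≤ b then g t else h t) 2 (volume.restrict (Icc b c)) := by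
    refine hy.memLp.ae_eq ?_
    have hne : ∀ᵐ t ∂(volume.restrict (Icc b c)), t ≠ b :=
      ae_restrict_of_ae (by simp [ae_iff, measure_singleton])
    filter_upwards [hne, ae_restrict_mem measurableSet_Icc] with t ht1 ht2
    have : ¬ t ≤ b := not_le.2 (lt_of_le_of_ne ht2.1 (Ne.symm ht1))
    simp [this]
  have hm : MemLp (fun t => if t ≤ b then g t else h t) 2 (volume.restrict (Icc a c)) := by
    rw [← Icc_union_Icc_eq_Icc hab hbc]
    refine (memLp_two_iff_integrable_sq_norm ?_).2 ?_
    · exact (aestronglyMeasurable_union_iff).2 ⟨hm1.1, hm2.1⟩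
    · exact IntegrableOn.union ((memLp_two_iff_integrable_sq_norm hm1.1).1 hm1)
        ((memLp_two_iff_integrable_sq_norm hm2.1).1 hm2)
  have hint : IntegrableOn (fun t => if t ≤ b then g t else h t) (Icc a c) :=
    hm.integrable (by norm_num)
  have e1 : ∀ t ∈ Icc a b, ∫ s in a..t, (if s ≤ b then g s else h s) = ∫ s in a..t, g s := by
    intro t ht
    refine intervalIntegral.integral_congr fun u hu => ?_
    rw [uIcc_of_le ht.1] at hu
    simp [hu.2.trans ht.2]
  refine ⟨hm, fun t ht => ?_⟩
  rcases le_or_gt t b with htb | htb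
  · simp only [htb, if_true, hab, if_true]
    rw [e1 t ⟨ht.1, htb⟩, hx.eq_add_integral t ⟨ht.1, htb⟩]
  · simp only [not_le.2 htb, if_false, hab, if_true]
    have i1 : IntervalIntegrable (fun t => if t ≤ b then g t else h t) volume a b :=
      (hint.mono_set (by rw [uIcc_of_le hab]; exact Icc_subset_Icc_right hbc)).intervalIntegrable
    have i2 : IntervalIntegrable (fun t => if t ≤ b then g t else h t) volume b t :=
      (hint.mono_set (by rw [uIcc_of_le htb.le]; exact Icc_subset_Icc hab ht.2)).intervalIntegrable
    rw [← intervalIntegral.integral_add_adjacent_intervals i1 i2, e1 b ⟨hab, le_rfl⟩]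
    have e2 : ∫ s in b..t, (if s ≤ b then g s else h s) = ∫ s in b..t, h s := by
      refine intervalIntegral.integral_congr_ae (Eventually.of_forall fun u hu => ?_)
      rw [uIoc_of_le htb.le] at hu
      simp [not_le.2 hu.1]
    rw [e2, hy.eq_add_integral t ⟨htb.le, ht.2⟩, ← hxy, hx.eq_add_integral b ⟨hab, le_rfl⟩]
    ring

theorem ae_hasDerivAt (hab : a ≤ b) (hx : HasL2Deriv x g a b) :
    ∀ᵐ t ∂(volume.restrict (Icc a b)), HasDerivAt x (g t) t := by
  have hi := hx.intervalIntegrable (left_mem_Icc.2 hab) (right_mem_Icc.2 hab)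
  have hne : ∀ᵐ t : ℝ, t ≠ a ∧ t ≠ b := by
    have h1 : ∀ᵐ t : ℝ, t ≠ a := by simp [ae_iff, measure_singleton]
    have h2 : ∀ᵐ t : ℝ, t ≠ b := by simp [ae_iff, measure_singleton]
    exact h1.and h2
  rw [ae_restrict_iff' measurableSet_Icc]
  filter_upwards [hi.ae_hasDerivAt_integral, hne] with t ht hn htI
  rw [uIcc_of_le hab] at ht
  have hd := (ht htI a (left_mem_Icc.2 hab)).const_add (x a)
  refine hd.congr_of_eventuallyEq ?_
  filter_upwards [Icc_mem_nhds (lt_of_le_of_ne htI.1 (Ne.symm hn.1)) (lt_of_le_of_ne htI.2 hn.2)]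
    with u hu using hx.eq_add_integral u hu

theorem deriv_ae_eq (hab : a ≤ b) (hx : HasL2Deriv x g a b) :
    deriv x =ᵐ[volume.restrict (Icc a b)] g := by
  filter_upwards [hx.ae_hasDerivAt hab] with t ht using ht.deriv

theorem absolutelyContinuous_re (hab : a ≤ b) (hx : HasL2Deriv x g a b) :
    AbsolutelyContinuousOnInterval (fun t => (x t).re) a b := by
  have hi := hx.intervalIntegrable (left_mem_Icc.2 hab) (right_mem_Icc.2 hab)
  have hr : IntervalIntegrable (fun t => (g t).re) volume a b := ⟨hi.1.re, hi.2.re⟩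
  have h1 := hr.absolutelyContinuousOnInterval_intervalIntegral (c := a) left_mem_uIcc
  have hk : AbsolutelyContinuousOnInterval (fun _ : ℝ => (x a).re) a b :=
    ((LipschitzWith.const (α := ℝ) (x a).re).lipschitzOnWith (s := uIcc a b)).absolutelyContinuousOnInterval
  have h2 := hk.fun_add h1
  refine Tendsto.congr' ?_ h2
  -- Absolute continuity only tests families of subintervals of [a, b], so the integral formula,
  -- valid on [a, b] alone, suffices.
  refine eventually_inf_principal.2 (Eventually.of_forall fun E hE => ?_)
  refine Finset.sum_congr rfl fun i hi' => ?_
  have hmem := hE.1 i hi'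
  rw [uIcc_of_le hab] at hmem
  have key : ∀ t ∈ Icc a b, (x t).re = (x a).re + ∫ s in a..t, (g s).re := by
    intro t ht
    have h5 := hx.eq_add_integral t ht
    have h6 := (Complex.reCLM).intervalIntegral_comp_comm
      (hx.intervalIntegrable (left_mem_Icc.2 hab) ht)
    simp only [Complex.reCLM_apply] at h6
    rw [h5, Complex.add_re, h6]
  simp only [key _ hmem.1, key _ hmem.2]

theorem mul_I (hx : HasL2Deriv x g a b) :
    HasL2Deriv (fun t => -Complex.I * x t) (fun t => -Complex.I * g t) a b where
  memLp := hx.memLp.const_mul _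
  eq_add_integral t ht := by
    rw [intervalIntegral.integral_const_mul, hx.eq_add_integral t ht, mul_add]

theorem absolutelyContinuous_im (hab : a ≤ b) (hx : HasL2Deriv x g a b) :
    AbsolutelyContinuousOnInterval (fun t => (x t).im) a b := by
  simpa using hx.mul_I.absolutelyContinuous_re hab

theorem isH1Path (hab : a ≤ b) (hx : HasL2Deriv x g a b) : IsH1Path a b x := by
  refine ⟨?_, hx.memLp.ae_eq (hx.deriv_ae_eq hab).symm⟩
  have h1 := hx.absolutelyContinuous_re hab
  have h2 := hx.absolutelyContinuous_im hab
  have h3 := squeeze_zero (f := fun E : ℕ × (ℕ → ℝ × ℝ) =>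
      ∑ i ∈ Finset.range E.1, dist (x (E.2 i).1) (x (E.2 i).2)) (fun E => by positivity)
    (fun E => ?_) (by simpa using Tendsto.add h1 h2)
  · exact h3
  · rw [← Finset.sum_add_distrib]
    refine Finset.sum_le_sum fun i _ => ?_
    rw [Complex.dist_eq, Real.dist_eq, Real.dist_eq, ← Complex.sub_re, ← Complex.sub_im]
    exact Complex.norm_le_abs_re_add_abs_im _

/-- Integration by parts for the real inner product of two paths. -/
theorem integral_inner_add (hab : a ≤ b) (hx : HasL2Deriv x g a b) (hy : HasL2Deriv y h a b) :
    ∫ t in a..b, (⟪g t, y t⟫_ℝ + ⟪x t, h t⟫_ℝ) = ⟪x b, y b⟫_ℝ - ⟪x a, y a⟫_ℝ := by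
  have hin : ∀ v w : ℂ, ⟪v, w⟫_ℝ = v.re * w.re + v.im * w.im := by
    intro v w
    rw [Complex.inner]
    simp
    ring
  have hac : AbsolutelyContinuousOnInterval (fun t => ⟪x t, y t⟫_ℝ) a b := by
    simp only [hin]
    exact ((hx.absolutelyContinuous_re hab).fun_mul (hy.absolutelyContinuous_re hab)).fun_add
      ((hx.absolutelyContinuous_im hab).fun_mul (hy.absolutelyContinuous_im hab))
  rw [← hac.integral_deriv_eq_sub]
  refine intervalIntegral.integral_congr_ae ?_
  have h1 := hx.ae_hasDerivAt hab
  have h2 := hy.ae_hasDerivAt hab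
  rw [ae_restrict_iff' measurableSet_Icc] at h1 h2
  filter_upwards [h1, h2] with t ht1 ht2 htI
  rw [uIoc_of_le hab] at htI
  have htI' : t ∈ Icc a b := ⟨htI.1.le, htI.2⟩
  have := (ht1 htI').inner ℝ (ht2 htI')
  rw [this.deriv, add_comm]

end HasL2Deriv

/-- The real and imaginary parts are absolutely continuous, hence differentiable almost everywhere
and equal to the integrals of their derivatives. Working with a chosen representative of the
derivative makes sums, conjugates and concatenations immediate. -/
theorem isH1Path_iff {x : ℝ → ℂ} {a b : ℝ} (hab : a ≤ b) :
    IsH1Path a b x ↔ HasL2Deriv x (deriv x) a b := by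
  refine ⟨fun ⟨hac, hL⟩ => ⟨hL, fun t ht => ?_⟩, fun h => h.isH1Path hab⟩
  have hac' : AbsolutelyContinuousOnInterval x a t :=
    hac.mono (by rw [uIcc_of_le ht.1, uIcc_of_le hab]; exact Icc_subset_Icc_right ht.2)
  have hproj : ∀ f : ℂ →L[ℝ] ℝ, (∀ v, |f v| ≤ ‖v‖) →
      AbsolutelyContinuousOnInterval (fun t => f (x t)) a t := by
    intro f hf
    refine squeeze_zero (fun E => by positivity) (fun E => ?_) hac'
    refine Finset.sum_le_sum fun i _ => ?_
    rw [Real.dist_eq, ← map_sub, dist_eq_norm]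
    exact hf _
  have hre := hproj Complex.reCLM Complex.abs_re_le_norm
  have him := hproj Complex.imCLM Complex.abs_im_le_norm
  have hdiff : ∀ᵐ u, u ∈ uIoc a t → DifferentiableAt ℝ x u := by
    filter_upwards [hre.ae_differentiableAt, him.ae_differentiableAt] with u h1 h2 hu
    have hu' := uIoc_subset_uIcc hu
    have e : x = fun s => (((Complex.reCLM (x s) : ℝ) : ℂ) + ((Complex.imCLM (x s) : ℝ) : ℂ) * Complex.I) := by
      ext s; simp [Complex.re_add_im]
    rw [e]
    exact (Complex.ofRealCLM.differentiableAt.comp u (h1 hu')).add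
      ((Complex.ofRealCLM.differentiableAt.comp u (h2 hu')).mul_const _)
  have hi : IntervalIntegrable (deriv x) volume a t := by
    have : IntegrableOn (deriv x) (Icc a b) := hL.integrable (by norm_num)
    exact (this.mono_set (by rw [uIcc_of_le ht.1]; exact Icc_subset_Icc_right ht.2)).intervalIntegrable
  have key : ∀ f : ℂ →L[ℝ] ℝ, AbsolutelyContinuousOnInterval (fun t => f (x t)) a t →
      f (∫ s in a..t, deriv x s) = f (x t) - f (x a) := by
    intro f hf
    rw [← f.intervalIntegral_comp_comm hi, ← hf.integral_deriv_eq_sub]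
    refine intervalIntegral.integral_congr_ae ?_
    filter_upwards [hdiff] with u hu huI
    exact ((f.hasFDerivAt.comp_hasDerivAt u (hu huI).hasDerivAt).deriv).symm
  have k1 := key _ hre
  have k2 := key _ him
  simp only [Complex.reCLM_apply, Complex.imCLM_apply] at k1 k2
  apply Complex.ext
  · rw [Complex.add_re]; linarith
  · rw [Complex.add_im]; linarith

/-! ### Two moving centres and fixed-end minimality -/

/-- The Lagrangian of a particle attracted by two moving centres. -/
def lagrangian (κ₁ κ₂ : ℝ) (c₁ c₂ x g : ℝ → ℂ) (t : ℝ) : ℝ :=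
  ‖g t‖ ^ 2 / 2 + κ₁ / ‖x t - c₁ t‖ + κ₂ / ‖x t - c₂ t‖

/-- The force exerted by two moving centres on a particle at `x t`. -/
def force (κ₁ κ₂ : ℝ) (c₁ c₂ x : ℝ → ℂ) (t : ℝ) : ℂ :=
  -(κ₁ / ‖x t - c₁ t‖ ^ 3) • (x t - c₁ t) - (κ₂ / ‖x t - c₂ t‖ ^ 3) • (x t - c₂ t)

/-- `z`, with derivative `g`, has finite action on `[a, b]` and minimizes it with fixed ends on every
subinterval, among the paths which avoid both centres. -/
structure IsTwoCenterMinimizer (κ₁ κ₂ : ℝ) (c₁ c₂ : ℝ → ℂ) (a b : ℝ) (z g : ℝ → ℂ) : Prop where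
  hasL2Deriv : HasL2Deriv z g a b
  integrableOn : IntegrableOn (lagrangian κ₁ κ₂ c₁ c₂ z g) (Icc a b)
  ae_ne : ∀ᵐ t ∂(volume.restrict (Icc a b)), z t ≠ c₁ t ∧ z t ≠ c₂ t
  le : ∀ s t : ℝ, ∀ x h : ℝ → ℂ, a ≤ s → s < t → t ≤ b → HasL2Deriv x h s t → x s = z s →
    x t = z t → (∀ u ∈ Icc s t, x u ≠ c₁ u ∧ x u ≠ c₂ u) →
    ∫ u in s..t, lagrangian κ₁ κ₂ c₁ c₂ z g u ≤ ∫ u in s..t, lagrangian κ₁ κ₂ c₁ c₂ x h u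

theorem lagrangian_swap (κ₁ κ₂ : ℝ) (c₁ c₂ x g : ℝ → ℂ) :
    lagrangian κ₁ κ₂ c₁ c₂ x g = lagrangian κ₂ κ₁ c₂ c₁ x g := by
  ext t
  simp only [lagrangian]
  ring

theorem IsTwoCenterMinimizer.swap {κ₁ κ₂ : ℝ} {c₁ c₂ : ℝ → ℂ} {a b : ℝ} {z g : ℝ → ℂ}
    (M : IsTwoCenterMinimizer κ₁ κ₂ c₁ c₂ a b z g) :
    IsTwoCenterMinimizer κ₂ κ₁ c₂ c₁ a b z g where
  hasL2Deriv := M.hasL2Deriv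
  integrableOn := by rw [lagrangian_swap]; exact M.integrableOn
  ae_ne := M.ae_ne.mono fun t h => h.symm
  le s t x h hs hst ht hx h1 h2 hn := by
    rw [lagrangian_swap, lagrangian_swap κ₂]
    exact M.le s t x h hs hst ht hx h1 h2 fun u hu => (hn u hu).symm

theorem HasL2Deriv.integrableOn_sq {x g : ℝ → ℂ} {a b : ℝ} (hx : HasL2Deriv x g a b) :
    IntegrableOn (fun t => ‖g t‖ ^ 2) (Icc a b) :=
  (memLp_two_iff_integrable_sq_norm hx.memLp.1).1 hx.memLp

theorem HasL2Deriv.integrableOn_inner {x y g h : ℝ → ℂ} {a b : ℝ} (hx : HasL2Deriv x g a b)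
    (hy : HasL2Deriv y h a b) : IntegrableOn (fun t => ⟪g t, h t⟫_ℝ) (Icc a b) := by
  refine Integrable.mono' (hx.integrableOn_sq.add hy.integrableOn_sq)
    (hx.memLp.1.inner hy.memLp.1) (Eventually.of_forall fun t => ?_)
  have := norm_inner_le_norm (𝕜 := ℝ) (g t) (h t)
  simp only [Pi.add_apply]
  nlinarith [sq_nonneg (‖g t‖ - ‖h t‖), sq_nonneg ‖g t‖, sq_nonneg ‖h t‖]

theorem continuousOn_div_norm {κ : ℝ} {c x : ℝ → ℂ} {s : Set ℝ} (hx : ContinuousOn x s)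
    (hc : ContinuousOn c s) (hn : ∀ u ∈ s, x u ≠ c u) :
    ContinuousOn (fun t => κ / ‖x t - c t‖) s :=
  continuousOn_const.div (hx.sub hc).norm fun u hu => by
    simpa [sub_eq_zero] using hn u hu

theorem continuousOn_force {κ₁ κ₂ : ℝ} {c₁ c₂ x : ℝ → ℂ} {s : Set ℝ} (hx : ContinuousOn x s)
    (hc₁ : ContinuousOn c₁ s) (hc₂ : ContinuousOn c₂ s) (hn : ∀ u ∈ s, x u ≠ c₁ u ∧ x u ≠ c₂ u) :
    ContinuousOn (force κ₁ κ₂ c₁ c₂ x) s := by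
  have h : ∀ (κ : ℝ) (c : ℝ → ℂ), ContinuousOn c s → (∀ u ∈ s, x u ≠ c u) →
      ContinuousOn (fun t => (κ / ‖x t - c t‖ ^ 3) • (x t - c t)) s := fun κ c hc hn =>
    (continuousOn_const.div ((hx.sub hc).norm.pow 3) fun u hu => by
      simpa [sub_eq_zero] using hn u hu).smul (hx.sub hc)
  have e : force κ₁ κ₂ c₁ c₂ x = fun t => -((κ₁ / ‖x t - c₁ t‖ ^ 3) • (x t - c₁ t)) -
      (κ₂ / ‖x t - c₂ t‖ ^ 3) • (x t - c₂ t) := by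
    ext1 t
    simp only [force, neg_smul]
  rw [e]
  exact (h κ₁ c₁ hc₁ fun u hu => (hn u hu).1).neg.sub (h κ₂ c₂ hc₂ fun u hu => (hn u hu).2)

theorem HasL2Deriv.integrableOn_lagrangian {κ₁ κ₂ : ℝ} {c₁ c₂ x g : ℝ → ℂ} {a b : ℝ}
    (hx : HasL2Deriv x g a b) (hc₁ : ContinuousOn c₁ (Icc a b)) (hc₂ : ContinuousOn c₂ (Icc a b))
    (hn : ∀ u ∈ Icc a b, x u ≠ c₁ u ∧ x u ≠ c₂ u) :
    IntegrableOn (lagrangian κ₁ κ₂ c₁ c₂ x g) (Icc a b) :=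
  ((hx.integrableOn_sq.div_const 2).add
    (continuousOn_div_norm hx.continuousOn hc₁ fun u hu => (hn u hu).1).integrableOn_Icc).add
    (continuousOn_div_norm hx.continuousOn hc₂ fun u hu => (hn u hu).2).integrableOn_Icc

/-! ### First variation and the Euler-Lagrange equation -/

/-- Second order upper bound for the Newtonian potential. -/
theorem one_div_norm_add_le {w η : ℂ} {r : ℝ} (hr : 0 < r) (hw : 2 * r ≤ ‖w‖) (hη : ‖η‖ ≤ r) :
    1 / ‖w + η‖ ≤ 1 / ‖w‖ - ⟪w, η⟫_ℝ / ‖w‖ ^ 3 + ‖η‖ ^ 2 / r ^ 3 := by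
  have hsq : ‖w + η‖ ^ 2 = ‖w‖ ^ 2 + 2 * ⟪w, η⟫_ℝ + ‖η‖ ^ 2 := norm_add_sq_real w η
  have hb : r ≤ ‖w + η‖ := by
    have := norm_sub_le (w + η) η
    simp only [add_sub_cancel_right] at this
    linarith
  have hab : |‖w‖ - ‖w + η‖| ≤ ‖η‖ := by
    have := abs_norm_sub_norm_le w (w + η)
    simpa using this
  generalize ‖w + η‖ = b at *
  generalize ‖w‖ = a at *
  generalize ‖η‖ = e at *
  generalize ⟪w, η⟫_ℝ = s at *
  have ha0 : 0 < a := by linarith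
  have hb0 : 0 < b := by linarith
  have hs : s = (b ^ 2 - a ^ 2 - e ^ 2) / 2 := by linarith
  -- An exact remainder formula. The middle term is nonnegative because |a - b| ≤ e, and the last
  -- because a ≥ 2r and b ≥ r.
  have key : 1 / a - s / a ^ 3 + e ^ 2 / r ^ 3 - 1 / b =
      (e ^ 2 / (2 * a ^ 3)) + (e ^ 2 - (a - b) ^ 2) * (1 / (a ^ 2 * b) + 1 / (2 * a ^ 3)) +
      e ^ 2 * (1 / r ^ 3 - (1 / (a ^ 2 * b) + 1 / (2 * a ^ 3))) := by
    rw [hs]; field_simp; ring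
  have h1 : (a - b) ^ 2 ≤ e ^ 2 := by
    have := sq_le_sq' (by linarith [neg_abs_le (a - b), abs_nonneg (a-b)]) ((le_abs_self _).trans hab)
    linarith
  have h2 : 1 / (a ^ 2 * b) ≤ 1 / (2 * r ^ 3) := by
    apply one_div_le_one_div_of_le (by positivity)
    have : (2 * r) ^ 2 ≤ a ^ 2 := by gcongr
    calc 2 * r ^ 3 ≤ (2 * r) ^ 2 * r := by nlinarith [pow_pos hr 3]
      _ ≤ a ^ 2 * b := by gcongr
  have h3 : 1 / (2 * a ^ 3) ≤ 1 / (2 * r ^ 3) := by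
    apply one_div_le_one_div_of_le (by positivity)
    have : r ^ 3 ≤ a ^ 3 := by gcongr; linarith
    linarith
  have h4 : 1 / (2 * r ^ 3) + 1 / (2 * r ^ 3) = 1 / r ^ 3 := by field_simp; ring
  have h5 : 0 ≤ (e ^ 2 - (a - b) ^ 2) * (1 / (a ^ 2 * b) + 1 / (2 * a ^ 3)) :=
    mul_nonneg (by linarith) (by positivity)
  have h6 : 0 ≤ e ^ 2 * (1 / r ^ 3 - (1 / (a ^ 2 * b) + 1 / (2 * a ^ 3))) :=
    mul_nonneg (by positivity) (by linarith)
  have h7 : 0 ≤ e ^ 2 / (2 * a ^ 3) := by positivity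
  linarith

/-- For small `s` of sign opposite to `I` the linear term dominates. Thanks to this, the first
variation needs only a quadratic upper bound for the perturbed Lagrangian, not differentiation under
the integral. -/
theorem eq_zero_of_forall_add_sq_nonneg {I B l : ℝ} (hl : 0 < l)
    (h : ∀ s : ℝ, |s| ≤ l → 0 ≤ s * I + s ^ 2 * B) : I = 0 := by
  by_contra hI
  have hB : 0 < |B| + 1 := by positivity
  have hI' : 0 < |I| := abs_pos.2 hI
  set m := min l (|I| / (2 * (|B| + 1))) with hm
  have hm0 : 0 < m := by positivity
  have h1 : m ≤ |I| / (2 * (|B| + 1)) := min_le_right _ _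
  have h2 : m * (2 * (|B| + 1)) ≤ |I| := by rwa [le_div_iff₀ (by positivity)] at h1
  have h3 : m ^ 2 * B ≤ m * (|I| / 2) := by
    have : B ≤ |B| := le_abs_self B
    nlinarith
  rcases abs_cases I with ⟨e, _⟩ | ⟨e, _⟩
  · have := h (-m) (by rw [abs_neg, abs_of_pos hm0]; exact min_le_left _ _)
    nlinarith [mul_pos hm0 hI']
  · have := h m (by rw [abs_of_pos hm0]; exact min_le_left _ _)
    nlinarith [mul_pos hm0 hI']

namespace IsTwoCenterMinimizer

variable {κ₁ κ₂ : ℝ} {c₁ c₂ : ℝ → ℂ} {a b : ℝ} {z g : ℝ → ℂ}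

theorem first_variation (M : IsTwoCenterMinimizer κ₁ κ₂ c₁ c₂ a b z g) (hκ₁ : 0 < κ₁) (hκ₂ : 0 < κ₂)
    (hc₁ : ContinuousOn c₁ (Icc a b)) (hc₂ : ContinuousOn c₂ (Icc a b)) {s t r : ℝ} (hs : a ≤ s)
    (hst : s < t) (ht : t ≤ b) (hr : 0 < r) (h₁ : ∀ u ∈ Icc s t, 2 * r ≤ ‖z u - c₁ u‖)
    (h₂ : ∀ u ∈ Icc s t, 2 * r ≤ ‖z u - c₂ u‖) {η h : ℝ → ℂ} (hη : HasL2Deriv η h s t)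
    (hηs : η s = 0) (hηt : η t = 0) :
    ∫ u in s..t, (⟪g u, h u⟫_ℝ + ⟪force κ₁ κ₂ c₁ c₂ z u, η u⟫_ℝ) = 0 := by
  have hsub : Icc s t ⊆ Icc a b := Icc_subset_Icc hs ht
  have hz := M.hasL2Deriv.mono hs ht
  have hzc := hz.continuousOn
  have hn : ∀ u ∈ Icc s t, z u ≠ c₁ u ∧ z u ≠ c₂ u := fun u hu =>
    ⟨fun e => by have := h₁ u hu; rw [e] at this; simp at this; linarith,
      fun e => by have := h₂ u hu; rw [e] at this; simp at this; linarith⟩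
  have hF := continuousOn_force (κ₁ := κ₁) (κ₂ := κ₂) hzc (hc₁.mono hsub) (hc₂.mono hsub) hn
  obtain ⟨N, hN⟩ := isCompact_Icc.exists_bound_of_continuousOn hη.continuousOn
  have hN1 : ∀ u ∈ Icc s t, ‖η u‖ ≤ |N| + 1 := fun u hu =>
    (hN u hu).trans (by linarith [le_abs_self N])
  set N' := |N| + 1 with hN'
  have hN'0 : 0 < N' := by positivity
  set K := (κ₁ + κ₂) / r ^ 3 * N' ^ 2 with hK
  have i1 : IntegrableOn (fun u => ⟪g u, h u⟫_ℝ + ⟪force κ₁ κ₂ c₁ c₂ z u, η u⟫_ℝ) (Icc s t) :=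
    (hz.integrableOn_inner hη).add (hF.inner hη.continuousOn).integrableOn_Icc
  have i2 : IntegrableOn (fun u => ‖h u‖ ^ 2 / 2 + K) (Icc s t) :=
    (hη.integrableOn_sq.div_const 2).add
      (integrableOn_const (by simp))
  have i3 := M.integrableOn.mono_set hsub
  have toI : ∀ {f : ℝ → ℝ}, IntegrableOn f (Icc s t) → IntervalIntegrable f volume s t :=
    fun hf => (hf.mono_set (by rw [uIcc_of_le hst.le])).intervalIntegrable
  -- The range |l| ≤ r/N' keeps the perturbation l • η below r, hence the perturbed path away from
  -- both centres.
  refine eq_zero_of_forall_add_sq_nonneg (l := r / N') (B := ∫ u in s..t, (‖h u‖ ^ 2 / 2 + K))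
    (by positivity) fun l hl => ?_
  have hx := hz.add (hη.const_smul l)
  have hsm : ∀ u ∈ Icc s t, ‖l • η u‖ ≤ r := fun u hu => by
    rw [norm_smul, Real.norm_eq_abs]
    calc |l| * ‖η u‖ ≤ r / N' * N' := by gcongr; exact hN1 u hu
      _ = r := by field_simp
  have hxn : ∀ u ∈ Icc s t, z u + l • η u ≠ c₁ u ∧ z u + l • η u ≠ c₂ u := by
    have aux : ∀ (u : ℝ) (c : ℂ), u ∈ Icc s t → 2 * r ≤ ‖z u - c‖ → z u + l • η u ≠ c := by
      intro u c hu h e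
      have : z u - c = -(l • η u) := by rw [← e]; ring
      rw [this, norm_neg] at h
      linarith [hsm u hu]
    exact fun u hu => ⟨aux u _ hu (h₁ u hu), aux u _ hu (h₂ u hu)⟩
  have hle := M.le s t _ _ hs hst ht hx (by simp [hηs]) (by simp [hηt]) hxn
  have i4 := hx.integrableOn_lagrangian (κ₁ := κ₁) (κ₂ := κ₂) (hc₁.mono hsub) (hc₂.mono hsub) hxn
  have hmono : ∫ u in s..t, lagrangian κ₁ κ₂ c₁ c₂ (fun u => z u + l • η u)
      (fun u => g u + l • h u) u ≤ ∫ u in s..t, (lagrangian κ₁ κ₂ c₁ c₂ z g u +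
        l * (⟪g u, h u⟫_ℝ + ⟪force κ₁ κ₂ c₁ c₂ z u, η u⟫_ℝ) + l ^ 2 * (‖h u‖ ^ 2 / 2 + K)) := by
    refine intervalIntegral.integral_mono_on hst.le (toI i4)
      (toI ((i3.add (i1.const_mul l)).add (i2.const_mul (l ^ 2)))) fun u hu => ?_
    have hk : ‖g u + l • h u‖ ^ 2 = ‖g u‖ ^ 2 + 2 * (l * ⟪g u, h u⟫_ℝ) + l ^ 2 * ‖h u‖ ^ 2 := by
      rw [norm_add_sq_real, real_inner_smul_right, norm_smul, Real.norm_eq_abs, mul_pow, sq_abs]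
    have hp : ∀ (κ : ℝ) (c : ℂ), 0 < κ → 2 * r ≤ ‖z u - c‖ → κ / ‖z u + l • η u - c‖ ≤
        κ / ‖z u - c‖ + l * (-(κ / ‖z u - c‖ ^ 3) * ⟪z u - c, η u⟫_ℝ) +
          l ^ 2 * (κ / r ^ 3 * N' ^ 2) := by
      intro κ c hκ hc
      have := one_div_norm_add_le hr hc (hsm u hu)
      rw [show z u - c + l • η u = z u + l • η u - c by ring, real_inner_smul_right, norm_smul,
        Real.norm_eq_abs, mul_pow, sq_abs] at this
      have h3 : ‖η u‖ ^ 2 ≤ N' ^ 2 := by gcongr; exact hN1 u hu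
      have h4 : l ^ 2 * ‖η u‖ ^ 2 / r ^ 3 ≤ l ^ 2 * N' ^ 2 / r ^ 3 := by gcongr
      calc κ / ‖z u + l • η u - c‖ = κ * (1 / ‖z u + l • η u - c‖) := by ring
        _ ≤ κ * (1 / ‖z u - c‖ - l * ⟪z u - c, η u⟫_ℝ / ‖z u - c‖ ^ 3 +
            l ^ 2 * N' ^ 2 / r ^ 3) := by
          apply mul_le_mul_of_nonneg_left _ hκ.le
          linarith
        _ = _ := by ring
    have hp1 := hp κ₁ _ hκ₁ (h₁ u hu)
    have hp2 := hp κ₂ _ hκ₂ (h₂ u hu)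
    have hf : ⟪force κ₁ κ₂ c₁ c₂ z u, η u⟫_ℝ =
        -(κ₁ / ‖z u - c₁ u‖ ^ 3) * ⟪z u - c₁ u, η u⟫_ℝ -
          (κ₂ / ‖z u - c₂ u‖ ^ 3) * ⟪z u - c₂ u, η u⟫_ℝ := by
      rw [force, inner_sub_left, real_inner_smul_left, real_inner_smul_left]
    simp only [lagrangian]
    rw [hk, hf, hK]
    have e1 : (κ₁ + κ₂) / r ^ 3 * N' ^ 2 = κ₁ / r ^ 3 * N' ^ 2 + κ₂ / r ^ 3 * N' ^ 2 := by ring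
    rw [e1]
    linarith
  have i5 : IntervalIntegrable (fun u => lagrangian κ₁ κ₂ c₁ c₂ z g u +
      l * (⟪g u, h u⟫_ℝ + ⟪force κ₁ κ₂ c₁ c₂ z u, η u⟫_ℝ)) volume s t :=
    toI (i3.add (i1.const_mul l))
  rw [intervalIntegral.integral_add i5 (toI (i2.const_mul (l ^ 2))),
    intervalIntegral.integral_add (toI i3) (toI (i1.const_mul l)),
    intervalIntegral.integral_const_mul, intervalIntegral.integral_const_mul] at hmono
  linarith

theorem exists_Icc_avoiding (M : IsTwoCenterMinimizer κ₁ κ₂ c₁ c₂ a b z g)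
    (hc₁ : ContinuousOn c₁ (Icc a b)) (hc₂ : ContinuousOn c₂ (Icc a b)) {t₀ : ℝ}
    (ht₀ : t₀ ∈ Ioo a b) (h₁ : z t₀ ≠ c₁ t₀) (h₂ : z t₀ ≠ c₂ t₀) :
    ∃ s t r : ℝ, a < s ∧ s < t₀ ∧ t₀ < t ∧ t < b ∧ 0 < r ∧
      (∀ u ∈ Icc s t, 2 * r ≤ ‖z u - c₁ u‖) ∧ (∀ u ∈ Icc s t, 2 * r ≤ ‖z u - c₂ u‖) := by
  have hnb : Icc a b ∈ 𝓝 t₀ := Icc_mem_nhds ht₀.1 ht₀.2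
  have hz := M.hasL2Deriv.continuousOn.continuousAt hnb
  have k1 := (hz.sub (hc₁.continuousAt hnb)).norm
  have k2 := (hz.sub (hc₂.continuousAt hnb)).norm
  have p1 : 0 < ‖z t₀ - c₁ t₀‖ := norm_pos_iff.2 (sub_ne_zero.2 h₁)
  have p2 : 0 < ‖z t₀ - c₂ t₀‖ := norm_pos_iff.2 (sub_ne_zero.2 h₂)
  set r := min ‖z t₀ - c₁ t₀‖ ‖z t₀ - c₂ t₀‖ / 4 with hr
  have hr0 : 0 < r := by positivity
  have q1 : 2 * r < ‖z t₀ - c₁ t₀‖ := by linarith [min_le_left ‖z t₀ - c₁ t₀‖ ‖z t₀ - c₂ t₀‖]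
  have q2 : 2 * r < ‖z t₀ - c₂ t₀‖ := by linarith [min_le_right ‖z t₀ - c₁ t₀‖ ‖z t₀ - c₂ t₀‖]
  have hev : ∀ᶠ u in 𝓝 t₀, u ∈ Ioo a b ∧ 2 * r < ‖z u - c₁ u‖ ∧ 2 * r < ‖z u - c₂ u‖ := by
    filter_upwards [Ioo_mem_nhds ht₀.1 ht₀.2, k1.eventually_const_lt q1,
      k2.eventually_const_lt q2] with u h1 h2 h3 using ⟨h1, h2, h3⟩
  obtain ⟨ε, hε, hb⟩ := Metric.eventually_nhds_iff.1 hev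
  have hin : ∀ u ∈ Icc (t₀ - ε / 2) (t₀ + ε / 2), dist u t₀ < ε := fun u hu => by
    rw [Real.dist_eq, abs_lt]; constructor <;> linarith [hu.1, hu.2]
  refine ⟨t₀ - ε / 2, t₀ + ε / 2, r, ?_, by linarith, by linarith, ?_, hr0, fun u hu =>
    (hb (hin u hu)).2.1.le, fun u hu => (hb (hin u hu)).2.2.le⟩
  · exact (hb (hin _ ⟨le_rfl, by linarith⟩)).1.1
  · exact (hb (hin _ ⟨by linarith, le_rfl⟩)).1.2

/-- Du Bois-Reymond: with P a primitive of the force, test with η' = g - P - m. Integration by parts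
turns the first variation into ∫ |g - P - m|² = 0. Hence `z` has the continuously differentiable
velocity P + m. -/
theorem euler_lagrange_nhds (M : IsTwoCenterMinimizer κ₁ κ₂ c₁ c₂ a b z g) (hκ₁ : 0 < κ₁)
    (hκ₂ : 0 < κ₂) (hc₁ : ContinuousOn c₁ (Icc a b)) (hc₂ : ContinuousOn c₂ (Icc a b)) {t₀ : ℝ}
    (ht₀ : t₀ ∈ Ioo a b) (h₁ : z t₀ ≠ c₁ t₀) (h₂ : z t₀ ≠ c₂ t₀) :
    ∃ P : ℝ → ℂ, (∀ᶠ u in 𝓝 t₀, HasDerivAt z (P u) u) ∧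
      HasDerivAt P (force κ₁ κ₂ c₁ c₂ z t₀) t₀ := by
  obtain ⟨s, t, r, has, hst₀, ht₀t, htb, hr, hs1, hs2⟩ := M.exists_Icc_avoiding hc₁ hc₂ ht₀ h₁ h₂
  have hst : s < t := hst₀.trans ht₀t
  have hsub : Icc s t ⊆ Icc a b := Icc_subset_Icc has.le htb.le
  have hz := M.hasL2Deriv.mono has.le htb.le
  have hn : ∀ u ∈ Icc s t, z u ≠ c₁ u ∧ z u ≠ c₂ u := fun u hu =>
    ⟨fun e => by have := hs1 u hu; rw [e] at this; simp at this; linarith,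
      fun e => by have := hs2 u hu; rw [e] at this; simp at this; linarith⟩
  set F := force κ₁ κ₂ c₁ c₂ z with hFdef
  have hF : ContinuousOn F (Icc s t) :=
    continuousOn_force hz.continuousOn (hc₁.mono hsub) (hc₂.mono hsub) hn
  have hFi : ∀ u ∈ Icc s t, IntervalIntegrable F volume s u := fun u hu =>
    (hF.mono (by rw [uIcc_of_le hu.1]; exact Icc_subset_Icc_right hu.2)).intervalIntegrable
  set P : ℝ → ℂ := fun u => ∫ v in s..u, F v with hP
  have hPd : ∀ u ∈ Ioo s t, HasDerivAt P (F u) u := fun u hu => by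
    have hnb : Icc s t ∈ 𝓝 u := Icc_mem_nhds hu.1 hu.2
    refine intervalIntegral.integral_hasDerivAt_right (hFi u ⟨hu.1.le, hu.2.le⟩) ?_
      (hF.continuousAt hnb)
    exact (hF.mono Ioo_subset_Icc_self).stronglyMeasurableAtFilter isOpen_Ioo u hu
  have hPc : ContinuousOn P (Icc s t) := by
    have := intervalIntegral.continuousOn_primitive_interval (a := s) (b := t) (f := F)
      (μ := volume) (by rw [uIcc_of_le hst.le]; exact hF.integrableOn_Icc)
    rwa [uIcc_of_le hst.le] at this
  have hPL : HasL2Deriv P F s t := HasL2Deriv.of_continuousOn hPc hPd hF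
  have hgi := hz.intervalIntegrable (left_mem_Icc.2 hst.le) (right_mem_Icc.2 hst.le)
  have hPi : IntervalIntegrable P volume s t :=
    (hPc.mono (by rw [uIcc_of_le hst.le])).intervalIntegrable
  -- The mean of g - P is subtracted so that η vanishes at `t` as well as at `s`.
  set m : ℂ := ((t - s)⁻¹ : ℝ) • ∫ v in s..t, (g v - P v) with hm
  have hfin : IsFiniteMeasure (volume.restrict (Icc s t)) := ⟨by simp⟩
  have hPmem : MemLp P 2 (volume.restrict (Icc s t)) := by
    obtain ⟨C, hC⟩ := isCompact_Icc.exists_bound_of_continuousOn hPc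
    exact (memLp_top_of_bound (hPc.aestronglyMeasurable measurableSet_Icc) C
      ((ae_restrict_iff' measurableSet_Icc).2 (Eventually.of_forall hC))).mono_exponent le_top
  set h : ℝ → ℂ := fun u => g u - P u - m with hh
  have hhL : MemLp h 2 (volume.restrict (Icc s t)) := (hz.memLp.sub hPmem).sub (memLp_const m)
  set η : ℝ → ℂ := fun u => ∫ v in s..u, h v with hη
  have hηL : HasL2Deriv η h s t := ⟨hhL, fun u hu => by simp [hη]⟩
  have hηs : η s = 0 := by simp [hη]
  have hηt : η t = 0 := by
    simp only [hη, hh]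
    rw [intervalIntegral.integral_sub (hgi.sub hPi) intervalIntegrable_const,
      intervalIntegral.integral_const, hm, smul_smul, mul_inv_cancel₀ (by linarith), one_smul,
      sub_self]
  have hfv := M.first_variation hκ₁ hκ₂ hc₁ hc₂ has.le hst htb.le hr hs1 hs2 hηL hηs hηt
  have hbp := hPL.integral_inner_add hst.le hηL
  rw [hηs, hηt, inner_zero_right, inner_zero_right, sub_zero] at hbp
  have toI : ∀ {f : ℝ → ℝ}, IntegrableOn f (Icc s t) → IntervalIntegrable f volume s t :=
    fun hf => (hf.mono_set (by rw [uIcc_of_le hst.le])).intervalIntegrable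
  have i1 := toI (hz.integrableOn_inner hηL)
  have i2 := toI (hF.inner hηL.continuousOn (𝕜 := ℝ)).integrableOn_Icc
  have hPL' : HasL2Deriv (fun u => ∫ v in s..u, P v) P s t := ⟨hPmem, fun u hu => by simp⟩
  have i3 := toI (hPL'.integrableOn_inner hηL)
  have i4 : IntervalIntegrable (fun u => ⟪m, h u⟫_ℝ) volume s t :=
    toI ((hhL.integrable (by norm_num)).const_inner m)
  have hmi : ∫ u in s..t, ⟪m, h u⟫_ℝ = 0 := by
    have hhi := hηL.intervalIntegrable (left_mem_Icc.2 hst.le) (right_mem_Icc.2 hst.le)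
    have := (innerSL ℝ m).intervalIntegral_comp_comm hhi
    simp only [innerSL_apply_apply] at this
    rw [this]
    have : ∫ u in s..t, h u = 0 := hηt
    rw [this, inner_zero_right]
  have hzero : ∫ u in s..t, ‖h u‖ ^ 2 = 0 := by
    have e : ∀ u, ‖h u‖ ^ 2 = (⟪g u, h u⟫_ℝ + ⟪F u, η u⟫_ℝ) - (⟪F u, η u⟫_ℝ + ⟪P u, h u⟫_ℝ) -
        ⟪m, h u⟫_ℝ := fun u => by
      rw [← real_inner_self_eq_norm_sq]
      nth_rewrite 1 [hh]
      simp only [inner_sub_left]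
      ring
    simp_rw [e]
    rw [intervalIntegral.integral_sub ((i1.add i2).sub (i2.add i3)) i4,
      intervalIntegral.integral_sub (i1.add i2) (i2.add i3), hfv, hbp, hmi]
    ring
  have hae : ∀ᵐ u ∂(volume.restrict (Icc s t)), h u = 0 := by
    rw [intervalIntegral.integral_of_le hst.le, ← integral_Icc_eq_integral_Ioc,
      setIntegral_eq_zero_iff_of_nonneg_ae (Eventually.of_forall fun u => by positivity)
        hηL.integrableOn_sq] at hzero
    filter_upwards [hzero] with u hu
    simpa using hu
  have hzL : HasL2Deriv z (fun u => P u + m) s t := hz.congr_deriv (by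
    filter_upwards [hae] with u hu
    simp only [hh] at hu
    linear_combination hu)
  refine ⟨fun u => P u + m, ?_, (hPd t₀ ⟨hst₀, ht₀t⟩).add_const m⟩
  filter_upwards [Ioo_mem_nhds hst₀ ht₀t] with u hu
  have hcont : ContinuousOn (fun u => P u + m) (Icc s t) := hPc.add continuousOn_const
  have hd := intervalIntegral.integral_hasDerivAt_right
    (hzL.intervalIntegrable (left_mem_Icc.2 hst.le) ⟨hu.1.le, hu.2.le⟩)
    ((hcont.mono Ioo_subset_Icc_self).stronglyMeasurableAtFilter isOpen_Ioo u hu)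
    (hcont.continuousAt (Icc_mem_nhds hu.1 hu.2))
  refine (hd.const_add (z s)).congr_of_eventuallyEq ?_
  filter_upwards [Icc_mem_nhds hu.1 hu.2] with v hv using hzL.eq_add_integral v hv

theorem euler_lagrange (M : IsTwoCenterMinimizer κ₁ κ₂ c₁ c₂ a b z g) (hκ₁ : 0 < κ₁)
    (hκ₂ : 0 < κ₂) (hc₁ : ContinuousOn c₁ (Icc a b)) (hc₂ : ContinuousOn c₂ (Icc a b)) {t₀ : ℝ}
    (ht₀ : t₀ ∈ Ioo a b) (h₁ : z t₀ ≠ c₁ t₀) (h₂ : z t₀ ≠ c₂ t₀) :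
    HasDerivAt z (deriv z t₀) t₀ ∧ HasDerivAt (deriv z) (force κ₁ κ₂ c₁ c₂ z t₀) t₀ := by
  obtain ⟨P, hP, hP'⟩ := M.euler_lagrange_nhds hκ₁ hκ₂ hc₁ hc₂ ht₀ h₁ h₂
  have he : deriv z =ᶠ[𝓝 t₀] P := hP.mono fun u hu => hu.deriv
  refine ⟨?_, hP'.congr_of_eventuallyEq he⟩
  rw [he.self_of_nhds]
  exact hP.self_of_nhds

end IsTwoCenterMinimizer

/-! ### Upper bound for the Kepler action: arcs around the centre -/

/-- The Lagrangian of the Kepler problem with fixed centre `0`. -/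
def keplerLagrangian (κ : ℝ) (w h : ℝ → ℂ) (t : ℝ) : ℝ := ‖h t‖ ^ 2 / 2 + κ / ‖w t‖

/-- For a chord with midpoint e and half-chord f, this is the direction in which the arc bulges:
away from the origin when e ≠ 0, any normal to f when the chord is a diameter. -/
theorem exists_unit_normal {e f : ℂ} (hef : ⟪e, f⟫_ℝ = 0) :
    ∃ n : ℂ, ‖n‖ = 1 ∧ ⟪f, n⟫_ℝ = 0 ∧ 0 ≤ ⟪e, n⟫_ℝ := by
  by_cases he : e = 0
  · by_cases hf : f = 0
    · exact ⟨1, by simp, by simp [hf], by simp [he]⟩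
    · have hf' : ‖f‖ ≠ 0 := norm_ne_zero_iff.2 hf
      refine ⟨(‖f‖⁻¹ : ℝ) • (Complex.I * f), ?_, ?_, by simp [he]⟩
      · rw [norm_smul, norm_mul, Complex.norm_I, norm_inv, norm_norm, one_mul, inv_mul_cancel₀ hf']
      · rw [real_inner_smul_right, Complex.inner]
        simp
        right
        ring
  · have he' : ‖e‖ ≠ 0 := norm_ne_zero_iff.2 he
    refine ⟨(‖e‖⁻¹ : ℝ) • e, ?_, ?_, ?_⟩
    · rw [norm_smul, norm_inv, norm_norm, inv_mul_cancel₀ he']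
    · rw [real_inner_smul_right, real_inner_comm, hef, mul_zero]
    · rw [real_inner_smul_right, real_inner_self_eq_norm_sq]
      positivity

theorem integral_quadratic (α β γ : ℝ) {s t : ℝ} (hst : s < t) :
    ∫ u in s..t, (α + β * ((2 * u - s - t) / (t - s)) + γ * ((2 * u - s - t) / (t - s)) ^ 2) =
      (t - s) * (α + γ / 3) := by
  have hτ : t - s ≠ 0 := by linarith
  have hd : ∀ u : ℝ, HasDerivAt (fun u => α * u + (t - s) / 2 *
      (β * ((2 * u - s - t) / (t - s)) ^ 2 / 2 + γ * ((2 * u - s - t) / (t - s)) ^ 3 / 3))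
      (α + β * ((2 * u - s - t) / (t - s)) + γ * ((2 * u - s - t) / (t - s)) ^ 2) u := by
    intro u
    have hx : HasDerivAt (fun u : ℝ => (2 * u - s - t) / (t - s)) (2 / (t - s)) u := by
      have := ((((hasDerivAt_id u).const_mul 2).sub_const s).sub_const t).div_const (t - s)
      simpa using this
    have := ((hasDerivAt_id u).const_mul α).add
      ((((hx.pow 2).const_mul β).div_const 2).add (((hx.pow 3).const_mul γ).div_const 3)
        |>.const_mul ((t - s) / 2))
    refine this.congr_deriv ?_
    generalize (2 * u - s - t) / (t - s) = x
    field_simp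
    push_cast
    ring
  rw [intervalIntegral.integral_eq_sub_of_hasDerivAt (fun u _ => hd u)
    (Continuous.intervalIntegrable (by fun_prop) _ _)]
  field_simp
  ring

theorem continuousOn_keplerLagrangian {κ : ℝ} {w h : ℝ → ℂ} {s : Set ℝ} (hw : ContinuousOn w s)
    (hh : ContinuousOn h s) (h0 : ∀ u ∈ s, w u ≠ 0) :
    ContinuousOn (keplerLagrangian κ w h) s :=
  ((hh.norm.pow 2).div_const 2).add
    (continuousOn_const.div hw.norm fun u hu => norm_ne_zero_iff.2 (h0 u hu))

/-- A path around the origin joining two points of the same circle. -/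
theorem exists_arc {κ ε s t : ℝ} (hκ : 0 < κ) (hε : 0 < ε) (hst : s < t) {w₁ w₂ : ℂ}
    (h₁ : ‖w₁‖ = ε) (h₂ : ‖w₂‖ = ε) :
    ∃ W h : ℝ → ℂ, HasL2Deriv W h s t ∧ W s = w₁ ∧ W t = w₂ ∧
      (∀ u ∈ Icc s t, W u ≠ 0 ∧ ‖W u‖ ≤ 2 * ε) ∧
      IntegrableOn (keplerLagrangian κ W h) (Icc s t) ∧
      ∫ u in s..t, keplerLagrangian κ W h u ≤
        8 / 3 * (ε ^ 2 / (t - s)) + 5 / 3 * (κ * (t - s) / ε) := by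
  have hτ : 0 < t - s := by linarith
  set e : ℂ := (2⁻¹ : ℝ) • (w₁ + w₂) with he
  set f : ℂ := (2⁻¹ : ℝ) • (w₂ - w₁) with hf
  have hef : ⟪e, f⟫_ℝ = 0 := by
    rw [he, hf, real_inner_smul_left, real_inner_smul_right, inner_add_left, inner_sub_right,
      inner_sub_right, real_inner_self_eq_norm_sq, real_inner_self_eq_norm_sq, h₁, h₂,
      real_inner_comm]
    ring
  have hef2 : ‖e‖ ^ 2 + ‖f‖ ^ 2 = ε ^ 2 := by
    have := parallelogram_law_with_norm ℝ w₁ w₂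
    rw [he, hf, norm_smul, norm_smul, norm_sub_rev w₂ w₁]
    simp only [norm_inv, Real.norm_ofNat]
    rw [h₁, h₂] at this
    nlinarith
  have hw1 : w₁ = e - f := by
    rw [he, hf, ← smul_sub, show w₁ + w₂ - (w₂ - w₁) = (2 : ℝ) • w₁ by rw [two_smul]; ring,
      smul_smul]
    norm_num
  have hw2 : w₂ = e + f := by
    rw [he, hf, ← smul_add, show w₁ + w₂ + (w₂ - w₁) = (2 : ℝ) • w₂ by rw [two_smul]; ring,
      smul_smul]
    norm_num
  obtain ⟨n, hn1, hfn, hen⟩ := exists_unit_normal hef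
  clear_value e f
  set X : ℝ → ℝ := fun u => (2 * u - s - t) / (t - s) with hX
  have hXd : ∀ u, HasDerivAt X (2 / (t - s)) u := by
    intro u
    have := ((((hasDerivAt_id u).const_mul 2).sub_const s).sub_const t).div_const (t - s)
    simpa using this
  have hXs : X s = -1 := by simp only [hX]; field_simp; ring
  have hXt : X t = 1 := by simp only [hX]; field_simp; ring
  have hXI : ∀ u ∈ Icc s t, X u ^ 2 ≤ 1 := by
    intro u hu
    have h1 : -1 ≤ X u := by simp only [hX]; rw [le_div_iff₀ hτ]; linarith [hu.1]
    have h2 : X u ≤ 1 := by simp only [hX]; rw [div_le_iff₀ hτ]; linarith [hu.2]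
    nlinarith
  -- A parabola over the chord from w₁ to w₂, with parameter X running from -1 to 1 and height ε/2
  -- at the middle.
  set W : ℝ → ℂ := fun u => e + X u • f + (ε / 2 * (1 - X u ^ 2)) • n with hW
  set h : ℝ → ℂ := fun u => (2 / (t - s)) • f + (-(2 * ε / (t - s) * X u)) • n with hh
  have hWd : ∀ u, HasDerivAt W (h u) u := by
    intro u
    have h1 := ((hXd u).smul_const f).const_add e
    have h2 := ((((hXd u).pow 2).const_sub 1).const_mul (ε / 2)).smul_const n
    refine (h1.add h2).congr_deriv ?_
    simp only [hh]
    congr 2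
    field_simp
    ring
  have hXc : Continuous X := by simp only [hX]; fun_prop
  have hWc : Continuous W := continuous_iff_continuousAt.2 fun u => (hWd u).continuousAt
  have hhc : Continuous h := by simp only [hh]; fun_prop
  have hWsq : ∀ u, ‖W u‖ ^ 2 = ‖e‖ ^ 2 + X u ^ 2 * ‖f‖ ^ 2 +
      ε * (1 - X u ^ 2) * ⟪e, n⟫_ℝ + ε ^ 2 * (1 - X u ^ 2) ^ 2 / 4 := by
    intro u
    simp only [hW]
    rw [norm_add_sq_real, norm_add_sq_real, inner_add_left]
    simp only [real_inner_smul_right, real_inner_smul_left, hfn, hef, norm_smul, hn1,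
      Real.norm_eq_abs, mul_pow, sq_abs]
    ring
  -- Since ‖e‖² + ‖f‖² = ε², dropping the ⟪e, n⟫ term leaves ‖W‖² ≥ (1 - X²)‖e‖² + X²ε² + ε²(1 -
  -- X²)²/4, and the last two terms sum to (ε(1 + X²)/2)².
  have hWlow : ∀ u ∈ Icc s t, ε * (1 + X u ^ 2) / 2 ≤ ‖W u‖ := by
    intro u hu
    have h1 := hXI u hu
    refine le_of_sq_le_sq ?_ (norm_nonneg _)
    rw [hWsq]
    have : 0 ≤ ε * (1 - X u ^ 2) * ⟪e, n⟫_ℝ :=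
      mul_nonneg (mul_nonneg hε.le (by linarith)) hen
    nlinarith [mul_nonneg (sub_nonneg.2 h1) (sq_nonneg ‖e‖)]
  refine ⟨W, h, HasL2Deriv.of_continuousOn hWc.continuousOn (fun u _ => hWd u) hhc.continuousOn,
    ?_, ?_, fun u hu => ⟨?_, ?_⟩, ?_, ?_⟩
  · simp only [hW, hXs, hw1]
    simp
    ring
  · simp only [hW, hXt, hw2]
    simp
  · have := hWlow u hu
    intro h0
    rw [h0, norm_zero] at this
    nlinarith [mul_nonneg hε.le (sq_nonneg (X u))]
  · have h1 := hXI u hu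
    have h3 : ‖e‖ ≤ ε := abs_le_of_sq_le_sq' (by nlinarith [sq_nonneg ‖f‖]) hε.le |>.2
    have hen2 : ⟪e, n⟫_ℝ ≤ ε := (real_inner_le_norm e n).trans (by rw [hn1, mul_one]; exact h3)
    refine le_of_sq_le_sq ?_ (by positivity)
    rw [hWsq]
    have h4 : X u ^ 2 * ‖f‖ ^ 2 ≤ ‖f‖ ^ 2 := by nlinarith [sq_nonneg ‖f‖]
    have h5 : ε * (1 - X u ^ 2) * ⟪e, n⟫_ℝ ≤ ε * 1 * ε := by
      apply mul_le_mul _ hen2 hen (by positivity)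
      apply mul_le_mul_of_nonneg_left _ hε.le
      linarith [sq_nonneg (X u)]
    have h6 : (1 - X u ^ 2) ^ 2 ≤ 1 := by nlinarith [sq_nonneg (X u)]
    nlinarith [sq_nonneg ε, mul_le_mul_of_nonneg_left h6 (sq_nonneg ε)]
  · refine (continuousOn_keplerLagrangian hWc.continuousOn hhc.continuousOn fun u hu h0 => ?_).integrableOn_Icc
    have := hWlow u hu
    rw [h0, norm_zero] at this
    nlinarith [mul_nonneg hε.le (sq_nonneg (X u))]
  · have hne : ∀ u ∈ Icc s t, W u ≠ 0 := fun u hu h0 => by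
      have := hWlow u hu
      rw [h0, norm_zero] at this
      nlinarith [mul_nonneg hε.le (sq_nonneg (X u))]
    have hmono : ∫ u in s..t, keplerLagrangian κ W h u ≤
        ∫ u in s..t, (2 * ‖f‖ ^ 2 / (t - s) ^ 2 + 2 * κ / ε + 0 * X u +
          (2 * ε ^ 2 / (t - s) ^ 2 - κ / ε) * X u ^ 2) := by
      refine intervalIntegral.integral_mono_on hst.le ?_ ?_ fun u hu => ?_
      · refine ContinuousOn.intervalIntegrable ?_
        rw [uIcc_of_le hst.le]
        exact continuousOn_keplerLagrangian hWc.continuousOn hhc.continuousOn hne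
      · exact Continuous.intervalIntegrable (by fun_prop) _ _
      · have hk : ‖h u‖ ^ 2 = 4 * ‖f‖ ^ 2 / (t - s) ^ 2 + 4 * ε ^ 2 / (t - s) ^ 2 * X u ^ 2 := by
          simp only [hh]
          rw [norm_add_sq_real, real_inner_smul_left, real_inner_smul_right, hfn, norm_smul,
            norm_smul, hn1, Real.norm_eq_abs, Real.norm_eq_abs, mul_pow, mul_pow, sq_abs, sq_abs]
          field_simp
          ring
        have hl := hWlow u hu
        have h1 := hXI u hu
        -- From 2/(1 + X²) ≤ 2 - X² on [-1, 1], which makes the majorant a polynomial in X.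
        have hp : κ / ‖W u‖ ≤ κ / ε * (2 - X u ^ 2) := by
          have : κ / ‖W u‖ ≤ κ / (ε * (1 + X u ^ 2) / 2) := by
            apply div_le_div_of_nonneg_left hκ.le (by positivity) hl
          refine this.trans ?_
          rw [div_le_iff₀ (by positivity)]
          have e1 : κ / ε * (2 - X u ^ 2) * (ε * (1 + X u ^ 2) / 2) =
              κ * ((2 - X u ^ 2) * (1 + X u ^ 2) / 2) := by field_simp
          rw [e1]
          nlinarith [mul_nonneg (sq_nonneg (X u)) (sub_nonneg.2 h1)]
        simp only [keplerLagrangian]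
        rw [hk]
        have e2 : 2 * κ / ε = κ / ε * 2 := by ring
        have e3 : 4 * ‖f‖ ^ 2 / (t - s) ^ 2 = 2 * (2 * ‖f‖ ^ 2 / (t - s) ^ 2) := by ring
        have e4 : 4 * ε ^ 2 / (t - s) ^ 2 = 2 * (2 * ε ^ 2 / (t - s) ^ 2) := by ring
        rw [e2, e3, e4]
        nlinarith
    refine hmono.trans ?_
    rw [integral_quadratic _ _ _ hst]
    have h3 : ‖f‖ ^ 2 ≤ ε ^ 2 := by nlinarith [sq_nonneg ‖e‖]
    have e1 : ∀ τ F : ℝ, τ ≠ 0 → τ * (2 * F / τ ^ 2 + 2 * κ / ε + (2 * ε ^ 2 / τ ^ 2 - κ / ε) / 3) =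
        2 * (F / τ) + 2 / 3 * (ε ^ 2 / τ) + 5 / 3 * (κ * τ / ε) := by
      intro τ F hτ
      field_simp
      ring
    rw [e1 _ _ hτ.ne']
    have : ‖f‖ ^ 2 / (t - s) ≤ ε ^ 2 / (t - s) := by gcongr
    linarith

/-- A path around the origin joining two points of the same circle in time `m - s`, resting at its
endpoint for the remaining time. -/
theorem exists_arc_wait {κ ε s m t : ℝ} (hκ : 0 < κ) (hε : 0 < ε) (hsm : s < m) (hmt : m ≤ t)
    {w₁ w₂ : ℂ} (h₁ : ‖w₁‖ = ε) (h₂ : ‖w₂‖ = ε) :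
    ∃ W h : ℝ → ℂ, HasL2Deriv W h s t ∧ W s = w₁ ∧ W t = w₂ ∧
      (∀ u ∈ Icc s t, W u ≠ 0 ∧ ‖W u‖ ≤ 2 * ε) ∧
      IntegrableOn (keplerLagrangian κ W h) (Icc s t) ∧
      ∫ u in s..t, keplerLagrangian κ W h u ≤
        8 / 3 * (ε ^ 2 / (m - s)) + 5 / 3 * (κ * (m - s) / ε) + κ * (t - m) / ε := by
  obtain ⟨W, h, hL, hWs, hWm, hWn, hWi, hWa⟩ := exists_arc hκ hε hsm h₁ h₂
  have hconst : HasL2Deriv (fun _ => w₂) (fun _ => 0) m t :=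
    HasL2Deriv.of_continuousOn continuousOn_const (fun u _ => hasDerivAt_const u w₂)
      continuousOn_const
  have hG := hL.glue hsm.le hmt hconst hWm
  have hw2 : w₂ ≠ 0 := norm_ne_zero_iff.1 (by rw [h₂]; exact hε.ne')
  have heq1 : ∀ u ∈ Icc s m, keplerLagrangian κ (fun u => if u ≤ m then W u else w₂)
      (fun u => if u ≤ m then h u else 0) u = keplerLagrangian κ W h u := fun u hu => by
    simp [keplerLagrangian, hu.2]
  have heq2 : ∀ u ∈ Ioc m t, keplerLagrangian κ (fun u => if u ≤ m then W u else w₂)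
      (fun u => if u ≤ m then h u else 0) u = κ / ε := fun u hu => by
    simp [keplerLagrangian, not_le.2 hu.1, h₂]
  have j1 : IntegrableOn (keplerLagrangian κ (fun u => if u ≤ m then W u else w₂)
      (fun u => if u ≤ m then h u else 0)) (Icc s m) :=
    hWi.congr_fun (fun u hu => (heq1 u hu).symm) measurableSet_Icc
  have j2 : IntegrableOn (keplerLagrangian κ (fun u => if u ≤ m then W u else w₂)
      (fun u => if u ≤ m then h u else 0)) (Ioc m t) :=
    IntegrableOn.congr_fun (f := fun _ => κ / ε) (integrableOn_const (by simp))
      (fun u hu => (heq2 u hu).symm) measurableSet_Ioc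
  refine ⟨_, _, hG, by simp [hsm.le, hWs], ?_, fun u hu => ?_, ?_, ?_⟩
  · rcases hmt.eq_or_lt with rfl | hlt
    · simp [hWm]
    · simp [not_le.2 hlt]
  · rcases le_or_gt u m with hum | hum
    · simpa [hum] using hWn u ⟨hu.1, hum⟩
    · simp only [not_le.2 hum, if_false]
      exact ⟨hw2, by linarith⟩
  · rw [← Icc_union_Ioc_eq_Icc hsm.le hmt]
    exact j1.union j2
  · have k1 : IntervalIntegrable (keplerLagrangian κ (fun u => if u ≤ m then W u else w₂)
      (fun u => if u ≤ m then h u else 0)) volume s m :=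
      (j1.mono_set (by rw [uIcc_of_le hsm.le])).intervalIntegrable
    have k2 : IntervalIntegrable (keplerLagrangian κ (fun u => if u ≤ m then W u else w₂)
      (fun u => if u ≤ m then h u else 0)) volume m t :=
      (intervalIntegrable_iff_integrableOn_Ioc_of_le hmt).2 j2
    rw [← intervalIntegral.integral_add_adjacent_intervals k1 k2,
      intervalIntegral.integral_congr (g := keplerLagrangian κ W h) (fun u hu => by
        rw [uIcc_of_le hsm.le] at hu; exact heq1 u hu),
      intervalIntegral.integral_congr_ae (a := m) (b := t) (g := fun _ => κ / ε)
        (Eventually.of_forall fun u hu => by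
        rw [uIoc_of_le hmt] at hu; exact heq2 u hu), intervalIntegral.integral_const]
    have : (t - m) • (κ / ε) = κ * (t - m) / ε := by rw [smul_eq_mul]; ring
    rw [this]
    linarith

/-! ### Lower bounds for the Kepler action of a collision -/

theorem hasDerivAt_norm_of_ne_zero {w : ℝ → ℂ} {w' : ℂ} {t : ℝ} (hw : HasDerivAt w w' t)
    (h0 : w t ≠ 0) : HasDerivAt (fun u => ‖w u‖) (⟪w t, w'⟫_ℝ / ‖w t‖) t := by
  have h1 := hw.norm_sq.sqrt (pow_ne_zero 2 (norm_ne_zero_iff.2 h0))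
  have e : (fun u => ‖w u‖) = fun u => Real.sqrt (‖w u‖ ^ 2) := by
    ext u; rw [Real.sqrt_sq (norm_nonneg _)]
  rw [e]
  refine h1.congr_deriv ?_
  rw [Real.sqrt_sq (norm_nonneg _)]
  have := norm_ne_zero_iff.2 h0
  field_simp

theorem abs_inner_div_norm_le (w w' : ℂ) : |⟪w, w'⟫_ℝ / ‖w‖| ≤ ‖w'‖ := by
  rw [abs_div, abs_norm]
  rcases eq_or_ne w 0 with rfl | h0
  · simp
  · rw [div_le_iff₀ (norm_pos_iff.2 h0), mul_comm]
    exact abs_real_inner_le_norm w w'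

/-- Lower bound for the integral of a Lagrangian along a path, in terms of a function of the
radius whose derivative is dominated by the Lagrangian. -/
theorem sub_le_integral_of_calibration {w w' : ℝ → ℂ} {Ψ ψ : ℝ → ℝ} {φ : ℝ → ℝ} {p s : ℝ}
    (hps : p ≤ s) (hw : ContinuousOn w (Icc p s)) (hd : ∀ u ∈ Ioo p s, HasDerivAt w (w' u) u)
    (h0 : ∀ u ∈ Ioo p s, w u ≠ 0) (hΨ : Continuous Ψ)
    (hΨ' : ∀ r, 0 < r → HasDerivAt Ψ (ψ r) r)
    (hφi : IntegrableOn φ (Icc p s))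
    (hφ : ∀ u ∈ Ioo p s, |ψ ‖w u‖| * ‖w' u‖ ≤ φ u) :
    |Ψ ‖w s‖ - Ψ ‖w p‖| ≤ ∫ u in p..s, φ u := by
  have hc : ContinuousOn (fun u => Ψ ‖w u‖) (Icc p s) := hΨ.comp_continuousOn hw.norm
  have hder : ∀ u ∈ Ioo p s, HasDerivAt (fun u => Ψ ‖w u‖)
      (ψ ‖w u‖ * (⟪w u, w' u⟫_ℝ / ‖w u‖)) u := fun u hu =>
    (hΨ' _ (norm_pos_iff.2 (h0 u hu))).comp u (hasDerivAt_norm_of_ne_zero (hd u hu) (h0 u hu))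
  have hb : ∀ u ∈ Ioo p s, |ψ ‖w u‖ * (⟪w u, w' u⟫_ℝ / ‖w u‖)| ≤ φ u := fun u hu => by
    rw [abs_mul]
    exact (mul_le_mul_of_nonneg_left (abs_inner_div_norm_le _ _) (abs_nonneg _)).trans (hφ u hu)
  rw [abs_le]
  constructor
  · have := intervalIntegral.sub_le_integral_of_hasDeriv_right_of_le hps hc.neg
      (fun u hu => (hder u hu).neg.hasDerivWithinAt) hφi
      (fun u hu => (neg_le_abs _).trans (hb u hu))
    simp only [Pi.neg_apply] at this
    linarith
  · exact intervalIntegral.sub_le_integral_of_hasDeriv_right_of_le hps hc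
      (fun u hu => (hder u hu).hasDerivWithinAt) hφi (fun u hu => (le_abs_self _).trans (hb u hu))

theorem hasDerivAt_mul_sqrt {r : ℝ} (hr : 0 < r) :
    HasDerivAt (fun r => r * √r) (3 / 2 * √r) r := by
  have := (hasDerivAt_id r).mul (Real.hasDerivAt_sqrt hr.ne')
  refine this.congr_deriv ?_
  have h := Real.sq_sqrt hr.le
  have h' := (Real.sqrt_pos.2 hr).ne'
  simp only [id]
  field_simp
  nlinarith

/-- Calibration by Ψ(r) = 2√(2κr), whose derivative √(2κ/r) is the zero-energy speed: by the
arithmetic-geometric mean inequality, Ψ'(|w|)|w'| ≤ |w'|²/2 + κ/|w|. -/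
theorem collision_leg {κ ε p s : ℝ} (hκ : 0 < κ) (hε : 0 < ε) (hps : p ≤ s) {w w' : ℝ → ℂ}
    (hw : ContinuousOn w (Icc p s)) (hd : ∀ u ∈ Ioo p s, HasDerivAt w (w' u) u)
    (h0 : ∀ u ∈ Ioo p s, w u ≠ 0) (hφi : IntegrableOn (keplerLagrangian κ w w') (Icc p s))
    (hend : (‖w p‖ = 0 ∧ ‖w s‖ = ε) ∨ (‖w p‖ = ε ∧ ‖w s‖ = 0)) :
    2 * √2 * √(κ * ε) ≤ ∫ u in p..s, keplerLagrangian κ w w' u := by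
  have hk2 : 0 ≤ 2 * κ := by positivity
  have key := sub_le_integral_of_calibration (Ψ := fun r => 2 * √(2 * κ) * √r)
    (ψ := fun r => √(2 * κ) / √r) hps hw hd h0 (by fun_prop) (fun r hr => by
      refine ((Real.hasDerivAt_sqrt hr.ne').const_mul _).congr_deriv ?_
      have h' := (Real.sqrt_pos.2 hr).ne'
      field_simp) hφi (fun u hu => by
      have hpos := norm_pos_iff.2 (h0 u hu)
      rw [abs_of_nonneg (by positivity)]
      have hsq : (√(2 * κ) / √‖w u‖) ^ 2 = 2 * κ / ‖w u‖ := by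
        rw [div_pow, Real.sq_sqrt hk2, Real.sq_sqrt hpos.le]
      simp only [keplerLagrangian]
      have : κ / ‖w u‖ = (√(2 * κ) / √‖w u‖) ^ 2 / 2 := by rw [hsq]; ring
      rw [this]
      nlinarith [sq_nonneg (√(2 * κ) / √‖w u‖ - ‖w' u‖)])
  have e : 2 * √2 * √(κ * ε) = 2 * √(2 * κ) * √ε := by
    rw [Real.sqrt_mul hκ.le, Real.sqrt_mul (by norm_num : (0 : ℝ) ≤ 2)]; ring
  rw [e]
  have h3 : 0 ≤ 2 * √(2 * κ) * √ε := by positivity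
  rcases hend with ⟨h1, h2⟩ | ⟨h1, h2⟩
  · simp only [h1, h2, Real.sqrt_zero, mul_zero, sub_zero] at key
    rwa [abs_of_nonneg h3] at key
  · simp only [h1, h2, Real.sqrt_zero, mul_zero, zero_sub, abs_neg] at key
    rwa [abs_of_nonneg h3] at key

/-- The same calibration for the Lagrangian minus κ/ε, which adds a term growing with the duration.
Here ψ² ≤ 2(κ/r - κ/ε) for r ≤ ε, and the integral of ψ over [0, ε] is the constant 4/3 √2 √(κε). -/
theorem collision_leg_of_norm_le {κ ε p s : ℝ} (hκ : 0 < κ) (hε : 0 < ε) (hps : p ≤ s)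
    {w w' : ℝ → ℂ}
    (hw : ContinuousOn w (Icc p s)) (hd : ∀ u ∈ Ioo p s, HasDerivAt w (w' u) u)
    (h0 : ∀ u ∈ Ioo p s, w u ≠ 0) (hφi : IntegrableOn (keplerLagrangian κ w w') (Icc p s))
    (hend : (‖w p‖ = 0 ∧ ‖w s‖ = ε) ∨ (‖w p‖ = ε ∧ ‖w s‖ = 0)) (hle : ∀ u ∈ Icc p s, ‖w u‖ ≤ ε) :
    4 / 3 * √2 * √(κ * ε) + κ * (s - p) / ε ≤ ∫ u in p..s, keplerLagrangian κ w w' u := by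
  have hk2 : 0 ≤ 2 * κ := by positivity
  have hi2 : IntegrableOn (fun _ : ℝ => κ / ε) (Icc p s) := integrableOn_const (by simp)
  have key := sub_le_integral_of_calibration
    (Ψ := fun r => √(2 * κ) * (2 * √r - 2 / 3 * (r * √r) / ε))
    (ψ := fun r => √(2 * κ) * (1 / √r - √r / ε))
    (φ := fun u => keplerLagrangian κ w w' u - κ / ε) hps hw hd h0 (by fun_prop) (fun r hr => by
      refine ((((Real.hasDerivAt_sqrt hr.ne').const_mul 2).sub
        (((hasDerivAt_mul_sqrt hr).const_mul (2 / 3)).div_const ε)).const_mul _).congr_deriv ?_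
      have h' := (Real.sqrt_pos.2 hr).ne'
      field_simp) (hφi.sub hi2) (fun u hu => by
      have hpos := norm_pos_iff.2 (h0 u hu)
      have hle' := hle u ⟨hu.1.le, hu.2.le⟩
      have h' := Real.sqrt_pos.2 hpos
      have hs := Real.sq_sqrt hpos.le
      have hnn : 0 ≤ 1 / √‖w u‖ - √‖w u‖ / ε := by
        rw [sub_nonneg, div_le_div_iff₀ hε h']; nlinarith
      rw [abs_of_nonneg (by positivity)]
      have hsq : (√(2 * κ) * (1 / √‖w u‖ - √‖w u‖ / ε)) ^ 2 ≤ 2 * (κ / ‖w u‖ - κ / ε) := by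
        rw [mul_pow, Real.sq_sqrt hk2]
        have e1 : (1 / √‖w u‖ - √‖w u‖ / ε) ^ 2 = 1 / ‖w u‖ - 2 / ε + ‖w u‖ / ε ^ 2 := by
          rw [sub_sq, div_pow, div_pow, hs]
          field_simp
        have e2 : ‖w u‖ / ε ^ 2 ≤ 1 / ε := by
          rw [div_le_div_iff₀ (by positivity) hε]; nlinarith
        rw [e1]
        have : 1 / ‖w u‖ - 2 / ε + ‖w u‖ / ε ^ 2 ≤ 1 / ‖w u‖ - 1 / ε := by
          have : 2 / ε = 2 * (1 / ε) := by ring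
          linarith
        calc 2 * κ * (1 / ‖w u‖ - 2 / ε + ‖w u‖ / ε ^ 2) ≤ 2 * κ * (1 / ‖w u‖ - 1 / ε) := by gcongr
          _ = _ := by ring
      simp only [keplerLagrangian]
      nlinarith [sq_nonneg (√(2 * κ) * (1 / √‖w u‖ - √‖w u‖ / ε) - ‖w' u‖)])
  have e : 4 / 3 * √2 * √(κ * ε) = √(2 * κ) * (2 * √ε - 2 / 3 * (ε * √ε) / ε) := by
    rw [Real.sqrt_mul hκ.le, Real.sqrt_mul (by norm_num : (0 : ℝ) ≤ 2)]
    field_simp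
    ring
  have toI : ∀ {f : ℝ → ℝ}, IntegrableOn f (Icc p s) → IntervalIntegrable f volume p s :=
    fun hf => (hf.mono_set (by rw [uIcc_of_le hps])).intervalIntegrable
  rw [intervalIntegral.integral_sub (toI hφi) (toI hi2), intervalIntegral.integral_const] at key
  have h3 : 0 ≤ 4 / 3 * √2 * √(κ * ε) := by positivity
  have e4 : (s - p) • (κ / ε) = κ * (s - p) / ε := by rw [smul_eq_mul]; ring
  rw [e4] at key
  rcases hend with ⟨h1, h2⟩ | ⟨h1, h2⟩
  · simp only [h1, h2, Real.sqrt_zero, mul_zero, sub_zero, zero_div] at key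
    rw [← e, abs_of_nonneg h3] at key
    linarith
  · simp only [h1, h2, Real.sqrt_zero, mul_zero, sub_zero, zero_div, zero_sub, abs_neg] at key
    rw [← e, abs_of_nonneg h3] at key
    linarith

/-- Cauchy-Schwarz, obtained by integrating (d/(t - s) - ‖h‖)² ≥ 0. -/
theorem HasL2Deriv.sq_div_le {w h : ℝ → ℂ} {s t : ℝ} (hw : HasL2Deriv w h s t) (hst : s < t) :
    ‖w t - w s‖ ^ 2 / (2 * (t - s)) ≤ ∫ u in s..t, ‖h u‖ ^ 2 / 2 := by
  have toI : ∀ {f : ℝ → ℝ}, IntegrableOn f (Icc s t) → IntervalIntegrable f volume s t :=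
    fun hf => (hf.mono_set (by rw [uIcc_of_le hst.le])).intervalIntegrable
  have hτ : 0 < t - s := by linarith
  set d := ‖w t - w s‖ with hd
  have h1 : d ≤ ∫ u in s..t, ‖h u‖ := by
    rw [hd, hw.sub_eq_integral (left_mem_Icc.2 hst.le) (right_mem_Icc.2 hst.le)]
    exact intervalIntegral.norm_integral_le_integral_norm hst.le
  have hn : IntegrableOn (fun u => ‖h u‖) (Icc s t) := hw.integrableOn.norm
  have i1 : IntervalIntegrable (fun u => d / (t - s) * ‖h u‖) volume s t := toI (hn.const_mul _)
  have h2 : ∫ u in s..t, (d / (t - s) * ‖h u‖ - (d / (t - s)) ^ 2 / 2) ≤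
      ∫ u in s..t, ‖h u‖ ^ 2 / 2 := by
    refine intervalIntegral.integral_mono_on hst.le (i1.sub intervalIntegrable_const)
      (toI (hw.integrableOn_sq.div_const 2)) fun u _ => ?_
    nlinarith [sq_nonneg (d / (t - s) - ‖h u‖)]
  rw [intervalIntegral.integral_sub i1 intervalIntegrable_const,
    intervalIntegral.integral_const_mul, intervalIntegral.integral_const, smul_eq_mul] at h2
  refine le_trans ?_ h2
  have h3 : d / (t - s) * d ≤ d / (t - s) * ∫ u in s..t, ‖h u‖ := by
    apply mul_le_mul_of_nonneg_left h1; positivity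
  have e : d ^ 2 / (2 * (t - s)) = d / (t - s) * d - (t - s) * ((d / (t - s)) ^ 2 / 2) := by
    field_simp; ring
  linarith

/-- Lower bound for the time a path with bounded energy takes to fall into the centre. -/
theorem collision_time {κ C ε p s : ℝ} (hκ : 0 < κ) (hε : 0 < ε) (hps : p ≤ s) {w w' : ℝ → ℂ}
    (hw : ContinuousOn w (Icc p s)) (hd : ∀ u ∈ Ioo p s, HasDerivAt w (w' u) u)
    (h0 : ∀ u ∈ Ioo p s, w u ≠ 0) (hle : ∀ u ∈ Icc p s, ‖w u‖ ≤ ε)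
    (hen : ∀ u ∈ Ioo p s, ‖w' u‖ ^ 2 / 2 - κ / ‖w u‖ ≤ C) (hC : C * ε ≤ κ / 20)
    (hp : ‖w p‖ = ε) (hs : ‖w s‖ = 0) : 45 / 100 * (ε ^ 2 / √(κ * ε)) ≤ s - p := by
  -- The energy bound gives r|w'|² ≤ 2.1 κ, so |(r^(3/2))'| ≤ (3/2)√(2.1 κ) ≤ (20/9)√κ. The duration
  -- is thus at least 9/20 in units of ε²/√(κε).
  have key := sub_le_integral_of_calibration (Ψ := fun r => r * √r)
    (ψ := fun r => 3 / 2 * √r) (φ := fun _ => 20 / 9 * √κ) hps hw hd h0 (by fun_prop)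
    (fun r hr => hasDerivAt_mul_sqrt hr) (integrableOn_const (by simp)) (fun u hu => by
      have hpos := norm_pos_iff.2 (h0 u hu)
      have hle' := hle u ⟨hu.1.le, hu.2.le⟩
      rw [abs_of_nonneg (by positivity)]
      refine le_of_sq_le_sq ?_ (by positivity)
      rw [mul_pow, mul_pow, mul_pow, Real.sq_sqrt hpos.le, Real.sq_sqrt hκ.le]
      have h1 : ‖w u‖ * ‖w' u‖ ^ 2 ≤ 2 * κ + 2 * (C * ‖w u‖) := by
        have h2 := mul_le_mul_of_nonneg_left (hen u hu) hpos.le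
        have e : ‖w u‖ * (‖w' u‖ ^ 2 / 2 - κ / ‖w u‖) = ‖w u‖ * ‖w' u‖ ^ 2 / 2 - κ := by
          field_simp
        rw [e] at h2
        linarith
      have h3 : C * ‖w u‖ ≤ κ / 20 := by
        rcases le_or_gt C 0 with h | h
        · nlinarith
        · nlinarith
      nlinarith)
  simp only [hp, hs, Real.sqrt_zero, mul_zero, zero_sub, abs_neg,
    intervalIntegral.integral_const, smul_eq_mul] at key
  rw [abs_of_nonneg (by positivity)] at key
  have e : ε ^ 2 / √(κ * ε) = ε * √ε / √κ := by
    rw [Real.sqrt_mul hκ.le, div_eq_div_iff (by positivity) (by positivity)]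
    have := Real.sq_sqrt hε.le
    calc ε ^ 2 * √κ = ε * (√ε ^ 2) * √κ := by rw [this]; ring
      _ = _ := by ring
  rw [e]
  have hk := Real.sqrt_pos.2 hκ
  rw [mul_div_assoc', div_le_iff₀ hk]
  linarith

/-! ### Exit times and comparison relative to a moving centre -/

/-- The last time at which a continuous function is at or above a level. -/
theorem exists_last_ge {f : ℝ → ℝ} {s t ε : ℝ} (hst : s ≤ t) (hf : ContinuousOn f (Icc s t))
    (hs : ε ≤ f s) (ht : f t < ε) : ∃ m ∈ Ico s t, f m = ε ∧ ∀ u ∈ Ioc m t, f u < ε := by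
  have hcl : IsClosed (Icc s t ∩ f ⁻¹' Ici ε) := hf.preimage_isClosed_of_isClosed isClosed_Icc isClosed_Ici
  have hcp : IsCompact (Icc s t ∩ f ⁻¹' Ici ε) := isCompact_Icc.of_isClosed_subset hcl inter_subset_left
  obtain ⟨m, ⟨hmI, hm⟩, hmax⟩ := hcp.exists_isGreatest ⟨s, ⟨le_rfl, hst⟩, hs⟩
  have hlt : ∀ u ∈ Ioc m t, f u < ε := fun u hu => by
    by_contra hc
    exact absurd (hmax ⟨⟨hmI.1.trans hu.1.le, hu.2⟩, not_lt.1 hc⟩) (not_le.2 hu.1)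
  have hmt : m < t := lt_of_le_of_ne hmI.2 fun e => by subst e; exact absurd hm (not_le.2 ht)
  refine ⟨m, ⟨hmI.1, hmt⟩, le_antisymm ?_ hm, hlt⟩
  have hc : ContinuousWithinAt f (Ioc m t) m :=
    (hf m hmI).mono fun u hu => ⟨hmI.1.trans hu.1.le, hu.2⟩
  have hcl : m ∈ closure (Ioc m t) := by
    rw [closure_Ioc hmt.ne]; exact ⟨le_rfl, hmt.le⟩
  exact hc.closure_le hcl continuousWithinAt_const fun u hu => (hlt u hu).le

/-- The first time at which a continuous function is at or above a level. -/
theorem exists_first_ge {f : ℝ → ℝ} {s t ε : ℝ} (hst : s ≤ t) (hf : ContinuousOn f (Icc s t))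
    (hs : f s < ε) (ht : ε ≤ f t) : ∃ m ∈ Ioc s t, f m = ε ∧ ∀ u ∈ Ico s m, f u < ε := by
  obtain ⟨m, hm, h1, h2⟩ := exists_last_ge (f := fun u => f (-u)) (s := -t) (t := -s) (ε := ε)
    (by linarith) (hf.comp continuous_neg.continuousOn fun u hu => ⟨by linarith [hu.2], by
      linarith [hu.1]⟩) (by simpa using ht) (by simpa using hs)
  refine ⟨-m, ⟨by linarith [hm.2], by linarith [hm.1]⟩, h1, fun u hu => ?_⟩
  simpa using h2 (-u) ⟨by linarith [hu.2], by linarith [hu.1]⟩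

/-- The centre `c` moves, on `(a, b)`, with velocity `v` and continuous acceleration `α`. -/
structure IsSmoothCenter (c v α : ℝ → ℂ) (a b : ℝ) : Prop where
  continuousOn : ContinuousOn c (Icc a b)
  hasDerivAt : ∀ t ∈ Ioo a b, HasDerivAt c (v t) t
  hasDerivAt_velocity : ∀ t ∈ Ioo a b, HasDerivAt v (α t) t
  continuousOn_acceleration : ContinuousOn α (Ioo a b)

theorem IsSmoothCenter.continuousOn_velocity {c v α : ℝ → ℂ} {a b : ℝ}
    (hc : IsSmoothCenter c v α a b) : ContinuousOn v (Ioo a b) := fun t ht =>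
  (hc.hasDerivAt_velocity t ht).continuousAt.continuousWithinAt

theorem IsSmoothCenter.hasL2Deriv {c v α : ℝ → ℂ} {a b s t : ℝ}
    (hc : IsSmoothCenter c v α a b) (h : Icc s t ⊆ Ioo a b) : HasL2Deriv c v s t :=
  HasL2Deriv.of_continuousOn (hc.continuousOn.mono (h.trans Ioo_subset_Icc_self))
    (fun u hu => hc.hasDerivAt u (h (Ioo_subset_Icc_self hu))) (hc.continuousOn_velocity.mono h)

theorem IsSmoothCenter.hasL2Deriv_velocity {c v α : ℝ → ℂ} {a b s t : ℝ}
    (hc : IsSmoothCenter c v α a b) (h : Icc s t ⊆ Ioo a b) : HasL2Deriv v α s t :=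
  HasL2Deriv.of_continuousOn (hc.continuousOn_velocity.mono h)
    (fun u hu => hc.hasDerivAt_velocity u (h (Ioo_subset_Icc_self hu)))
    (hc.continuousOn_acceleration.mono h)

namespace IsTwoCenterMinimizer

variable {κ₁ κ₂ : ℝ} {c₁ c₂ v₁ α₁ : ℝ → ℂ} {a b : ℝ} {z g : ℝ → ℂ}

theorem integrableOn_kepler (M : IsTwoCenterMinimizer κ₁ κ₂ c₁ c₂ a b z g) (hκ₁ : 0 < κ₁)
    (hκ₂ : 0 < κ₂) (hc : IsSmoothCenter c₁ v₁ α₁ a b) {s t : ℝ} (hsub : Icc s t ⊆ Ioo a b) :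
    IntegrableOn (keplerLagrangian κ₁ (fun u => z u - c₁ u) (fun u => g u - v₁ u)) (Icc s t) := by
  rcases lt_or_ge t s with h | h
  · simp [Icc_eq_empty (not_le.2 h)]
  have hs := (hsub (left_mem_Icc.2 h)).1
  have ht := (hsub (right_mem_Icc.2 h)).2
  have hz := M.hasL2Deriv.mono hs.le ht.le
  have hw := hz.sub (hc.hasL2Deriv hsub)
  have hsub' : Icc s t ⊆ Icc a b := hsub.trans Ioo_subset_Icc_self
  refine (hw.integrableOn_sq.div_const 2).add ?_
  refine Integrable.mono' (M.integrableOn.mono_set hsub') ?_ (Eventually.of_forall fun u => ?_)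
  · have h1 : AEMeasurable (fun u => z u - c₁ u) (volume.restrict (Icc s t)) :=
      (hw.continuousOn.aestronglyMeasurable measurableSet_Icc).aemeasurable
    exact (aemeasurable_const.div h1.norm).aestronglyMeasurable
  · rw [Real.norm_of_nonneg (by positivity)]
    simp only [lagrangian]
    have : 0 ≤ ‖g u‖ ^ 2 / 2 := by positivity
    have : 0 ≤ κ₂ / ‖z u - c₂ u‖ := by positivity
    linarith

/-- Comparison, in coordinates relative to the first centre, with a path around that centre. -/
theorem comparison (M : IsTwoCenterMinimizer κ₁ κ₂ c₁ c₂ a b z g) (hκ₁ : 0 < κ₁) (hκ₂ : 0 < κ₂)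
    (hc₁ : IsSmoothCenter c₁ v₁ α₁ a b) (hc₂ : ContinuousOn c₂ (Icc a b)) {s t d ε K : ℝ}
    (hst : s < t) (hsub : Icc s t ⊆ Ioo a b) (hd : 0 < d) (hε : 0 < ε) (hεd : 2 * ε ≤ d)
    (hdist : ∀ u ∈ Icc s t, 2 * d ≤ ‖c₁ u - c₂ u‖) (hα : ∀ u ∈ Icc s t, ‖α₁ u‖ ≤ K)
    (hz : ∀ u ∈ Icc s t, ‖z u - c₁ u‖ ≤ ε)
    {W h : ℝ → ℂ} (hW : HasL2Deriv W h s t) (hWs : W s = z s - c₁ s) (hWt : W t = z t - c₁ t)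
    (hWn : ∀ u ∈ Icc s t, W u ≠ 0 ∧ ‖W u‖ ≤ 2 * ε)
    (hWi : IntegrableOn (keplerLagrangian κ₁ W h) (Icc s t)) :
    ∫ u in s..t, keplerLagrangian κ₁ (fun u => z u - c₁ u) (fun u => g u - v₁ u) u ≤
      (∫ u in s..t, keplerLagrangian κ₁ W h u) + 3 * (K + κ₂ / d ^ 2) * ε * (t - s) := by
  have hs := (hsub (left_mem_Icc.2 hst.le)).1
  have ht := (hsub (right_mem_Icc.2 hst.le)).2
  have hsub' : Icc s t ⊆ Icc a b := hsub.trans Ioo_subset_Icc_self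
  have toI : ∀ {f : ℝ → ℝ}, IntegrableOn f (Icc s t) → IntervalIntegrable f volume s t :=
    fun hf => (hf.mono_set (by rw [uIcc_of_le hst.le])).intervalIntegrable
  have hzL := M.hasL2Deriv.mono hs.le ht.le
  have hcL := hc₁.hasL2Deriv hsub
  have hvL := hc₁.hasL2Deriv_velocity hsub
  have hw := hzL.sub hcL
  have hx := hW.add hcL
  have hη := hW.sub hw
  have hfar : ∀ (u : ℝ) (y : ℂ), u ∈ Icc s t → ‖y‖ ≤ 2 * ε → d ≤ ‖y + c₁ u - c₂ u‖ := by
    intro u y hu hy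
    have h1 := hdist u hu
    have h2 : ‖c₁ u - c₂ u‖ ≤ ‖y + c₁ u - c₂ u‖ + ‖y‖ := by
      have := norm_sub_le (y + c₁ u - c₂ u) y
      rwa [show y + c₁ u - c₂ u - y = c₁ u - c₂ u by ring] at this
    linarith
  have hxn : ∀ u ∈ Icc s t, W u + c₁ u ≠ c₁ u ∧ W u + c₁ u ≠ c₂ u := fun u hu =>
    ⟨by simpa using (hWn u hu).1, fun e => by
      have := hfar u (W u) hu (hWn u hu).2
      rw [e, sub_self, norm_zero] at this
      linarith⟩
  have hle := M.le s t _ _ hs.le hst ht.le hx (by rw [hWs]; ring) (by rw [hWt]; ring) hxn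
  have hη0 : ∀ u ∈ Icc s t, ‖W u - (z u - c₁ u)‖ ≤ 3 * ε := fun u hu => by
    have := norm_sub_le (W u) (z u - c₁ u)
    linarith [(hWn u hu).2, hz u hu]
  -- The compared paths share their ends, so the cross term of the moving frame integrates to minus
  -- the term in the acceleration. Their sum may be added to the integrand for free, and leaves an
  -- error controlled by K · 3ε.
  have hbp := hvL.integral_inner_add hst.le hη
  rw [hWs, hWt, sub_self, sub_self, inner_zero_right, inner_zero_right, sub_zero] at hbp
  have iA : IntegrableOn (fun u => ⟪α₁ u, W u - (z u - c₁ u)⟫_ℝ) (Icc s t) :=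
    ((hc₁.continuousOn_acceleration.mono hsub).inner hη.continuousOn).integrableOn_Icc
  have iB : IntegrableOn (fun u => ⟪v₁ u, h u - (g u - v₁ u)⟫_ℝ) (Icc s t) :=
    hcL.integrableOn_inner hη
  have iK := M.integrableOn_kepler hκ₁ hκ₂ hc₁ hsub
  have iL := M.integrableOn.mono_set hsub'
  set D := 3 * (K + κ₂ / d ^ 2) * ε with hD
  have hmono : ∫ u in s..t, lagrangian κ₁ κ₂ c₁ c₂ (fun u => W u + c₁ u)
      (fun u => h u + v₁ u) u ≤ ∫ u in s..t, (lagrangian κ₁ κ₂ c₁ c₂ z g u +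
        (keplerLagrangian κ₁ W h u -
          keplerLagrangian κ₁ (fun u => z u - c₁ u) (fun u => g u - v₁ u) u) +
        (⟪α₁ u, W u - (z u - c₁ u)⟫_ℝ + ⟪v₁ u, h u - (g u - v₁ u)⟫_ℝ) + D) := by
    refine intervalIntegral.integral_mono_on hst.le
      (toI (hx.integrableOn_lagrangian (hc₁.continuousOn.mono hsub') (hc₂.mono hsub') hxn))
      ((((toI iL).add ((toI hWi).sub (toI iK))).add ((toI iA).add (toI iB))).add
        intervalIntegrable_const) fun u hu => ?_
    have hk : ‖h u + v₁ u‖ ^ 2 = ‖h u‖ ^ 2 + 2 * ⟪v₁ u, h u⟫_ℝ + ‖v₁ u‖ ^ 2 := by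
      rw [norm_add_sq_real, real_inner_comm]
    have hk2 : ‖g u‖ ^ 2 = ‖g u - v₁ u‖ ^ 2 + 2 * ⟪v₁ u, g u - v₁ u⟫_ℝ + ‖v₁ u‖ ^ 2 := by
      have := norm_add_sq_real (g u - v₁ u) (v₁ u)
      rwa [sub_add_cancel, real_inner_comm] at this
    have hA : -(K * (3 * ε)) ≤ ⟪α₁ u, W u - (z u - c₁ u)⟫_ℝ := by
      have h1 := abs_real_inner_le_norm (α₁ u) (W u - (z u - c₁ u))
      have h2 : ‖α₁ u‖ * ‖W u - (z u - c₁ u)‖ ≤ K * (3 * ε) := by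
        apply mul_le_mul (hα u hu) (hη0 u hu) (norm_nonneg _)
        exact (norm_nonneg _).trans (hα u hu)
      linarith [neg_abs_le ⟪α₁ u, W u - (z u - c₁ u)⟫_ℝ]
    have hP : κ₂ / ‖W u + c₁ u - c₂ u‖ ≤ κ₂ / ‖z u - c₂ u‖ + κ₂ / d ^ 2 * (3 * ε) := by
      have h1 := hfar u (W u) hu (hWn u hu).2
      have h2 := hfar u (z u - c₁ u) hu (by linarith [hz u hu])
      rw [sub_add_cancel] at h2
      have h3 : ‖z u - c₂ u‖ ≤ ‖W u + c₁ u - c₂ u‖ + 3 * ε := by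
        have := norm_sub_le (W u + c₁ u - c₂ u) (W u - (z u - c₁ u))
        rw [show W u + c₁ u - c₂ u - (W u - (z u - c₁ u)) = z u - c₂ u by ring] at this
        linarith [hη0 u hu]
      generalize ‖W u + c₁ u - c₂ u‖ = p at *
      generalize ‖z u - c₂ u‖ = q at *
      have hp : 0 < p := by linarith
      have hq : 0 < q := by linarith
      have e : κ₂ / p - κ₂ / q = κ₂ * ((q - p) / (p * q)) := by field_simp
      have h4 : (q - p) / (p * q) ≤ 3 * ε / d ^ 2 := by
        rw [div_le_div_iff₀ (by positivity) (by positivity)]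
        have h5 : d ^ 2 ≤ p * q := by nlinarith
        calc (q - p) * d ^ 2 ≤ 3 * ε * d ^ 2 := by gcongr; linarith
          _ ≤ 3 * ε * (p * q) := by gcongr
      have h6 := mul_le_mul_of_nonneg_left h4 hκ₂.le
      have e2 : κ₂ / d ^ 2 * (3 * ε) = κ₂ * (3 * ε / d ^ 2) := by ring
      linarith
    have e3 : W u + c₁ u - c₁ u = W u := by ring
    simp only [lagrangian, keplerLagrangian, hD]
    rw [hk, hk2, e3, inner_sub_right (v₁ u) (h u)]
    have e4 : 3 * (K + κ₂ / d ^ 2) * ε = K * (3 * ε) + κ₂ / d ^ 2 * (3 * ε) := by ring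
    rw [e4]
    linarith
  have j1 : IntervalIntegrable (fun u => lagrangian κ₁ κ₂ c₁ c₂ z g u +
        (keplerLagrangian κ₁ W h u -
          keplerLagrangian κ₁ (fun u => z u - c₁ u) (fun u => g u - v₁ u) u)) volume s t :=
    (toI iL).add ((toI hWi).sub (toI iK))
  have j2 : IntervalIntegrable (fun u => keplerLagrangian κ₁ W h u -
          keplerLagrangian κ₁ (fun u => z u - c₁ u) (fun u => g u - v₁ u) u) volume s t :=
    (toI hWi).sub (toI iK)
  have j3 : IntervalIntegrable (fun u => ⟪α₁ u, W u - (z u - c₁ u)⟫_ℝ +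
      ⟪v₁ u, h u - (g u - v₁ u)⟫_ℝ) volume s t := (toI iA).add (toI iB)
  have j4 : IntervalIntegrable (fun u => lagrangian κ₁ κ₂ c₁ c₂ z g u +
        (keplerLagrangian κ₁ W h u -
          keplerLagrangian κ₁ (fun u => z u - c₁ u) (fun u => g u - v₁ u) u) +
        (⟪α₁ u, W u - (z u - c₁ u)⟫_ℝ + ⟪v₁ u, h u - (g u - v₁ u)⟫_ℝ)) volume s t := j1.add j3
  rw [intervalIntegral.integral_add j4 intervalIntegrable_const,
    intervalIntegral.integral_add j1 j3, intervalIntegral.integral_add (toI iL) j2,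
    intervalIntegral.integral_sub (toI hWi) (toI iK), hbp, intervalIntegral.integral_const,
    smul_eq_mul] at hmono
  linarith

/-- The Kepler energy relative to the first centre stays bounded above along a collision-free arc
near that centre. -/
theorem exists_energy_le (M : IsTwoCenterMinimizer κ₁ κ₂ c₁ c₂ a b z (deriv z)) (hκ₁ : 0 < κ₁)
    (hκ₂ : 0 < κ₂) (hc₁ : IsSmoothCenter c₁ v₁ α₁ a b) (hc₂ : ContinuousOn c₂ (Icc a b))
    {s t d K : ℝ} (hst : s < t) (hsub : Icc s t ⊆ Ioo a b) (hd : 0 < d)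
    (hn : ∀ u ∈ Ico s t, z u ≠ c₁ u) (hfar : ∀ u ∈ Icc s t, d ≤ ‖z u - c₂ u‖)
    (hα : ∀ u ∈ Icc s t, ‖α₁ u‖ ≤ K) :
    ∃ C : ℝ, ∀ u ∈ Ico s t, ‖deriv z u - v₁ u‖ ^ 2 / 2 - κ₁ / ‖z u - c₁ u‖ ≤ C := by
  have hs := (hsub (left_mem_Icc.2 hst.le)).1
  have ht := (hsub (right_mem_Icc.2 hst.le)).2
  have hw := (M.hasL2Deriv.mono hs.le ht.le).sub (hc₁.hasL2Deriv hsub)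
  set R := κ₂ / d ^ 2 + K with hR
  have hiW : IntegrableOn (fun u => R * ‖deriv z u - v₁ u‖) (Icc s t) :=
    hw.integrableOn.norm.const_mul R
  have hR0 : 0 ≤ R := by
    have := (norm_nonneg _).trans (hα s (left_mem_Icc.2 hst.le))
    positivity
  have hEL : ∀ u ∈ Ico s t, HasDerivAt (fun u => z u - c₁ u) (deriv z u - v₁ u) u ∧
      HasDerivAt (fun u => deriv z u - v₁ u) (force κ₁ κ₂ c₁ c₂ z u - α₁ u) u := fun u hu => by
    have huI := hsub (Ico_subset_Icc_self hu)
    have h2 : z u ≠ c₂ u := fun e => by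
      have := hfar u (Ico_subset_Icc_self hu)
      rw [e, sub_self, norm_zero] at this; linarith
    obtain ⟨e1, e2⟩ := M.euler_lagrange hκ₁ hκ₂ hc₁.continuousOn hc₂ huI (hn u hu) h2
    exact ⟨e1.sub (hc₁.hasDerivAt u huI), e2.sub (hc₁.hasDerivAt_velocity u huI)⟩
  set e : ℝ → ℝ := fun u => ‖deriv z u - v₁ u‖ ^ 2 / 2 - κ₁ / ‖z u - c₁ u‖ with he
  -- The attraction of the first centre cancels. The remaining power is at most R times the relative
  -- speed, which is integrable even up to a collision at `t`.
  have hder : ∀ u ∈ Ico s t, HasDerivAt e (⟪deriv z u - v₁ u,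
      -(κ₂ / ‖z u - c₂ u‖ ^ 3) • (z u - c₂ u) - α₁ u⟫_ℝ) u := fun u hu => by
    obtain ⟨d1, d2⟩ := hEL u hu
    have hw0 : z u - c₁ u ≠ 0 := sub_ne_zero.2 (hn u hu)
    have hw0' := norm_ne_zero_iff.2 hw0
    have h1 := (d2.norm_sq.div_const 2).sub
      ((hasDerivAt_const u κ₁).div (hasDerivAt_norm_of_ne_zero d1 hw0) hw0')
    refine h1.congr_deriv ?_
    rw [force, real_inner_comm (deriv z u - v₁ u) (z u - c₁ u)]
    generalize z u - c₁ u = w at hw0' ⊢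
    generalize deriv z u - v₁ u = V
    generalize z u - c₂ u = w₂
    simp only [inner_sub_right, real_inner_smul_right]
    field_simp
    ring
  have hbound : ∀ u ∈ Ico s t, ⟪deriv z u - v₁ u,
      -(κ₂ / ‖z u - c₂ u‖ ^ 3) • (z u - c₂ u) - α₁ u⟫_ℝ ≤ R * ‖deriv z u - v₁ u‖ := by
    intro u hu
    refine (real_inner_le_norm _ _).trans ?_
    rw [mul_comm]
    refine mul_le_mul_of_nonneg_right ?_ (norm_nonneg _)
    have huI := Ico_subset_Icc_self hu
    have h1 := norm_sub_le (-(κ₂ / ‖z u - c₂ u‖ ^ 3) • (z u - c₂ u)) (α₁ u)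
    have h2 := hfar u huI
    have h3 : ‖-(κ₂ / ‖z u - c₂ u‖ ^ 3) • (z u - c₂ u)‖ = κ₂ / ‖z u - c₂ u‖ ^ 2 := by
      have : 0 < ‖z u - c₂ u‖ := by linarith
      rw [norm_smul, norm_neg, Real.norm_of_nonneg (by positivity)]
      field_simp
    have h4 : κ₂ / ‖z u - c₂ u‖ ^ 2 ≤ κ₂ / d ^ 2 := by gcongr
    linarith [hα u huI]
  refine ⟨e s + ∫ u in s..t, R * ‖deriv z u - v₁ u‖, fun u hu => ?_⟩
  have hsubu : Icc s u ⊆ Ico s t := fun x hx => ⟨hx.1, hx.2.trans_lt hu.2⟩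
  have h1 := intervalIntegral.sub_le_integral_of_hasDeriv_right_of_le hu.1
    (fun x hx => (hder x (hsubu hx)).continuousAt.continuousWithinAt)
    (fun x hx => (hder x (hsubu (Ioo_subset_Icc_self hx))).hasDerivWithinAt)
    (hiW.mono_set (hsubu.trans Ico_subset_Icc_self))
    (fun x hx => hbound x (hsubu (Ioo_subset_Icc_self hx)))
  have h2 : ∫ x in s..u, R * ‖deriv z x - v₁ x‖ ≤ ∫ x in s..t, R * ‖deriv z x - v₁ x‖ := by
    refine intervalIntegral.integral_mono_interval le_rfl hu.1 hu.2.le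
      (Eventually.of_forall fun x => by positivity)
      ((hiW.mono_set (by rw [uIcc_of_le hst.le])).intervalIntegrable)
  have : e u ≤ e s + ∫ x in s..t, R * ‖deriv z x - v₁ x‖ := by linarith
  exact this

end IsTwoCenterMinimizer

/-! ### Exclusion of interior collisions -/

/-- Numerical incompatibility of the lower and upper bounds for the action near a collision. -/
theorem collision_bounds_false {l r x y : ℝ} (hx : 45 / 100 ≤ x) (hy : 0 < y)
    (hl₁ : 2 * √2 ≤ l) (hl₂ : 4 / 3 * √2 + x ≤ l) (hr₁ : 2 * √2 ≤ r) (hr₂ : 4 / 3 * √2 + y ≤ r)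
    (hr₃ : 1 / (2 * y) ≤ r)
    (hup : ∀ σ, 0 < σ → σ ≤ x + y → l + r ≤ 8 / 3 / σ + 5 / 3 * σ + (x + y - σ) + 1 / 100) :
    False := by
  have h2 : (1414 / 1000 : ℝ) ≤ √2 := Real.le_sqrt_of_sq_le (by norm_num)
  -- Here x, y are the normalized durations and l, r the normalized actions of the two legs. A long
  -- passage is beaten by an arc of duration 2 followed by a rest; a shorter one by an arc of the
  -- full duration σ = x + y. When y is small, so that the arc is expensive, the Cauchy-Schwarz
  -- bound 1/(2y) compensates.
  rcases le_or_gt 2 (x + y) with hσ | hσ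
  · have := hup 2 (by norm_num) hσ
    norm_num at this
    linarith
  · have hu := hup (x + y) (by linarith) le_rfl
    rw [sub_self, add_zero] at hu
    set σ := x + y with hs
    have hσ0 : 0 < σ := by linarith
    have hf : ∀ B : ℝ, 8 / 3 + 5 / 3 * σ ^ 2 ≤ B * σ → 8 / 3 / σ + 5 / 3 * σ ≤ B := by
      intro B hB
      have : 8 / 3 / σ + 5 / 3 * σ = (8 / 3 + 5 / 3 * σ ^ 2) / σ := by field_simp
      rw [this, div_le_iff₀ hσ0]
      exact hB
    rcases le_or_gt y (1 / 10) with h | h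
    · have := hf (67 / 10) (by nlinarith)
      have h3 : 5 ≤ 1 / (2 * y) := by rw [le_div_iff₀ (by positivity)]; linarith
      linarith
    · rcases le_or_gt y (16 / 100) with h' | h'
      · have := hf (58 / 10) (by nlinarith)
        have h3 : 3125 / 1000 ≤ 1 / (2 * y) := by rw [le_div_iff₀ (by positivity)]; linarith
        linarith
      · have := hf (55 / 10) (by nlinarith)
        linarith

/-- Kepler scaling: measuring times in units of ε²/√(κε) and actions in units of √(κε) removes κ and
ε and leaves `collision_bounds_false`. -/
theorem collision_action_false {κ ε t₁ b₀ t₂ L R : ℝ} (hκ : 0 < κ) (hε : 0 < ε)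
    (h₂ : b₀ < t₂) (L1 : 2 * √2 * √(κ * ε) ≤ L)
    (L2 : 4 / 3 * √2 * √(κ * ε) + κ * (b₀ - t₁) / ε ≤ L)
    (L3 : 45 / 100 * (ε ^ 2 / √(κ * ε)) ≤ b₀ - t₁) (R1 : 2 * √2 * √(κ * ε) ≤ R)
    (R2 : 4 / 3 * √2 * √(κ * ε) + κ * (t₂ - b₀) / ε ≤ R)
    (R3 : ε ^ 2 / (2 * (t₂ - b₀)) ≤ R)
    (hup : ∀ m, t₁ < m → m ≤ t₂ → L + R ≤ 8 / 3 * (ε ^ 2 / (m - t₁)) +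
      5 / 3 * (κ * (m - t₁) / ε) + κ * (t₂ - m) / ε + √(κ * ε) / 100) : False := by
  have hQ0 : 0 < √(κ * ε) := Real.sqrt_pos.2 (by positivity)
  have hQ2 : √(κ * ε) ^ 2 = κ * ε := Real.sq_sqrt (by positivity)
  generalize √(κ * ε) = Q at *
  have hscale : ∀ τ, κ * τ / ε = τ * Q / ε ^ 2 * Q := fun τ => by
    have : τ * Q / ε ^ 2 * Q = τ * Q ^ 2 / ε ^ 2 := by ring
    rw [this, hQ2]; field_simp
  have h2' := sub_pos.2 h₂
  refine collision_bounds_false (l := L / Q) (r := R / Q) (x := (b₀ - t₁) * Q / ε ^ 2)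
    (y := (t₂ - b₀) * Q / ε ^ 2) ?_ (by positivity) ?_ ?_ ?_ ?_ ?_ ?_
  · rw [le_div_iff₀ (by positivity)]
    rw [mul_div_assoc', div_le_iff₀ hQ0] at L3
    linarith
  · rw [le_div_iff₀ hQ0]; exact L1
  · rw [le_div_iff₀ hQ0, add_mul, ← hscale]; exact L2
  · rw [le_div_iff₀ hQ0]; linarith
  · rw [le_div_iff₀ hQ0, add_mul, ← hscale]; exact R2
  · rw [le_div_iff₀ hQ0]
    have e : 1 / (2 * ((t₂ - b₀) * Q / ε ^ 2)) * Q = ε ^ 2 / (2 * (t₂ - b₀)) := by field_simp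
    rw [e]; exact R3
  · intro σ hσ hσ2
    have hsum : (b₀ - t₁) * Q / ε ^ 2 + (t₂ - b₀) * Q / ε ^ 2 = (t₂ - t₁) * Q / ε ^ 2 := by ring
    rw [hsum] at hσ2 ⊢
    have hτ : 0 < σ * ε ^ 2 / Q := by positivity
    have hm2 : σ * ε ^ 2 / Q ≤ t₂ - t₁ := by
      rw [le_div_iff₀ (by positivity)] at hσ2
      rwa [div_le_iff₀ hQ0]
    have hWa := hup (t₁ + σ * ε ^ 2 / Q) (by linarith) (by linarith)
    rw [← add_div, div_le_iff₀ hQ0]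
    rw [add_sub_cancel_left] at hWa
    have e1 : ε ^ 2 / (σ * ε ^ 2 / Q) = Q / σ := by field_simp
    have e2 : κ * (σ * ε ^ 2 / Q) / ε = σ * Q := by
      rw [hscale]; field_simp
    have e3 : κ * (t₂ - (t₁ + σ * ε ^ 2 / Q)) / ε = ((t₂ - t₁) * Q / ε ^ 2 - σ) * Q := by
      have : κ * (t₂ - (t₁ + σ * ε ^ 2 / Q)) / ε =
          κ * (t₂ - t₁) / ε - κ * (σ * ε ^ 2 / Q) / ε := by ring
      rw [this, e2, hscale (t₂ - t₁)]; ring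
    rw [e1, e2, e3] at hWa
    have e4 : (8 / 3 / σ + 5 / 3 * σ + ((t₂ - t₁) * Q / ε ^ 2 - σ) + 1 / 100) * Q =
        8 / 3 * (Q / σ) + 5 / 3 * (σ * Q) + ((t₂ - t₁) * Q / ε ^ 2 - σ) * Q + Q / 100 := by ring
    rw [e4]
    linarith

namespace IsTwoCenterMinimizer

variable {κ₁ κ₂ : ℝ} {c₁ c₂ v₁ α₁ v₂ α₂ : ℝ → ℂ} {a b : ℝ} {z : ℝ → ℂ}

/-- A minimizer does not collide with a centre at the end of a collision-free arc. -/
theorem ne_center_of_left (M : IsTwoCenterMinimizer κ₁ κ₂ c₁ c₂ a b z (deriv z)) (hκ₁ : 0 < κ₁)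
    (hκ₂ : 0 < κ₂) (hc₁ : IsSmoothCenter c₁ v₁ α₁ a b) (hc₂ : ContinuousOn c₂ (Icc a b))
    {t' b₀ : ℝ} (hat' : a < t') (ht'b : t' < b₀) (hb : b₀ < b) (hn : ∀ u ∈ Ico t' b₀, z u ≠ c₁ u)
    (hsep : c₁ b₀ ≠ c₂ b₀) : z b₀ ≠ c₁ b₀ := by
  intro hcol
  have hb₀ : b₀ ∈ Ioo a b := ⟨hat'.trans ht'b, hb⟩
  have hnb : Icc a b ∈ 𝓝 b₀ := Icc_mem_nhds hb₀.1 hb₀.2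
  set d := ‖c₁ b₀ - c₂ b₀‖ / 3 with hd_def
  have hd : 0 < d := by
    have := norm_pos_iff.2 (sub_ne_zero.2 hsep)
    positivity
  have hzc := M.hasL2Deriv.continuousOn
  have hev : ∀ᶠ u in 𝓝 b₀, u ∈ Ioo a b ∧ 2 * d < ‖c₁ u - c₂ u‖ ∧ d < ‖z u - c₂ u‖ := by
    have k1 := ((hc₁.continuousOn.continuousAt hnb).sub (hc₂.continuousAt hnb)).norm
    have k2 := ((hzc.continuousAt hnb).sub (hc₂.continuousAt hnb)).norm
    filter_upwards [Ioo_mem_nhds hb₀.1 hb₀.2,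
      k1.eventually_const_lt (u := 2 * d) (by simp only [Pi.sub_apply]; linarith),
      k2.eventually_const_lt (u := d) (by simp only [Pi.sub_apply, hcol]; linarith)] with u h1 h2 h3 using ⟨h1, h2, h3⟩
  obtain ⟨δ', hδ', hball⟩ := Metric.eventually_nhds_iff.1 hev
  set δ := min (δ' / 2) (b₀ - t') with hδ_def
  have hδ : 0 < δ := lt_min (by linarith) (by linarith)
  have hδ1 : δ < δ' := (min_le_left _ _).trans_lt (by linarith)
  have hδ2 : δ ≤ b₀ - t' := min_le_right _ _
  set s := b₀ - δ with hs
  set t := b₀ + δ with ht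
  have hin : ∀ u ∈ Icc s t, u ∈ Ioo a b ∧ 2 * d < ‖c₁ u - c₂ u‖ ∧ d < ‖z u - c₂ u‖ :=
    fun u hu => hball (by rw [Real.dist_eq, abs_lt]; constructor <;> linarith [hu.1, hu.2])
  have hsub : Icc s t ⊆ Ioo a b := fun u hu => (hin u hu).1
  obtain ⟨K, hK⟩ := isCompact_Icc.exists_bound_of_continuousOn
    (hc₁.continuousOn_acceleration.mono hsub)
  have hsb : s < b₀ := by linarith
  have hbt : b₀ < t := by linarith
  obtain ⟨C, hC⟩ := M.exists_energy_le hκ₁ hκ₂ hc₁ hc₂ hsb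
    ((Icc_subset_Icc_right hbt.le).trans hsub) hd
    (fun u hu => hn u ⟨by linarith [hu.1], hu.2⟩)
    (fun u hu => (hin u ⟨hu.1, hu.2.trans hbt.le⟩).2.2.le)
    (fun u hu => hK u ⟨hu.1, hu.2.trans hbt.le⟩)
  have hsI := hsub ⟨le_rfl, (hsb.trans hbt).le⟩
  have htI := hsub ⟨(hsb.trans hbt).le, le_rfl⟩
  have hwL := (M.hasL2Deriv.mono hsI.1.le htI.2.le).sub (hc₁.hasL2Deriv hsub)
  set w : ℝ → ℂ := fun u => z u - c₁ u with hw
  set w' : ℝ → ℂ := fun u => deriv z u - v₁ u with hw'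
  have hwc := hwL.continuousOn
  have hwd : ∀ u ∈ Icc s t, w u ≠ 0 → HasDerivAt w (w' u) u := fun u hu h0 =>
    (M.euler_lagrange hκ₁ hκ₂ hc₁.continuousOn hc₂ (hsub hu) (sub_ne_zero.1 h0) (fun e => by
      have := (hin u hu).2.2
      rw [e, sub_self, norm_zero] at this; linarith)).1.sub (hc₁.hasDerivAt u (hsub hu))
  have hφ : IntegrableOn (keplerLagrangian κ₁ w w') (Icc s t) :=
    M.integrableOn_kepler hκ₁ hκ₂ hc₁ hsub
  have hwb : w b₀ = 0 := by simp [hw, hcol]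
  have hws : 0 < ‖w s‖ := norm_pos_iff.2 (sub_ne_zero.2 (hn s ⟨by linarith, hsb⟩))
  have hae0 : ∀ᵐ u ∂(volume.restrict (Icc s t)), w u ≠ 0 := by
    have := ae_restrict_of_ae_restrict_of_subset (hsub.trans Ioo_subset_Icc_self) M.ae_ne
    filter_upwards [this] with u hu using sub_ne_zero.2 hu.1
  -- The path cannot rest at the centre after b₀, since it avoids the centres almost everywhere. So
  -- it leaves the small disc later.
  obtain ⟨t₃, ht₃, hwt₃⟩ : ∃ t₃ ∈ Ioc b₀ t, w t₃ ≠ 0 := by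
    by_contra hcon
    push Not at hcon
    have h1 : ∀ᵐ u ∂(volume.restrict (Ioc b₀ t)), False := by
      have h2 : ∀ᵐ u ∂(volume.restrict (Ioc b₀ t)), w u ≠ 0 :=
        ae_restrict_of_ae_restrict_of_subset
          (fun u hu => ⟨by linarith [hu.1], hu.2⟩ : Ioc b₀ t ⊆ Icc s t) hae0
      filter_upwards [h2, ae_restrict_mem measurableSet_Ioc] with u h3 h4 using h3 (hcon u h4)
    rw [Filter.eventually_false_iff_eq_bot, ae_eq_bot, Measure.restrict_eq_zero,
      Real.volume_Ioc, ENNReal.ofReal_eq_zero] at h1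
    linarith
  set E := 3 * (K + κ₂ / d ^ 2) * (2 * δ) with hE
  have hK0 : 0 ≤ K := (norm_nonneg _).trans (hK b₀ ⟨hsb.le, hbt.le⟩)
  have hE0 : 0 ≤ E := by positivity
  -- The radius is small enough for exits on both sides, for distance from the second centre, for a
  -- negligible energy constant, and for a comparison error E ε at most √(κ₁ε)/100.
  obtain ⟨ε, hε, hε1, hε2, hε3, hε4, hε5⟩ : ∃ ε : ℝ, 0 < ε ∧ ε ≤ ‖w s‖ ∧ ε ≤ ‖w t₃‖ ∧ 2 * ε ≤ d ∧
      C * ε ≤ κ₁ / 20 ∧ (100 * E) ^ 2 * ε ≤ κ₁ := by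
    have p1 : 0 < κ₁ / (20 * (|C| + 1)) := by positivity
    have p2 : 0 < κ₁ / ((100 * E) ^ 2 + 1) := by positivity
    have p3 := norm_pos_iff.2 hwt₃
    refine ⟨min (min ‖w s‖ ‖w t₃‖) (min (d / 2) (min (κ₁ / (20 * (|C| + 1)))
      (κ₁ / ((100 * E) ^ 2 + 1)))), by positivity, (min_le_left _ _).trans (min_le_left _ _),
      (min_le_left _ _).trans (min_le_right _ _), ?_, ?_, ?_⟩
    all_goals
      set ε := min (min ‖w s‖ ‖w t₃‖) (min (d / 2) (min (κ₁ / (20 * (|C| + 1)))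
        (κ₁ / ((100 * E) ^ 2 + 1))))
    · have : ε ≤ d / 2 := (min_le_right _ _).trans (min_le_left _ _)
      linarith
    · have : ε ≤ κ₁ / (20 * (|C| + 1)) :=
        (min_le_right _ _).trans ((min_le_right _ _).trans (min_le_left _ _))
      rw [le_div_iff₀ (by positivity)] at this
      have hε : 0 < ε := by positivity
      nlinarith [le_abs_self C]
    · have : ε ≤ κ₁ / ((100 * E) ^ 2 + 1) :=
        (min_le_right _ _).trans ((min_le_right _ _).trans (min_le_right _ _))
      rw [le_div_iff₀ (by positivity)] at this
      have hε : 0 < ε := by positivity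
      linarith
  have hwn0 : ‖w b₀‖ = 0 := by rw [hwb, norm_zero]
  obtain ⟨t₁, ht₁, hwt₁, hlt₁⟩ := exists_last_ge hsb.le
    (hwc.norm.mono (Icc_subset_Icc_right hbt.le)) hε1 (by rw [hwn0]; exact hε)
  obtain ⟨t₂, ht₂, hwt₂, hlt₂⟩ := exists_first_ge ht₃.1.le
    (hwc.norm.mono (Icc_subset_Icc hsb.le ht₃.2)) (by rw [hwn0]; exact hε) hε2
  have ht₂t : t₂ ≤ t := ht₂.2.trans ht₃.2
  -- Collisions may recur after b₀, so the calibrations on the right start at the last collision p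
  -- before the exit. On [b₀, p] the Lagrangian is at least κ₁/ε almost everywhere, which restores
  -- the duration term.
  obtain ⟨p, hp, hwp, hltp⟩ := exists_last_ge (f := fun u => -‖w u‖) (ε := 0) ht₂.1.le
    (hwc.norm.neg.mono (Icc_subset_Icc hsb.le ht₂t)) (by rw [hwn0, neg_zero])
    (by rw [hwt₂]; linarith)
  have hwp0 : ‖w p‖ = 0 := by linarith
  have hle : ∀ u ∈ Icc t₁ t₂, ‖w u‖ ≤ ε := fun u hu => by
    rcases lt_trichotomy u b₀ with h | h | h
    · rcases hu.1.eq_or_lt with e | e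
      · rw [← e, hwt₁]
      · exact (hlt₁ u ⟨e, h.le⟩).le
    · rw [h, hwn0]; exact hε.le
    · rcases hu.2.eq_or_lt with e | e
      · rw [e, hwt₂]
      · exact (hlt₂ u ⟨h.le, e⟩).le
  have hsubI : ∀ {x y : ℝ}, s ≤ x → y ≤ t → Icc x y ⊆ Icc s t := fun h1 h2 => Icc_subset_Icc h1 h2
  have toI : ∀ {x y : ℝ}, s ≤ x → x ≤ y → y ≤ t →
      IntervalIntegrable (keplerLagrangian κ₁ w w') volume x y := fun h1 h2 h3 =>
    (hφ.mono_set (by rw [uIcc_of_le h2]; exact hsubI h1 h3)).intervalIntegrable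
  have hleft0 : ∀ u ∈ Ioo t₁ b₀, w u ≠ 0 := fun u hu =>
    sub_ne_zero.2 (hn u ⟨by linarith [hu.1, ht₁.1], hu.2⟩)
  have hleftd : ∀ u ∈ Ioo t₁ b₀, HasDerivAt w (w' u) u := fun u hu =>
    hwd u ⟨ht₁.1.trans hu.1.le, (hu.2.trans hbt).le⟩ (hleft0 u hu)
  have hright0 : ∀ u ∈ Ioo p t₂, w u ≠ 0 := fun u hu => by
    have := hltp u ⟨hu.1, hu.2.le⟩
    exact norm_pos_iff.1 (by linarith)
  have hsp : s ≤ p := hsb.le.trans hp.1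
  have hrightd : ∀ u ∈ Ioo p t₂, HasDerivAt w (w' u) u := fun u hu =>
    hwd u ⟨hsp.trans hu.1.le, hu.2.le.trans ht₂t⟩ (hright0 u hu)
  have hwcl := hwc.mono (hsubI ht₁.1 hbt.le)
  have hwcr := hwc.mono (hsubI hsp ht₂t)
  have L1 := collision_leg hκ₁ hε ht₁.2.le hwcl hleftd hleft0
    (hφ.mono_set (hsubI ht₁.1 hbt.le)) (Or.inr ⟨hwt₁, hwn0⟩)
  have L2 := collision_leg_of_norm_le hκ₁ hε ht₁.2.le hwcl hleftd hleft0
    (hφ.mono_set (hsubI ht₁.1 hbt.le)) (Or.inr ⟨hwt₁, hwn0⟩)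
    (fun u hu => hle u ⟨hu.1, hu.2.trans ht₂.1.le⟩)
  have L3 := collision_time hκ₁ hε ht₁.2.le hwcl hleftd hleft0
    (fun u hu => hle u ⟨hu.1, hu.2.trans ht₂.1.le⟩)
    (fun u hu => hC u ⟨ht₁.1.trans hu.1.le, hu.2⟩) hε4 hwt₁ hwn0
  have R1 := collision_leg hκ₁ hε hp.2.le hwcr hrightd hright0
    (hφ.mono_set (hsubI hsp ht₂t)) (Or.inl ⟨hwp0, hwt₂⟩)
  have R2 := collision_leg_of_norm_le hκ₁ hε hp.2.le hwcr hrightd hright0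
    (hφ.mono_set (hsubI hsp ht₂t)) (Or.inl ⟨hwp0, hwt₂⟩)
    (fun u hu => hle u ⟨ht₁.2.le.trans (hp.1.trans hu.1), hu.2⟩)
  have hgap : κ₁ * (p - b₀) / ε ≤ ∫ u in b₀..p, keplerLagrangian κ₁ w w' u := by
    have h1 : ∫ u in b₀..p, κ₁ / ε ≤ ∫ u in b₀..p, keplerLagrangian κ₁ w w' u := by
      refine intervalIntegral.integral_mono_ae_restrict hp.1 intervalIntegrable_const
        (toI hsb.le hp.1 (hp.2.le.trans ht₂t)) ?_
      have h2 := ae_restrict_of_ae_restrict_of_subset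
        (hsubI hsb.le (hp.2.le.trans ht₂t) : Icc b₀ p ⊆ Icc s t) hae0
      filter_upwards [h2, ae_restrict_mem measurableSet_Icc] with u h3 h4
      have h5 := hle u ⟨ht₁.2.le.trans h4.1, h4.2.trans hp.2.le⟩
      have h6 : κ₁ / ε ≤ κ₁ / ‖w u‖ :=
        div_le_div_of_nonneg_left hκ₁.le (norm_pos_iff.2 h3) h5
      have h7 : 0 ≤ ‖w' u‖ ^ 2 / 2 := by positivity
      simp only [keplerLagrangian]
      linarith
    rw [intervalIntegral.integral_const, smul_eq_mul] at h1
    calc κ₁ * (p - b₀) / ε = (p - b₀) * (κ₁ / ε) := by ring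
      _ ≤ _ := h1
  have hgap0 : 0 ≤ κ₁ * (p - b₀) / ε :=
    div_nonneg (mul_nonneg hκ₁.le (sub_nonneg.2 hp.1)) hε.le
  have R3 : ε ^ 2 / (2 * (t₂ - b₀)) ≤ ∫ u in b₀..t₂, keplerLagrangian κ₁ w w' u := by
    have h1 := (hwL.mono hsb.le ht₂t).sq_div_le ht₂.1
    rw [hwb, sub_zero, hwt₂] at h1
    refine h1.trans (intervalIntegral.integral_mono_on ht₂.1.le ?_ (toI hsb.le ht₂.1.le ht₂t)
      fun u _ => ?_)
    · have : IntegrableOn (fun u => ‖w' u‖ ^ 2 / 2) (Icc b₀ t₂) :=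
        (hwL.mono hsb.le ht₂t).integrableOn_sq.div_const 2
      exact (this.mono_set (by rw [uIcc_of_le ht₂.1.le])).intervalIntegrable
    · simp only [keplerLagrangian]
      have : 0 ≤ κ₁ / ‖w u‖ := by positivity
      simp only [hw']
      linarith
  set L := ∫ u in t₁..b₀, keplerLagrangian κ₁ w w' u with hL
  set R := ∫ u in b₀..t₂, keplerLagrangian κ₁ w w' u with hR
  have hRsplit : (∫ u in b₀..p, keplerLagrangian κ₁ w w' u) +
      (∫ u in p..t₂, keplerLagrangian κ₁ w w' u) = R :=
    intervalIntegral.integral_add_adjacent_intervals (toI hsb.le hp.1 (hp.2.le.trans ht₂t))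
      (toI hsp hp.2.le ht₂t)
  have hLR : L + R = ∫ u in t₁..t₂, keplerLagrangian κ₁ w w' u :=
    intervalIntegral.integral_add_adjacent_intervals (toI ht₁.1 ht₁.2.le hbt.le)
      (toI hsb.le ht₂.1.le ht₂t)
  refine collision_action_false hκ₁ hε ht₂.1 L1 L2 L3 (by linarith) ?_ R3
    fun m hm1 hm2 => ?_
  · have e : κ₁ * (t₂ - b₀) / ε = κ₁ * (p - b₀) / ε + κ₁ * (t₂ - p) / ε := by ring
    linarith
  · have ht₁₂ : t₁ < t₂ := ht₁.2.trans ht₂.1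
    obtain ⟨W, h, hWL, hWs, hWt, hWn, hWi, hWa⟩ := exists_arc_wait hκ₁ hε hm1 hm2 hwt₁ hwt₂
    have hcmp := M.comparison hκ₁ hκ₂ hc₁ hc₂ ht₁₂ ((hsubI ht₁.1 ht₂t).trans hsub) hd hε hε3
      (fun u hu => (hin u (hsubI ht₁.1 ht₂t hu)).2.1.le) (fun u hu => hK u (hsubI ht₁.1 ht₂t hu))
      (fun u hu => hle u hu) hWL hWs hWt hWn hWi
    have hcmp' : L + R ≤ (∫ u in t₁..t₂, keplerLagrangian κ₁ W h u) +
        3 * (K + κ₂ / d ^ 2) * ε * (t₂ - t₁) := by rw [hLR]; exact hcmp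
    have herr2 : 3 * (K + κ₂ / d ^ 2) * ε * (t₂ - t₁) ≤ E * ε := by
      have : t₂ - t₁ ≤ 2 * δ := by linarith [ht₁.1]
      calc 3 * (K + κ₂ / d ^ 2) * ε * (t₂ - t₁) ≤ 3 * (K + κ₂ / d ^ 2) * ε * (2 * δ) := by gcongr
        _ = E * ε := by rw [hE]; ring
    have herr : E * ε ≤ √(κ₁ * ε) / 100 := by
      refine le_of_sq_le_sq ?_ (by positivity)
      rw [div_pow, Real.sq_sqrt (by positivity)]
      have : (100 * E) ^ 2 * ε * ε ≤ κ₁ * ε := by gcongr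
      linarith
    linarith

/-- A minimizer has no collisions in the interior of the time interval. -/
theorem ne_centers (M : IsTwoCenterMinimizer κ₁ κ₂ c₁ c₂ a b z (deriv z)) (hκ₁ : 0 < κ₁)
    (hκ₂ : 0 < κ₂) (hc₁ : IsSmoothCenter c₁ v₁ α₁ a b) (hc₂ : IsSmoothCenter c₂ v₂ α₂ a b)
    (hsep : ∀ t ∈ Ioo a b, c₁ t ≠ c₂ t) : ∀ t ∈ Ioo a b, z t ≠ c₁ t ∧ z t ≠ c₂ t := by
  intro t ht
  by_contra hcol
  obtain ⟨t', ht', hnt'⟩ : ∃ t' ∈ Ioo a t, z t' ≠ c₁ t' ∧ z t' ≠ c₂ t' := by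
    by_contra hcon
    push Not at hcon
    have h1 : ∀ᵐ u ∂(volume.restrict (Ioo a t)), False := by
      have h2 := ae_restrict_of_ae_restrict_of_subset
          (fun u hu => ⟨hu.1.le, (hu.2.trans ht.2).le⟩ : Ioo a t ⊆ Icc a b) M.ae_ne
      filter_upwards [h2, ae_restrict_mem measurableSet_Ioo] with u h3 h4
      exact h3.2 (hcon u h4 h3.1)
    rw [Filter.eventually_false_iff_eq_bot, ae_eq_bot, Measure.restrict_eq_zero,
      Real.volume_Ioo, ENNReal.ofReal_eq_zero] at h1
    linarith [ht.1]
  -- The first zero of the product of the distances ends an arc free of both kinds of collision.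
  set f : ℝ → ℝ := fun u => -(‖z u - c₁ u‖ * ‖z u - c₂ u‖) with hf
  have hsub : Icc t' t ⊆ Icc a b := Icc_subset_Icc ht'.1.le ht.2.le
  have hfc : ContinuousOn f (Icc t' t) :=
    (((M.hasL2Deriv.continuousOn.sub hc₁.continuousOn).norm.mul
      (M.hasL2Deriv.continuousOn.sub hc₂.continuousOn).norm).neg).mono hsub
  have hft' : f t' < 0 := by
    have h1 := norm_pos_iff.2 (sub_ne_zero.2 hnt'.1)
    have h2 := norm_pos_iff.2 (sub_ne_zero.2 hnt'.2)
    simp only [hf]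
    nlinarith [mul_pos h1 h2]
  have hft : 0 ≤ f t := by
    simp only [hf]
    rw [not_and_or, not_not, not_not] at hcol
    rcases hcol with h | h <;> simp [h]
  obtain ⟨b₀, hb₀, hfb, hlt⟩ := exists_first_ge ht'.2.le hfc hft' hft
  have hnc : ∀ u ∈ Ico t' b₀, z u ≠ c₁ u ∧ z u ≠ c₂ u := fun u hu => by
    have := hlt u hu
    constructor <;> intro e <;> simp [hf, e] at this
  have hb₀I : b₀ ∈ Ioo a b := ⟨ht'.1.trans hb₀.1, hb₀.2.trans_lt ht.2⟩
  have h1 := M.ne_center_of_left hκ₁ hκ₂ hc₁ hc₂.continuousOn ht'.1 hb₀.1 hb₀I.2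
    (fun u hu => (hnc u hu).1) (hsep b₀ hb₀I)
  have h2 := M.swap.ne_center_of_left hκ₂ hκ₁ hc₂ hc₁.continuousOn ht'.1 hb₀.1 hb₀I.2
    (fun u hu => (hnc u hu).2) (hsep b₀ hb₀I).symm
  simp only [hf, neg_eq_zero, mul_eq_zero, norm_eq_zero, sub_eq_zero] at hfb
  rcases hfb with h | h
  · exact h1 h
  · exact h2 h

end IsTwoCenterMinimizer

/-! ### From the extended action to fixed-end minimality -/

theorem action_eq_of_hasL2Deriv {μ m a b : ℝ} {q x h : ℝ → ℂ} (hab : a ≤ b)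
    (hx : HasL2Deriv x h a b) :
    action μ m q a b x = ∫⁻ t in Icc a b, (‖h t‖ₑ ^ 2 / 2 + potential μ m (q t) (x t)) := by
  refine lintegral_congr_ae ?_
  filter_upwards [hx.deriv_ae_eq hab] with t ht
  rw [ht]

theorem integrand_eq_ofReal_lagrangian {μ m t : ℝ} {q x h : ℝ → ℂ} (hμ : 0 < μ) (hm : 0 < m)
    (h0 : x t ≠ 0) (hq : x t ≠ q t) :
    ‖h t‖ₑ ^ 2 / 2 + potential μ m (q t) (x t) =
      ENNReal.ofReal (lagrangian μ m (fun _ => 0) q x h t) := by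
  have p0 := norm_pos_iff.2 h0
  have pq := norm_pos_iff.2 (sub_ne_zero.2 hq)
  simp only [lagrangian, potential, sub_zero]
  rw [ENNReal.ofReal_add (by positivity) (by positivity),
    ENNReal.ofReal_add (by positivity) (by positivity), ENNReal.ofReal_div_of_pos p0,
    ENNReal.ofReal_div_of_pos pq, ENNReal.ofReal_div_of_pos two_pos,
    ENNReal.ofReal_pow (norm_nonneg _), ofReal_norm, ofReal_norm, ofReal_norm, add_assoc]
  simp

theorem action_eq_ofReal {μ m a b : ℝ} {q x h : ℝ → ℂ} (hμ : 0 < μ) (hm : 0 < m) (hab : a ≤ b)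
    (hx : HasL2Deriv x h a b)
    (hi : IntegrableOn (lagrangian μ m (fun _ => 0) q x h) (Icc a b))
    (hn : ∀ᵐ t ∂(volume.restrict (Icc a b)), x t ≠ 0 ∧ x t ≠ q t) :
    action μ m q a b x =
      ENNReal.ofReal (∫ t in a..b, lagrangian μ m (fun _ => 0) q x h t) := by
  rw [action_eq_of_hasL2Deriv hab hx, intervalIntegral.integral_of_le hab,
    ← integral_Icc_eq_integral_Ioc, ofReal_integral_eq_lintegral_ofReal hi
      (Eventually.of_forall fun t => by simp only [lagrangian, Pi.zero_apply]; positivity)]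
  refine lintegral_congr_ae ?_
  filter_upwards [hn] with t ht using integrand_eq_ofReal_lagrangian hμ hm ht.1 ht.2

/-- At a collision the extended potential is infinite, whereas the real quotient is 0. Finiteness of
the action makes collisions a null set, so the two integrands agree almost everywhere. -/
theorem integrableOn_lagrangian_of_action_ne_top {μ m a b : ℝ} {q x h : ℝ → ℂ} (hμ : 0 < μ)
    (hm : 0 < m) (hab : a ≤ b) (hq : ContinuousOn q (Icc a b)) (hx : HasL2Deriv x h a b)
    (hfin : action μ m q a b x ≠ ⊤) :
    IntegrableOn (lagrangian μ m (fun _ => 0) q x h) (Icc a b) ∧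
      ∀ᵐ t ∂(volume.restrict (Icc a b)), x t ≠ 0 ∧ x t ≠ q t := by
  have hxm : AEMeasurable x (volume.restrict (Icc a b)) :=
    (hx.continuousOn.aestronglyMeasurable measurableSet_Icc).aemeasurable
  have hqm : AEMeasurable q (volume.restrict (Icc a b)) :=
    (hq.aestronglyMeasurable measurableSet_Icc).aemeasurable
  have hhm : AEMeasurable h (volume.restrict (Icc a b)) := hx.memLp.1.aemeasurable
  have hpm : AEMeasurable (fun t => ‖h t‖ₑ ^ 2 / 2 + potential μ m (q t) (x t))
      (volume.restrict (Icc a b)) := by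
    unfold potential
    exact ((hhm.enorm.pow_const 2).div_const 2).add
      ((aemeasurable_const.div hxm.enorm).add (aemeasurable_const.div (hxm.sub hqm).enorm))
  rw [action_eq_of_hasL2Deriv hab hx] at hfin
  have hn : ∀ᵐ t ∂(volume.restrict (Icc a b)), x t ≠ 0 ∧ x t ≠ q t := by
    filter_upwards [ae_lt_top' hpm hfin] with t ht
    constructor
    · intro e
      rw [potential, e, enorm_zero, ENNReal.div_zero (by simpa using hμ)] at ht
      simp at ht
    · intro e
      rw [potential, e, sub_self, enorm_zero, ENNReal.div_zero (by simpa using hm)] at ht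
      simp at ht
  refine ⟨⟨?_, ?_⟩, hn⟩
  · unfold lagrangian
    exact (((hhm.norm.pow_const 2).div_const 2).add
      (aemeasurable_const.div (hxm.sub aemeasurable_const).norm) |>.add
      (aemeasurable_const.div (hxm.sub hqm).norm)).aestronglyMeasurable
  · rw [hasFiniteIntegral_iff_ofReal (Eventually.of_forall fun t => by
      simp only [lagrangian, Pi.zero_apply]; positivity)]
    refine lt_of_le_of_lt (le_of_eq ?_) (lt_top_iff_ne_top.2 hfin)
    refine lintegral_congr_ae ?_
    filter_upwards [hn] with t ht using (integrand_eq_ofReal_lagrangian hμ hm ht.1 ht.2).symm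

theorem integrableOn_rpow_mul {T : ℝ} (hT : 0 < T) :
    IntegrableOn (fun t : ℝ => ((-t) * (T + t)) ^ (-(2 / 3) : ℝ)) (Icc (-T) 0) := by
  have h1 : IntervalIntegrable (fun t : ℝ => (-t) ^ (-(2 / 3) : ℝ)) volume (-T) 0 := by
    have := (intervalIntegral.intervalIntegrable_rpow' (a := 0) (b := T) (r := -(2 / 3))
      (by norm_num)).comp_sub_left 0
    simpa using this.symm
  have h2 : IntervalIntegrable (fun t : ℝ => (T + t) ^ (-(2 / 3) : ℝ)) volume (-T) 0 := by
    have := (intervalIntegral.intervalIntegrable_rpow' (a := 0) (b := T) (r := -(2 / 3))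
      (by norm_num)).comp_add_left T
    simpa using this
  have hT' : -T ≤ 0 := by linarith
  rw [intervalIntegrable_iff_integrableOn_Icc_of_le hT'] at h1 h2
  refine Integrable.mono' ((h1.add h2).const_mul ((T / 2) ^ (-(2 / 3) : ℝ))) ?_ ?_
  · exact (Measurable.pow_const (by fun_prop) _).aestronglyMeasurable
  · refine (ae_restrict_iff' measurableSet_Icc).2 (Eventually.of_forall fun t ht => ?_)
    have p1 : 0 ≤ -t := by linarith [ht.2]
    have p2 : 0 ≤ T + t := by linarith [ht.1]
    have q1 : 0 ≤ (-t) ^ (-(2 / 3) : ℝ) := Real.rpow_nonneg p1 _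
    have q2 : 0 ≤ (T + t) ^ (-(2 / 3) : ℝ) := Real.rpow_nonneg p2 _
    have q3 : 0 ≤ (T / 2) ^ (-(2 / 3) : ℝ) := by positivity
    rw [Real.norm_of_nonneg (Real.rpow_nonneg (mul_nonneg p1 p2) _), Real.mul_rpow p1 p2]
    simp only [Pi.add_apply]
    rcases le_total (T / 2) (-t) with h | h
    · have : (-t) ^ (-(2 / 3) : ℝ) ≤ (T / 2) ^ (-(2 / 3) : ℝ) :=
        Real.rpow_le_rpow_of_nonpos (by linarith) h (by norm_num)
      nlinarith [mul_nonneg q3 q1, mul_le_mul_of_nonneg_right this q2]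
    · have : (T + t) ^ (-(2 / 3) : ℝ) ≤ (T / 2) ^ (-(2 / 3) : ℝ) :=
        Real.rpow_le_rpow_of_nonpos (by linarith) (by linarith) (by norm_num)
      nlinarith [mul_nonneg q3 q2, mul_le_mul_of_nonneg_left this q1]

/-- There is a path of finite action from any point of the closed upper half plane to the
collision. -/
theorem exists_action_ne_top {μ m T : ℝ} (hμ : 0 < μ) (hm : 0 < m) (hT : 0 < T) {q : ℝ → ℂ}
    (hqc : ContinuousOn q (Icc (-T) 0)) (hq : ∀ t ∈ Icc (-T) 0, (q t).im = 0) {p : ℂ}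
    (hp : 0 ≤ p.im) :
    ∃ x h : ℝ → ℂ, HasL2Deriv x h (-T) 0 ∧ x (-T) = p ∧ x 0 = 0 ∧ action μ m q (-T) 0 x ≠ ⊤ := by
  -- With exponent 2/3 both β'² and 1/β are O(((-t)(T + t))^(-2/3)), hence integrable. The centres
  -- are real, so a height of at least β bounds both distances from below. The factor T + t allows
  -- the initial point to be a collision too.
  set β : ℝ → ℝ := fun t => ((-t) * (T + t)) ^ (2 / 3 : ℝ) with hβ
  set β' : ℝ → ℝ := fun t => (-(T + 2 * t)) * (2 / 3) * ((-t) * (T + t)) ^ (-(1 / 3) : ℝ) with hβ'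
  set ω : ℝ → ℝ := fun t => ((-t) * (T + t)) ^ (-(2 / 3) : ℝ) with hω
  have hωi : IntegrableOn ω (Icc (-T) 0) := integrableOn_rpow_mul hT
  have hβd : ∀ t ∈ Ioo (-T) 0, HasDerivAt β (β' t) t := fun t ht => by
    have hpos : 0 < (-t) * (T + t) := mul_pos (by linarith [ht.2]) (by linarith [ht.1])
    have h1 : HasDerivAt (fun t : ℝ => (-t) * (T + t)) (-(T + 2 * t)) t := by
      refine ((hasDerivAt_id t).neg.mul ((hasDerivAt_id t).const_add T)).congr_deriv ?_
      simp only [id, Pi.neg_apply]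
      ring
    have := h1.rpow_const (p := 2 / 3) (Or.inl hpos.ne')
    refine this.congr_deriv ?_
    simp only [hβ']
    norm_num
  have hβc : Continuous β := (by fun_prop : Continuous fun t : ℝ => (-t) * (T + t)).rpow_const
    (fun t => Or.inr (by norm_num))
  set x : ℝ → ℂ := fun t => (-t / T : ℝ) • p + (β t : ℂ) * Complex.I with hx
  set h : ℝ → ℂ := fun t => (-1 / T : ℝ) • p + (β' t : ℂ) * Complex.I with hh
  have hxd : ∀ t ∈ Ioo (-T) 0, HasDerivAt x (h t) t := fun t ht => by
    have h1 : HasDerivAt (fun t : ℝ => -t / T) (-1 / T) t := (hasDerivAt_id t).neg.div_const T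
    exact (h1.smul_const p).add ((hβd t ht).ofReal_comp.mul_const Complex.I)
  have hxc : Continuous x := by
    simp only [hx]
    exact ((continuous_neg.div_const T).smul continuous_const).add
      ((Complex.continuous_ofReal.comp hβc).mul continuous_const)
  have hβ'm : Measurable β' := by
    have : Measurable fun t : ℝ => ((-t) * (T + t)) ^ (-(1 / 3) : ℝ) :=
      Measurable.pow_const (by fun_prop) _
    exact Measurable.mul (by fun_prop) this
  have hhm : Measurable h := by
    simp only [hh]
    exact measurable_const.add ((Complex.measurable_ofReal.comp hβ'm).mul measurable_const)
  have hβ'sq : ∀ t ∈ Icc (-T) 0, β' t ^ 2 ≤ T ^ 2 * ω t := fun t ht => by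
    have hnn : 0 ≤ (-t) * (T + t) := mul_nonneg (by linarith [ht.2]) (by linarith [ht.1])
    have e : (((-t) * (T + t)) ^ (-(1 / 3) : ℝ)) ^ 2 = ω t := by
      rw [← Real.rpow_natCast, ← Real.rpow_mul hnn]
      simp only [hω]
      norm_num
    have hω0 : 0 ≤ ω t := Real.rpow_nonneg hnn _
    simp only [hβ']
    rw [mul_pow, e, mul_pow]
    have : (-(T + 2 * t)) ^ 2 ≤ T ^ 2 := by nlinarith [ht.1, ht.2]
    have h3 : (-(T + 2 * t)) ^ 2 * (2 / 3) ^ 2 ≤ T ^ 2 := by nlinarith [sq_nonneg (-(T + 2 * t))]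
    exact mul_le_mul_of_nonneg_right h3 hω0
  have hhsq : ∀ t ∈ Icc (-T) 0, ‖h t‖ ^ 2 ≤ 2 * ‖(-1 / T : ℝ) • p‖ ^ 2 + 2 * (T ^ 2 * ω t) :=
    fun t ht => by
      have h1 := norm_add_le ((-1 / T : ℝ) • p) ((β' t : ℂ) * Complex.I)
      have h2 : ‖(β' t : ℂ) * Complex.I‖ ^ 2 = β' t ^ 2 := by
        rw [norm_mul, Complex.norm_I, mul_one, Complex.norm_real, Real.norm_eq_abs, sq_abs]
      have h3 := hβ'sq t ht
      have h4 : ‖h t‖ ^ 2 ≤ (‖(-1 / T : ℝ) • p‖ + ‖(β' t : ℂ) * Complex.I‖) ^ 2 := by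
        gcongr
      nlinarith [sq_nonneg (‖(-1 / T : ℝ) • p‖ - ‖(β' t : ℂ) * Complex.I‖)]
  have hmem : MemLp h 2 (volume.restrict (Icc (-T) 0)) := by
    refine (memLp_two_iff_integrable_sq_norm hhm.aestronglyMeasurable).2 ?_
    refine Integrable.mono' (g := fun t => 2 * ‖(-1 / T : ℝ) • p‖ ^ 2 + 2 * (T ^ 2 * ω t)) ?_
      (hhm.norm.pow_const 2).aestronglyMeasurable ?_
    · exact Integrable.add (integrable_const _) ((hωi.const_mul _).const_mul _)
    · refine (ae_restrict_iff' measurableSet_Icc).2 (Eventually.of_forall fun t ht => ?_)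
      rw [Real.norm_of_nonneg (by positivity)]
      exact hhsq t ht
  have hL : HasL2Deriv x h (-T) 0 := HasL2Deriv.of_hasDerivAt hxc.continuousOn hxd hmem
  have hIoo : ∀ᵐ t ∂(volume.restrict (Icc (-T) 0)), t ∈ Ioo (-T) 0 := by
    rw [← restrict_Ioo_eq_restrict_Icc]
    exact ae_restrict_mem measurableSet_Ioo
  have him : ∀ t ∈ Ioo (-T) 0, β t ≤ (x t).im ∧ 0 < β t := fun t ht => by
    have hpos : 0 < (-t) * (T + t) := mul_pos (by linarith [ht.2]) (by linarith [ht.1])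
    refine ⟨?_, Real.rpow_pos_of_pos hpos _⟩
    simp only [hx]
    simp
    exact mul_nonneg (by rw [neg_div, neg_nonneg]; exact div_nonpos_of_nonpos_of_nonneg ht.2.le hT.le) hp
  have hnorm : ∀ t ∈ Ioo (-T) 0, β t ≤ ‖x t‖ ∧ β t ≤ ‖x t - q t‖ := fun t ht => by
    have h1 := (him t ht).1
    refine ⟨h1.trans ((le_abs_self _).trans (Complex.abs_im_le_norm _)), ?_⟩
    have h2 := Complex.abs_im_le_norm (x t - q t)
    rw [Complex.sub_im, hq t (Ioo_subset_Icc_self ht), sub_zero] at h2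
    exact h1.trans ((le_abs_self _).trans h2)
  have hn : ∀ᵐ t ∂(volume.restrict (Icc (-T) 0)), x t ≠ 0 ∧ x t ≠ q t := by
    filter_upwards [hIoo] with t ht
    have h1 := hnorm t ht
    have h2 := (him t ht).2
    exact ⟨norm_pos_iff.1 (by linarith), sub_ne_zero.1 (norm_pos_iff.1 (by linarith))⟩
  have hi : IntegrableOn (lagrangian μ m (fun _ => 0) q x h) (Icc (-T) 0) := by
    refine Integrable.mono' (g := fun t => (2 * ‖(-1 / T : ℝ) • p‖ ^ 2 + 2 * (T ^ 2 * ω t)) +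
      (μ + m) * ω t) ?_ ?_ ?_
    · exact ((integrable_const _).add ((hωi.const_mul _).const_mul _)).add (hωi.const_mul _)
    · have hqm : AEMeasurable q (volume.restrict (Icc (-T) 0)) :=
        (hqc.aestronglyMeasurable measurableSet_Icc).aemeasurable
      have hxm : AEMeasurable x (volume.restrict (Icc (-T) 0)) := hxc.measurable.aemeasurable
      unfold lagrangian
      exact (((hhm.aemeasurable.norm.pow_const 2).div_const 2).add
        (aemeasurable_const.div (hxm.sub aemeasurable_const).norm) |>.add
        (aemeasurable_const.div (hxm.sub hqm).norm)).aestronglyMeasurable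
    · filter_upwards [hIoo] with t ht
      have h1 := hnorm t ht
      have h2 := (him t ht).2
      have h3 := hhsq t (Ioo_subset_Icc_self ht)
      have hpos : 0 ≤ (-t) * (T + t) := mul_nonneg (by linarith [ht.2]) (by linarith [ht.1])
      have h4 : ω t = 1 / β t := by
        simp only [hω, hβ]
        rw [Real.rpow_neg hpos, one_div]
      have h5 : μ / ‖x t‖ ≤ μ * ω t := by
        rw [h4, mul_one_div]; exact div_le_div_of_nonneg_left hμ.le h2 h1.1
      have h6 : m / ‖x t - q t‖ ≤ m * ω t := by
        rw [h4, mul_one_div]; exact div_le_div_of_nonneg_left hm.le h2 h1.2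
      have hnn : 0 ≤ lagrangian μ m (fun _ => 0) q x h t := by simp only [lagrangian]; positivity
      rw [Real.norm_of_nonneg hnn]
      simp only [lagrangian, sub_zero]
      have : 0 ≤ ‖h t‖ ^ 2 := by positivity
      linarith
  refine ⟨x, h, hL, ?_, ?_, ?_⟩
  · simp [hx, hβ, hT.ne']
  · simp [hx, hβ]
  · rw [action_eq_ofReal hμ hm (by linarith) hL hi hn]
    exact ENNReal.ofReal_ne_top

theorem IsActionMinimizer.isTwoCenterMinimizer {μ m T : ℝ} (hμ : 0 < μ) (hm : 0 < m) (hT : 0 < T)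
    {q : ℝ → ℂ} (hqc : ContinuousOn q (Icc (-T) 0)) (hq : ∀ t ∈ Icc (-T) 0, (q t).im = 0)
    {A A₀ : Set ℂ} (hA : A ⊆ {w : ℂ | 0 ≤ w.im}) (h0 : (0 : ℂ) ∈ A₀) {z : ℝ → ℂ}
    (hz : IsActionMinimizer μ m q (-T) 0 A A₀ z) :
    IsTwoCenterMinimizer μ m (fun _ => 0) q (-T) 0 z (deriv z) := by
  have hT' : -T ≤ 0 := by linarith
  obtain ⟨⟨hzH, hzA, hzA₀⟩, hmin⟩ := hz
  have hzL := (isH1Path_iff hT').1 hzH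
  have hfin : action μ m q (-T) 0 z ≠ ⊤ := by
    obtain ⟨x, h, hx, hx1, hx2, hx3⟩ := exists_action_ne_top hμ hm hT hqc hq (hA hzA)
    have hxΩ : x ∈ pathSpace (-T) 0 A A₀ :=
      ⟨hx.isH1Path hT', by rw [hx1]; exact hzA, by rw [hx2]; exact h0⟩
    exact ne_top_of_le_ne_top hx3 (hmin hxΩ)
  obtain ⟨hi, hn⟩ := integrableOn_lagrangian_of_action_ne_top hμ hm hT' hqc hzL hfin
  refine ⟨hzL, hi, hn, fun s t x h hs hst ht hx hxs hxt hxn => ?_⟩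
  -- The competitor is `z` with its piece on [s, t] replaced by `x`.
  have hG := ((hzL.mono le_rfl (hst.le.trans ht)).glue hs hst.le hx hxs.symm).glue
    (hs.trans hst.le) ht (hzL.mono (hs.trans hst.le) le_rfl)
    (by simp only [not_le.2 hst, if_false, hxt])
  set X : ℝ → ℂ := fun u => if u ≤ t then (if u ≤ s then z u else x u) else z u with hX
  set H : ℝ → ℂ := fun u => if u ≤ t then (if u ≤ s then deriv z u else h u) else deriv z u with hH
  have hXΩ : X ∈ pathSpace (-T) 0 A A₀ := by
    refine ⟨hG.isH1Path hT', ?_, ?_⟩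
    · simp only [hX, hs.trans hst.le, hs, if_true]; exact hzA
    · rcases ht.eq_or_lt with e | e
      · simp only [hX, e, le_rfl, if_true, not_le.2 (e ▸ hst), if_false]
        rw [← e, hxt, e]; exact hzA₀
      · simp only [hX, not_le.2 e, if_false]; exact hzA₀
  set Lz := lagrangian μ m (fun _ => 0) q z (deriv z) with hLz
  set Lx := lagrangian μ m (fun _ => 0) q x h with hLx
  set LX := lagrangian μ m (fun _ => 0) q X H with hLX
  have hsub : Icc s t ⊆ Icc (-T) 0 := Icc_subset_Icc hs ht
  have e1 : ∀ u, u ≤ s → LX u = Lz u := fun u hu => by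
    simp only [hLX, hLz, lagrangian, hX, hH, hu, hu.trans hst.le, if_true]
  have e2 : ∀ u ∈ Ioc s t, LX u = Lx u := fun u hu => by
    simp only [hLX, hLx, lagrangian, hX, hH, hu.2, if_true, not_le.2 hu.1, if_false]
  have e3 : ∀ u, t < u → LX u = Lz u := fun u hu => by
    simp only [hLX, hLz, lagrangian, hX, hH, not_le.2 hu, if_false]
  have hLxi : IntegrableOn Lx (Icc s t) :=
    hx.integrableOn_lagrangian continuousOn_const (hqc.mono hsub) hxn
  have i1 : IntegrableOn LX (Icc (-T) s) :=
    (hi.mono_set (Icc_subset_Icc_right (hst.le.trans ht))).congr_fun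
      (fun u hu => (e1 u hu.2).symm) measurableSet_Icc
  have i2 : IntegrableOn LX (Ioc s t) :=
    (hLxi.mono_set Ioc_subset_Icc_self).congr_fun (fun u hu => (e2 u hu).symm) measurableSet_Ioc
  have i3 : IntegrableOn LX (Ioc t 0) :=
    (hi.mono_set (Ioc_subset_Icc_self.trans (Icc_subset_Icc_left (hs.trans hst.le)))).congr_fun
      (fun u hu => (e3 u hu.1).symm) measurableSet_Ioc
  have hXi : IntegrableOn LX (Icc (-T) 0) := by
    rw [← Icc_union_Ioc_eq_Icc (hs.trans hst.le) ht, ← Icc_union_Ioc_eq_Icc hs hst.le]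
    exact (i1.union i2).union i3
  have hXn : ∀ᵐ u ∂(volume.restrict (Icc (-T) 0)), X u ≠ 0 ∧ X u ≠ q u := by
    filter_upwards [hn] with u hu
    simp only [hX]
    split_ifs with h1 h2
    · exact hu
    · exact hxn u ⟨(not_le.1 h2).le, h1⟩
    · exact hu
  have hle := hmin hXΩ
  simp only [mem_ofPred_eq] at hle
  rw [action_eq_ofReal hμ hm hT' hzL hi hn, action_eq_ofReal hμ hm hT' hG hXi hXn,
    ENNReal.ofReal_le_ofReal_iff (intervalIntegral.integral_nonneg hT' fun u _ => by
      simp only [lagrangian]; positivity)] at hle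
  have hii : ∀ {f : ℝ → ℝ} {u v : ℝ}, IntegrableOn f (Icc (-T) 0) → -T ≤ u → u ≤ v → v ≤ 0 →
      IntervalIntegrable f volume u v := fun hf h1 h2 h3 =>
    (hf.mono_set (by rw [uIcc_of_le h2]; exact Icc_subset_Icc h1 h3)).intervalIntegrable
  have hst0 := hst.le.trans ht
  have hsplit : ∀ {f : ℝ → ℝ}, IntegrableOn f (Icc (-T) 0) → ∫ u in (-T)..0, f u =
      (∫ u in (-T)..s, f u) + (∫ u in s..t, f u) + ∫ u in t..0, f u := fun hf => by
    rw [intervalIntegral.integral_add_adjacent_intervals (hii hf le_rfl hs hst0)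
      (hii hf hs hst.le ht), intervalIntegral.integral_add_adjacent_intervals
      (hii hf le_rfl (hs.trans hst.le) ht) (hii hf (hs.trans hst.le) ht le_rfl)]
  rw [hsplit hi, hsplit hXi] at hle
  have c1 : ∫ u in (-T)..s, LX u = ∫ u in (-T)..s, Lz u :=
    intervalIntegral.integral_congr fun u hu => by
      rw [uIcc_of_le hs] at hu; exact e1 u hu.2
  have c2 : ∫ u in s..t, LX u = ∫ u in s..t, Lx u :=
    intervalIntegral.integral_congr_ae (Eventually.of_forall fun u hu => by
      rw [uIoc_of_le hst.le] at hu; exact e2 u hu)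
  have c3 : ∫ u in t..0, LX u = ∫ u in t..0, Lz u :=
    intervalIntegral.integral_congr_ae (Eventually.of_forall fun u hu => by
      rw [uIoc_of_le ht] at hu; exact e3 u hu.1)
  rw [c1, c2, c3] at hle
  linarith

theorem isSmoothCenter_zero (a b : ℝ) :
    IsSmoothCenter (fun _ => 0) (fun _ => 0) (fun _ => 0) a b :=
  ⟨continuousOn_const, fun t _ => hasDerivAt_const t 0, fun t _ => hasDerivAt_const t 0,
    continuousOn_const⟩

theorem IsCollisionKepler.exists_isSmoothCenter {μ T : ℝ} {q : ℝ → ℂ} (hT : 0 < T)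
    (hq : IsCollisionKepler μ T q) :
    ∃ v : ℝ → ℂ, IsSmoothCenter q v (fun t => -(μ / ‖q t‖ ^ 3) • q t) (-T) 0 := by
  obtain ⟨v, hv⟩ := hq.newton
  have hsub : Ioo (-T) 0 ⊆ Icc (-T) T := fun t ht => ⟨ht.1.le, by linarith [ht.2]⟩
  have hnb : ∀ t ∈ Ioo (-T) 0, Icc (-T) T ∈ 𝓝 t := fun t ht =>
    Icc_mem_nhds ht.1 (by linarith [ht.2])
  have hqc : ContinuousOn q (Ioo (-T) 0) := hq.continuousOn.mono hsub
  refine ⟨v, hq.continuousOn.mono (Icc_subset_Icc_right hT.le),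
    fun t ht => (hv t (hsub ht) ht.2.ne).1.hasDerivAt (hnb t ht),
    fun t ht => (hv t (hsub ht) ht.2.ne).2.hasDerivAt (hnb t ht), ?_⟩
  refine ContinuousOn.smul (ContinuousOn.neg (continuousOn_const.div (hqc.norm.pow 3)
    fun t ht => ?_)) hqc
  exact pow_ne_zero 3 (norm_ne_zero_iff.2 (hq.no_other_collision t (hsub ht) ht.2.ne))

/-! ### Rates near the collision -/

/-- Asymptotic estimates for a solution of the radial Kepler problem falling into the centre. -/
theorem radial_kepler {μ a : ℝ} (hμ : 0 < μ) (ha : a < 0) {ρ ρ' : ℝ → ℝ}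
    (hc : ContinuousOn ρ (Icc a 0)) (h0 : ρ 0 = 0) (hpos : ∀ t ∈ Ioo a 0, 0 < ρ t)
    (hd : ∀ t ∈ Ioo a 0, HasDerivAt ρ (ρ' t) t)
    (hd' : ∀ t ∈ Ioo a 0, HasDerivAt ρ' (-(μ / ρ t ^ 2)) t) :
    ∃ t₁ ∈ Ioo a 0, ∀ t ∈ Ico t₁ 0, ρ' t < 0 ∧ μ / ρ t ≤ ρ' t ^ 2 ∧ ρ' t ^ 2 ≤ 3 * (μ / ρ t) := by
  set e : ℝ → ℝ := fun t => ρ' t ^ 2 / 2 - μ / ρ t with he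
  have hed : ∀ t ∈ Ioo a 0, HasDerivAt e 0 t := fun t ht => by
    have hp := hpos t ht
    have := (((hd' t ht).pow 2).div_const 2).sub ((hasDerivAt_const t μ).div (hd t ht) hp.ne')
    refine this.congr_deriv ?_
    field_simp
    push_cast
    ring
  have hmid : a / 2 ∈ Ioo a 0 := ⟨by linarith, by linarith⟩
  have hconst : ∀ t ∈ Ioo a 0, e t = e (a / 2) := fun t ht =>
    isOpen_Ioo.is_const_of_deriv_eq_zero (isPreconnected_Ioo)
      (fun t ht => (hed t ht).differentiableAt.differentiableWithinAt)
      (fun t ht => (hed t ht).deriv) ht hmid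
  set c := e (a / 2) with hcdef
  -- Close to the collision the constant energy c is at most half of μ/ρ, so ρ'² = 2μ/ρ + 2c lies
  -- between μ/ρ and 3μ/ρ.
  have hev : ∀ᶠ t in 𝓝[Icc a 0] 0, |c| * ρ t < μ / 2 := by
    have h1 : ContinuousWithinAt (fun t => |c| * ρ t) (Icc a 0) 0 :=
      continuousWithinAt_const.mul (hc 0 ⟨ha.le, le_rfl⟩)
    refine h1.eventually_lt_const ?_
    simp only [h0]; linarith
  rw [eventually_nhdsWithin_iff] at hev
  obtain ⟨δ, hδ, hball⟩ := Metric.eventually_nhds_iff.1 hev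
  set s := max (a / 2) (-(δ / 2)) with hs
  have hs0 : s < 0 := max_lt (by linarith) (by linarith)
  have hsa : a < s := lt_of_lt_of_le (by linarith) (le_max_left _ _)
  have hsδ : -(δ / 2) ≤ s := le_max_right _ _
  -- The mean value theorem gives one time with negative velocity; ρ'' < 0 keeps it negative
  -- afterwards.
  obtain ⟨ξ, hξ, hξs⟩ := exists_hasDerivAt_eq_slope ρ ρ' hs0
    (hc.mono (Icc_subset_Icc_left hsa.le)) (fun t ht => hd t ⟨hsa.trans ht.1, ht.2⟩)
  have hξneg : ρ' ξ < 0 := by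
    rw [hξs, h0]
    exact div_neg_of_neg_of_pos (by linarith [hpos s ⟨hsa, hs0⟩]) (by linarith)
  refine ⟨ξ, ⟨hsa.trans hξ.1, hξ.2⟩, fun t ht => ?_⟩
  have htI : t ∈ Ioo a 0 := ⟨(hsa.trans hξ.1).trans_le ht.1, ht.2⟩
  have hp := hpos t htI
  have hsmall : |c| * ρ t < μ / 2 := hball (by
    rw [Real.dist_eq, sub_zero, abs_lt]; constructor <;> linarith [ht.1, hξ.1, ht.2])
    ⟨htI.1.le, htI.2.le⟩
  have hE : ρ' t ^ 2 = 2 * (μ / ρ t) + 2 * c := by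
    have := hconst t htI
    simp only [he] at this
    linarith
  have hcb : |c| ≤ μ / ρ t / 2 := by
    rw [div_div, le_div_iff₀ (by positivity)]; linarith
  refine ⟨?_, by linarith [neg_abs_le c], by linarith [le_abs_self c]⟩
  rcases ht.1.eq_or_lt with h | h
  · rwa [← h]
  · obtain ⟨η, hη, hηs⟩ := exists_hasDerivAt_eq_slope ρ' (fun t => -(μ / ρ t ^ 2)) h
      (fun u hu => (hd' u ⟨(hsa.trans hξ.1).trans_le hu.1, hu.2.trans_lt ht.2⟩).continuousAt.continuousWithinAt)
      (fun u hu => hd' u ⟨(hsa.trans hξ.1).trans hu.1, hu.2.trans ht.2⟩)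
    have hp2 := hpos η ⟨(hsa.trans hξ.1).trans hη.1, hη.2.trans ht.2⟩
    have h1 : (ρ' t - ρ' ξ) / (t - ξ) < 0 := by
      rw [← hηs]; have : 0 < μ / ρ η ^ 2 := by positivity
      linarith
    have h2 : 0 < t - ξ := by linarith
    have h3 : ρ' t - ρ' ξ < 0 := by
      by_contra hcon
      exact absurd h1 (not_lt.2 (div_nonneg (not_lt.1 hcon) h2.le))
    linarith

theorem sub_le_of_hasDerivAt_le {f f' : ℝ → ℝ} {s t : ℝ} (hst : s ≤ t)
    (hc : ContinuousOn f (Icc s t)) (hd : ∀ u ∈ Ioo s t, HasDerivAt f (f' u) u) {B : ℝ}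
    (hB : ∀ u ∈ Ioo s t, f' u ≤ B) : f t - f s ≤ B * (t - s) := by
  rcases hst.eq_or_lt with rfl | h
  · simp
  · obtain ⟨ξ, hξ, e⟩ := exists_hasDerivAt_eq_slope f f' h hc hd
    have := hB ξ hξ
    rwa [e, div_le_iff₀ (by linarith)] at this

/-- A path whose radius is bounded by a multiple of `ρ` at every time at which its speed is
controlled. -/
theorem exists_le_mul_of_speed_bound {μ C a : ℝ} (hμ : 0 < μ) {r r' ρ ρ' : ℝ → ℝ}
    (hrc : ContinuousOn r (Icc a 0)) (hρc : ContinuousOn ρ (Icc a 0)) (hr0 : r 0 = 0)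
    (hρ0 : ρ 0 = 0) (hr : ∀ t ∈ Ico a 0, 0 < r t) (hρ : ∀ t ∈ Ico a 0, 0 < ρ t)
    (hrd : ∀ t ∈ Ioo a 0, HasDerivAt r (r' t) t) (hρd : ∀ t ∈ Ioo a 0, HasDerivAt ρ (ρ' t) t)
    (hneg : ∀ t ∈ Ioo a 0, ρ' t < 0) (hρ' : ∀ t ∈ Ioo a 0, μ / ρ t ≤ ρ' t ^ 2)
    (hr' : ∀ t ∈ Ioo a 0, r' t ^ 2 ≤ C * (1 / ρ t + 1 / r t)) :
    ∃ K, 1 ≤ K ∧ ∀ t ∈ Ico a 0, r t ≤ K * ρ t := by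
  -- Chosen so that K²μ > 2|C|. While r > Kρ, the speed of r is then below K|ρ'|, so Kρ - r
  -- decreases and cannot rise to 0 at the collision.
  set K := 1 + 2 * |C| / μ with hK
  have hK1 : 1 ≤ K := by
    have : 0 ≤ 2 * |C| / μ := by positivity
    linarith
  have hKC : 2 * |C| < K ^ 2 * μ := by
    have h1 : K * μ = μ + 2 * |C| := by rw [hK]; field_simp
    nlinarith [abs_nonneg C]
  refine ⟨K, hK1, fun t ht => ?_⟩
  by_contra hcon
  push Not at hcon
  obtain ⟨s, hs, hfs, hlt⟩ := exists_first_ge (f := fun u => K * ρ u - r u) (ε := 0) ht.2.le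
    ((continuousOn_const.mul hρc).sub hrc |>.mono (Icc_subset_Icc_left ht.1)) (by linarith)
    (by simp [hr0, hρ0])
  have hsub : ∀ u ∈ Ioo t s, u ∈ Ioo a 0 := fun u hu =>
    ⟨ht.1.trans_lt hu.1, hu.2.trans_le hs.2⟩
  obtain ⟨ξ, hξ, he⟩ := exists_hasDerivAt_eq_slope (fun u => K * ρ u - r u)
    (fun u => K * ρ' u - r' u) hs.1
    ((continuousOn_const.mul hρc).sub hrc |>.mono (Icc_subset_Icc ht.1 hs.2))
    (fun u hu => ((hρd u (hsub u hu)).const_mul K).sub (hrd u (hsub u hu)))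
  have hξI := hsub ξ hξ
  have hpos : 0 < (K * ρ s - r s - (K * ρ t - r t)) / (s - t) := by
    apply div_pos _ (by linarith [hs.1])
    linarith
  rw [← he] at hpos
  have hlt' := hlt ξ ⟨hξ.1.le, hξ.2⟩
  have hρξ := hρ ξ ⟨hξI.1.le, hξI.2⟩
  have hrξ := hr ξ ⟨hξI.1.le, hξI.2⟩
  have h1 : r' ξ ^ 2 ≤ 2 * |C| / ρ ξ := by
    have h2 : 1 / r ξ ≤ 1 / ρ ξ := one_div_le_one_div_of_le hρξ (by nlinarith)
    have h3 := hr' ξ hξI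
    have h4 : C * (1 / ρ ξ + 1 / r ξ) ≤ |C| * (1 / ρ ξ + 1 / ρ ξ) :=
      mul_le_mul (le_abs_self C) (by linarith) (by positivity) (abs_nonneg C)
    calc r' ξ ^ 2 ≤ |C| * (1 / ρ ξ + 1 / ρ ξ) := h3.trans h4
      _ = 2 * |C| / ρ ξ := by ring
  have h5 : 2 * |C| / ρ ξ < K ^ 2 * (μ / ρ ξ) := by
    rw [mul_div_assoc']; gcongr
  have h6 : K ^ 2 * (μ / ρ ξ) ≤ K ^ 2 * ρ' ξ ^ 2 := by
    gcongr; exact hρ' ξ hξI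
  have h7 : K * ρ' ξ < 0 := mul_neg_of_pos_of_neg (by linarith) (hneg ξ hξI)
  nlinarith

/-- An angle driven by an angular momentum `g` which decays at the self-similar rate cannot stay
bounded below. -/
theorem angle_not_bounded {a A B c : ℝ} (ha : a < 0) (hA : 0 < A) (hB : 0 < B) (hc : 0 < c)
    {r ρ θ g g' : ℝ → ℝ} (hr : ∀ t ∈ Ico a 0, 0 < r t) (hρ : ∀ t ∈ Ico a 0, 0 < ρ t)
    (hg : ∀ t ∈ Ico a 0, 0 < g t) (hθ : ∀ t ∈ Ico a 0, 0 ≤ θ t)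
    (hθd : ∀ t ∈ Ico a 0, HasDerivAt θ (-(g t / r t ^ 2)) t)
    (hgd : ∀ t ∈ Ico a 0, HasDerivAt g (g' t) t)
    (hg' : ∀ t ∈ Ico a 0, g' t ≤ -(c * (r t / ρ t ^ 2)))
    (hgB : ∀ t ∈ Ico a 0, g t ≤ B * √(ρ t))
    (hanti : ∀ s ∈ Ico a 0, ∀ t ∈ Ico a 0, s ≤ t → ρ t ≤ ρ s)
    (htime : ∀ t ∈ Ico a 0, ρ t * √(ρ t) ≤ A * (-t)) : False := by
  set k := 2 * A * (2 * √B / c + 1) with hk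
  have hk0 : 0 < k := by positivity
  -- The drop over [s, s/2] does not depend on s; iterating along a/2^n exhausts θ.
  have step : ∀ s ∈ Ico a 0, 1 / k ^ 3 ≤ θ s - θ (s / 2) := by
    intro s hs
    have hsub : ∀ u ∈ Icc s (s / 2), u ∈ Ico a 0 := fun u hu =>
      ⟨hs.1.trans hu.1, by linarith [hu.2, hs.2]⟩
    have hρs := hρ s hs
    set p := √(√(ρ s)) with hp
    have hp0 : 0 < p := Real.sqrt_pos.2 (Real.sqrt_pos.2 hρs)
    have hp2 : p ^ 2 = √(ρ s) := Real.sq_sqrt (Real.sqrt_nonneg _)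
    have hp4 : p ^ 4 = ρ s := by
      rw [show p ^ 4 = (p ^ 2) ^ 2 by ring, hp2, Real.sq_sqrt hρs.le]
    -- Here p = ρ(s)^(1/4), and the weights make the terms homogeneous under Kepler scaling. Φ
    -- decreases, and the √g term uses up only part of the gain k(-s)/2, because p⁶ = ρ(s)^(3/2) ≤
    -- A(-s). The rest, at least p⁶, must be paid by θ.
    set Φ : ℝ → ℝ := fun u => k ^ 3 * p ^ 6 * θ u + 2 / c * p ^ 5 * √(g u) + k * u with hΦ
    have hΦd : ∀ u ∈ Icc s (s / 2), HasDerivAt Φ (k ^ 3 * p ^ 6 * (-(g u / r u ^ 2)) +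
        2 / c * p ^ 5 * (g' u / (2 * √(g u))) + k * 1) u := fun u hu =>
      (((hθd u (hsub u hu)).const_mul _).add
        (((hgd u (hsub u hu)).sqrt (hg u (hsub u hu)).ne').const_mul _)).add
        ((hasDerivAt_id u).const_mul k)
    have hle := sub_le_of_hasDerivAt_le (f := Φ) (s := s) (t := s / 2) (B := 0)
      (by linarith [hs.2]) (fun u hu => (hΦd u hu).continuousAt.continuousWithinAt)
      (fun u hu => hΦd u (Ioo_subset_Icc_self hu)) (fun u hu => by
        have huI := hsub u (Ioo_subset_Icc_self hu)
        have hru := hr u huI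
        have hρu := hρ u huI
        have hgu := hg u huI
        have hsg : 0 < √(g u) := Real.sqrt_pos.2 hgu
        have hsg2 : √(g u) ^ 2 = g u := Real.sq_sqrt hgu.le
        set x := p ^ 6 * (g u / r u ^ 2) with hx
        set y := p ^ 5 * (r u / (ρ u ^ 2 * √(g u))) with hy
        have hy0 : 0 < y := by positivity
        have hx0 : 0 < x := by positivity
        have h1 : 2 / c * p ^ 5 * (g' u / (2 * √(g u))) ≤ -y := by
          have h2 := hg' u huI
          have e : -y = 2 / c * p ^ 5 * (-(c * (r u / ρ u ^ 2)) / (2 * √(g u))) := by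
            rw [hy]; field_simp
          rw [e]
          gcongr
        -- Both r and g cancel in x y² = (ρ(s)/ρ(u))⁴, so no lower bound on the radius is needed:
        -- either y ≥ k or x ≥ 1/k².
        have h3 : 1 ≤ x * y ^ 2 := by
          have e : x * y ^ 2 = (p ^ 4) ^ 4 / ρ u ^ 4 := by
            rw [hx, hy]
            rw [← hsg2]
            field_simp
            rw [Real.sqrt_sq hsg.le]
          rw [e, hp4, le_div_iff₀ (by positivity), one_mul]
          have := hanti s hs u huI hu.1.le
          gcongr
        have h4 : k ≤ k ^ 3 * x + y := by
          rcases le_or_gt k y with h | h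
          · nlinarith [mul_pos (pow_pos hk0 3) hx0]
          · have h5 : x * y ^ 2 ≤ x * k ^ 2 := by gcongr
            have h6 : k * 1 ≤ k * (x * k ^ 2) := by gcongr; linarith
            nlinarith
        have e1 : k ^ 3 * p ^ 6 * (-(g u / r u ^ 2)) = -(k ^ 3 * x) := by rw [hx]; ring
        rw [e1]
        linarith)
    rw [zero_mul] at hle
    simp only [hΦ] at hle
    have hs2 : s / 2 ∈ Ico a 0 := hsub _ ⟨by linarith [hs.2], le_rfl⟩
    have hg2 : 0 ≤ 2 / c * p ^ 5 * √(g (s / 2)) := by positivity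
    have hgs : √(g s) ≤ √B * p := by
      refine Real.sqrt_le_iff.2 ⟨by positivity, ?_⟩
      rw [mul_pow, Real.sq_sqrt hB.le, hp2]
      exact hgB s hs
    have hgs2 : 2 / c * p ^ 5 * √(g s) ≤ 2 * √B / c * p ^ 6 := by
      calc 2 / c * p ^ 5 * √(g s) ≤ 2 / c * p ^ 5 * (√B * p) := by gcongr
        _ = 2 * √B / c * p ^ 6 := by ring
    have ht := htime s hs
    rw [← hp2, ← hp4] at ht
    have hkA : k * (-s) / 2 = (2 * √B / c + 1) * (A * (-s)) := by rw [hk]; ring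
    have h5 : (2 * √B / c + 1) * p ^ 6 ≤ (2 * √B / c + 1) * (A * (-s)) := by
      apply mul_le_mul_of_nonneg_left _ (by positivity)
      linarith
    have h7 : p ^ 6 ≤ k ^ 3 * p ^ 6 * (θ s - θ (s / 2)) := by linarith
    have h8 : p ^ 6 * 1 ≤ p ^ 6 * (k ^ 3 * (θ s - θ (s / 2))) := by linarith
    have h9 := le_of_mul_le_mul_left h8 (by positivity)
    rw [div_le_iff₀ (by positivity)]
    linarith
  have hmem : ∀ n : ℕ, a / 2 ^ n ∈ Ico a 0 := fun n => by
    have h2 : (1 : ℝ) ≤ 2 ^ n := one_le_pow₀ (by norm_num)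
    refine ⟨?_, div_neg_of_neg_of_pos ha (by positivity)⟩
    rw [le_div_iff₀ (by positivity)]
    nlinarith
  have iter : ∀ n : ℕ, n * (1 / k ^ 3) ≤ θ a - θ (a / 2 ^ n) := by
    intro n
    induction n with
    | zero => simp
    | succ n ih =>
      have h1 := step _ (hmem n)
      have e : a / 2 ^ (n + 1) = a / 2 ^ n / 2 := by rw [pow_succ, div_div]
      rw [e]
      push_cast
      linarith
  obtain ⟨n, hn⟩ := exists_nat_gt (θ a / (1 / k ^ 3))
  rw [div_lt_iff₀ (by positivity)] at hn
  linarith [iter n, hθ _ (hmem n)]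

/-- The product of distance and speed of a path of finite energy is not bounded below near a
time at which the path reaches the origin. -/
theorem HasL2Deriv.not_le_norm_mul_norm {z V : ℝ → ℂ} {a c : ℝ} (hz : HasL2Deriv z V a 0)
    (ha : a < 0) (h0 : z 0 = 0) (hc : 0 < c) : ¬ ∀ t ∈ Ioo a 0, c ≤ ‖z t‖ * ‖V t‖ := by
  intro h
  have hsq : IntegrableOn (fun t => ‖V t‖ ^ 2) (Icc a 0) := hz.integrableOn_sq
  set M := ∫ u in a..0, ‖V u‖ ^ 2 / 2 with hM
  -- Finite kinetic energy gives |z|² = O(-t). With |z||V| ≥ c this would make 1/t integrable up to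
  -- 0.
  have hb : ∀ t ∈ Ioo a 0, ‖z t‖ ^ 2 ≤ M * (2 * (-t)) := fun t ht => by
    have h1 := (hz.mono ht.1.le le_rfl).sq_div_le ht.2
    rw [h0, zero_sub, norm_neg, div_le_iff₀ (by linarith [ht.2]), zero_sub] at h1
    have h2 : ∫ u in t..0, ‖V u‖ ^ 2 / 2 ≤ M := by
      rw [hM, intervalIntegral.integral_of_le ha.le, intervalIntegral.integral_of_le ht.2.le]
      refine setIntegral_mono_set (IntegrableOn.mono_set (hsq.div_const 2) Ioc_subset_Icc_self)
        (ae_of_all _ fun u => by positivity) (Ioc_subset_Ioc_left ht.1.le).eventuallyLE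
    have h3 : 0 ≤ 2 * (-t) := by linarith [ht.2]
    exact h1.trans (mul_le_mul_of_nonneg_right h2 h3)
  have hint : IntervalIntegrable (fun t : ℝ => t⁻¹) volume a 0 := by
    rw [intervalIntegrable_iff_integrableOn_Ioo_of_le ha.le]
    refine Integrable.mono' ((hsq.mono_set Ioo_subset_Icc_self).const_mul (2 * M / c ^ 2))
      measurable_inv.aestronglyMeasurable ?_
    refine (ae_restrict_iff' measurableSet_Ioo).2 (ae_of_all _ fun t ht => ?_)
    have ht0 : 0 < -t := by linarith [ht.2]
    rw [norm_inv, Real.norm_of_nonpos ht.2.le, inv_le_iff_one_le_mul₀ ht0,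
      div_mul_eq_mul_div, div_mul_eq_mul_div, le_div_iff₀ (by positivity), one_mul]
    calc c ^ 2 ≤ (‖z t‖ * ‖V t‖) ^ 2 := by gcongr; exact h t ht
      _ = ‖z t‖ ^ 2 * ‖V t‖ ^ 2 := by ring
      _ ≤ M * (2 * (-t)) * ‖V t‖ ^ 2 := by gcongr; exact hb t ht
      _ = 2 * M * ‖V t‖ ^ 2 * (-t) := by ring
  rw [intervalIntegrable_inv_iff] at hint
  rcases hint with h1 | h1
  · exact ha.ne h1
  · exact h1 right_mem_uIcc

/-! ### Collision orbits in the upper half plane -/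

/-- A particle in the upper half plane, attracted by a fixed centre `0` and by a centre `-ρ` which
falls into `0` on the real axis, and reaching the origin together with it. -/
structure IsUpperCollisionOrbit (μ m a : ℝ) (ρ ρ' : ℝ → ℝ) (z V : ℝ → ℂ) : Prop where
  continuousOn_center : ContinuousOn ρ (Icc a 0)
  center_zero : ρ 0 = 0
  center_pos : ∀ t ∈ Ioo a 0, 0 < ρ t
  hasDerivAt_center : ∀ t ∈ Ioo a 0, HasDerivAt ρ (ρ' t) t
  hasDerivAt_center_velocity : ∀ t ∈ Ioo a 0, HasDerivAt ρ' (-(μ / ρ t ^ 2)) t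
  hasL2Deriv : HasL2Deriv z V a 0
  zero : z 0 = 0
  im_pos : ∀ t ∈ Ioo a 0, 0 < (z t).im
  hasDerivAt : ∀ t ∈ Ioo a 0, HasDerivAt z (V t) t
  hasDerivAt_velocity : ∀ t ∈ Ioo a 0,
    HasDerivAt V (force μ m (fun _ => 0) (fun t => -(ρ t : ℂ)) z t) t

/-- The angular momentum about the origin. -/
def angularMomentum (z V : ℝ → ℂ) (t : ℝ) : ℝ := (z t).re * (V t).im - (z t).im * (V t).re

theorem abs_angularMomentum_le (z V : ℝ → ℂ) (t : ℝ) :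
    |angularMomentum z V t| ≤ ‖z t‖ * ‖V t‖ := by
  have e : angularMomentum z V t = (starRingEnd ℂ (z t) * V t).im := by
    simp [angularMomentum, Complex.mul_im]; ring
  rw [e]
  refine (Complex.abs_im_le_norm _).trans ?_
  rw [norm_mul, Complex.norm_conj]

namespace IsUpperCollisionOrbit

variable {μ m a : ℝ} {ρ ρ' : ℝ → ℝ} {z V : ℝ → ℂ}

theorem norm_pos (h : IsUpperCollisionOrbit μ m a ρ ρ' z V) {t : ℝ} (ht : t ∈ Ioo a 0) :
    0 < ‖z t‖ := by
  refine norm_pos_iff.2 fun h0 => ?_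
  have := h.im_pos t ht
  simp [h0] at this

theorem im_le (t : ℝ) : (z t).im ≤ ‖z t + (ρ t : ℂ)‖ := by
  have h1 := (le_abs_self _).trans (Complex.abs_im_le_norm (z t + (ρ t : ℂ)))
  simpa using h1

theorem dist_pos (h : IsUpperCollisionOrbit μ m a ρ ρ' z V) {t : ℝ} (ht : t ∈ Ioo a 0) :
    0 < ‖z t + (ρ t : ℂ)‖ := (h.im_pos t ht).trans_le (im_le t)

/-- The force of the centre at 0 is radial, so only the centre at -ρ contributes; its torque is
positive above the real axis. -/
theorem hasDerivAt_angularMomentum (h : IsUpperCollisionOrbit μ m a ρ ρ' z V) {t : ℝ}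
    (ht : t ∈ Ioo a 0) : HasDerivAt (angularMomentum z V)
      (m * (ρ t * (z t).im / ‖z t + (ρ t : ℂ)‖ ^ 3)) t := by
  have hz := h.hasDerivAt t ht
  have hV := h.hasDerivAt_velocity t ht
  have hzr : HasDerivAt (fun u => (z u).re) (V t).re t := Complex.reCLM.hasFDerivAt.comp_hasDerivAt t hz
  have hzi : HasDerivAt (fun u => (z u).im) (V t).im t := Complex.imCLM.hasFDerivAt.comp_hasDerivAt t hz
  have hVr : HasDerivAt (fun u => (V u).re) _ t := Complex.reCLM.hasFDerivAt.comp_hasDerivAt t hV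
  have hVi : HasDerivAt (fun u => (V u).im) _ t := Complex.imCLM.hasFDerivAt.comp_hasDerivAt t hV
  refine ((hzr.mul hVi).sub (hzi.mul hVr)).congr_deriv ?_
  simp only [force, sub_zero, sub_neg_eq_add, Complex.reCLM_apply, Complex.imCLM_apply,
    Complex.sub_re, Complex.sub_im, Complex.smul_re, Complex.smul_im, Complex.add_re,
    Complex.add_im, Complex.ofReal_re, Complex.ofReal_im, smul_eq_mul]
  ring

theorem angularMomentum_lt (h : IsUpperCollisionOrbit μ m a ρ ρ' z V) (hm : 0 < m) {s t : ℝ} (hs : a < s)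
    (hst : s < t) (ht : t < 0) : angularMomentum z V s < angularMomentum z V t := by
  have hsub : ∀ u ∈ Icc s t, u ∈ Ioo a 0 := fun u hu => ⟨hs.trans_le hu.1, hu.2.trans_lt ht⟩
  refine strictMonoOn_of_deriv_pos (convex_Icc s t) (fun u hu =>
    (h.hasDerivAt_angularMomentum (hsub u hu)).continuousAt.continuousWithinAt) (fun u hu => ?_)
    (left_mem_Icc.2 hst.le) (right_mem_Icc.2 hst.le) hst
  have hu' := hsub u (interior_subset hu)
  rw [(h.hasDerivAt_angularMomentum hu').deriv]
  have := h.im_pos u hu'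
  have := h.center_pos u hu'
  have := h.dist_pos hu'
  positivity

/-- Once nonnegative, an increasing angular momentum would soon exceed a positive constant for good,
and so would |z||V|, contradicting finite kinetic energy at the origin. -/
theorem angularMomentum_neg (h : IsUpperCollisionOrbit μ m a ρ ρ' z V) (hm : 0 < m) {t : ℝ}
    (ht : t ∈ Ioo a 0) : angularMomentum z V t < 0 := by
  by_contra hcon
  push Not at hcon
  have hm2 := h.angularMomentum_lt hm ht.1 (t := t / 2) (by linarith [ht.2]) (by linarith [ht.2])
  refine (h.hasL2Deriv.mono (s := t / 2) (by linarith [ht.1, ht.2]) le_rfl).not_le_norm_mul_norm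
    (by linarith [ht.2]) h.zero (hcon.trans_lt hm2) fun u hu => ?_
  exact (h.angularMomentum_lt hm (by linarith [ht.1, ht.2]) hu.1 hu.2).le.trans
    ((le_abs_self _).trans (abs_angularMomentum_le z V u))

theorem hasDerivAt_arg (h : IsUpperCollisionOrbit μ m a ρ ρ' z V) {t : ℝ} (ht : t ∈ Ioo a 0) :
    HasDerivAt (fun u => Complex.arg (z u)) (angularMomentum z V t / ‖z t‖ ^ 2) t := by
  have h1 := (h.hasDerivAt t ht).clog_real (Or.inr (h.im_pos t ht).ne')
  have h2 : HasDerivAt (fun u => (Complex.log (z u)).im) _ t :=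
    Complex.imCLM.hasFDerivAt.comp_hasDerivAt t h1
  simp only [Complex.log_im] at h2
  refine h2.congr_deriv ?_
  simp only [Complex.imCLM_apply, Complex.div_im, angularMomentum, ← Complex.normSq_eq_norm_sq]
  ring

theorem arg_strictAnti (h : IsUpperCollisionOrbit μ m a ρ ρ' z V) (hm : 0 < m) :
    StrictAntiOn (fun u => Complex.arg (z u)) (Ioo a 0) := by
  refine strictAntiOn_of_deriv_neg (convex_Ioo a 0)
    (fun u hu => (h.hasDerivAt_arg hu).continuousAt.continuousWithinAt) fun u hu => ?_
  have hu' := interior_subset hu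
  rw [(h.hasDerivAt_arg hu').deriv]
  exact div_neg_of_neg_of_pos (h.angularMomentum_neg hm hu') (by have := h.norm_pos hu'; positivity)

theorem arg_pos (h : IsUpperCollisionOrbit μ m a ρ ρ' z V) {t : ℝ} (ht : t ∈ Ioo a 0) :
    0 < Complex.arg (z t) := by
  have h1 := h.im_pos t ht
  refine lt_of_le_of_ne (Complex.arg_nonneg_iff.2 h1.le) fun h2 => ?_
  exact h1.ne' (Complex.arg_eq_zero_iff.1 h2.symm).2

theorem arg_lt_pi (h : IsUpperCollisionOrbit μ m a ρ ρ' z V) {t : ℝ} (ht : t ∈ Ioo a 0) :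
    Complex.arg (z t) < Real.pi := by
  have h1 := h.im_pos t ht
  refine lt_of_le_of_ne (Complex.arg_le_pi _) fun h2 => ?_
  exact h1.ne' (Complex.arg_eq_pi_iff.1 h2).2

/-- The energy of the particle changes only through the motion of the second centre. -/
theorem hasDerivAt_energy (h : IsUpperCollisionOrbit μ m a ρ ρ' z V) {t : ℝ} (ht : t ∈ Ioo a 0) :
    HasDerivAt (fun u => ‖V u‖ ^ 2 / 2 - μ / ‖z u‖ - m / ‖z u + (ρ u : ℂ)‖)
      (m * (ρ' t * ((z t).re + ρ t) / ‖z t + (ρ t : ℂ)‖ ^ 3)) t := by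
  have hr := h.norm_pos ht
  have hd := h.dist_pos ht
  have hz := hasDerivAt_norm_of_ne_zero (h.hasDerivAt t ht) (norm_pos_iff.1 hr)
  have hw := hasDerivAt_norm_of_ne_zero (w := fun u => z u + (ρ u : ℂ))
    ((h.hasDerivAt t ht).add (h.hasDerivAt_center t ht).ofReal_comp) (norm_pos_iff.1 hd)
  refine ((((h.hasDerivAt_velocity t ht).norm_sq.div_const 2).sub
    ((hasDerivAt_const t μ).div hz hr.ne')).sub
    ((hasDerivAt_const t m).div hw hd.ne')).congr_deriv ?_
  simp only [force, sub_zero, sub_neg_eq_add, inner_sub_right, inner_smul_right, inner_add_left,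
    inner_add_right, Complex.inner, Complex.mul_re, Complex.conj_re, Complex.conj_im,
    Complex.ofReal_re, Complex.ofReal_im]
  field_simp
  ring

/-- The derivative of ρ^(3/2) is (3/2)√ρ ρ', bounded by (3/2)√(3μ) in absolute value. -/
theorem center_mul_sqrt_le (h : IsUpperCollisionOrbit μ m a ρ ρ' z V) {b : ℝ} (hb : b ∈ Ioo a 0)
    (hρ' : ∀ t ∈ Ico b 0, ρ' t < 0 ∧ ρ' t ^ 2 ≤ 3 * (μ / ρ t)) {t : ℝ} (ht : t ∈ Ico b 0) :
    ρ t * √(ρ t) ≤ 3 / 2 * √(3 * μ) * (-t) := by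
  have hsub : ∀ u ∈ Ico b 0, u ∈ Ioo a 0 := fun u hu => ⟨hb.1.trans_le hu.1, hu.2⟩
  have hc := h.continuousOn_center.mono (Icc_subset_Icc_left (hsub t ht).1.le)
  have := sub_le_of_hasDerivAt_le (f := fun u => -(ρ u * √(ρ u)))
    (f' := fun u => -(3 / 2 * √(ρ u) * ρ' u)) (B := 3 / 2 * √(3 * μ)) ht.2.le
    (hc.mul hc.sqrt).neg (fun u hu => by
      have hu' := hsub u ⟨ht.1.trans hu.1.le, hu.2⟩
      exact ((hasDerivAt_mul_sqrt (h.center_pos u hu')).comp u (h.hasDerivAt_center u hu')).neg)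
    (fun u hu => by
      have huI : u ∈ Ico b 0 := ⟨ht.1.trans hu.1.le, hu.2⟩
      have hp := h.center_pos u (hsub u huI)
      have h1 : -(√(ρ u) * ρ' u) ≤ √(3 * μ) := by
        apply Real.le_sqrt_of_sq_le
        rw [neg_sq, mul_pow, Real.sq_sqrt hp.le]
        calc ρ u * ρ' u ^ 2 ≤ ρ u * (3 * (μ / ρ u)) := by gcongr; exact (hρ' u huI).2
          _ = 3 * μ := by field_simp
      linarith)
  simp only [h.center_zero, zero_mul, neg_zero, zero_sub, neg_neg] at this
  exact this

/-- An argument confined to a compact subset of (0, π) makes all distances comparable to their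
natural scales, and the resulting rates contradict `angle_not_bounded`. -/
theorem exists_arg_lt (h : IsUpperCollisionOrbit μ m a ρ ρ' z V) (hμ : 0 < μ) (hm : 0 < m)
    (ha : a < 0) {η : ℝ} (hη : 0 < η) : ∃ t ∈ Ioo a 0, Complex.arg (z t) < η := by
  by_contra hcon
  push Not at hcon
  obtain ⟨b, hb, hrad⟩ := radial_kepler hμ ha h.continuousOn_center h.center_zero h.center_pos
    h.hasDerivAt_center h.hasDerivAt_center_velocity
  have hsub : ∀ u ∈ Ico b 0, u ∈ Ioo a 0 := fun u hu => ⟨hb.1.trans_le hu.1, hu.2⟩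
  have hbI : b ∈ Ico b 0 := ⟨le_rfl, hb.2⟩
  obtain ⟨c, hc0, hc⟩ : ∃ c > 0, ∀ t ∈ Ico b 0, c * ‖z t‖ ≤ (z t).im := by
    have hηπ : η < Real.pi := (hcon b hb).trans_lt (h.arg_lt_pi hb)
    refine ⟨min (Real.sin η) (Real.sin (Complex.arg (z b))), lt_min
      (Real.sin_pos_of_pos_of_lt_pi hη hηπ)
      (Real.sin_pos_of_pos_of_lt_pi (h.arg_pos hb) (h.arg_lt_pi hb)), fun t ht => ?_⟩
    rw [← Complex.norm_mul_sin_arg, mul_comm]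
    gcongr
    refine strictConcaveOn_sin_Icc.concaveOn.min_le_of_mem_Icc ⟨hη.le, hηπ.le⟩
      ⟨(h.arg_pos hb).le, (h.arg_lt_pi hb).le⟩ ⟨hcon t (hsub t ht), ?_⟩
    exact (h.arg_strictAnti hm).antitoneOn hb (hsub t ht) ht.1
  have hr : ∀ t ∈ Ico b 0, 0 < ‖z t‖ := fun t ht => h.norm_pos (hsub t ht)
  have hρ : ∀ t ∈ Ico b 0, 0 < ρ t := fun t ht => h.center_pos t (hsub t ht)
  have hd : ∀ t ∈ Ico b 0, 0 < ‖z t + (ρ t : ℂ)‖ := fun t ht => h.dist_pos (hsub t ht)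
  -- Twice the area of the triangle 0, z, -ρ is ρ Im z, which is at most |z||z + ρ|.
  have hdρ : ∀ t ∈ Ico b 0, c * ρ t ≤ ‖z t + (ρ t : ℂ)‖ := fun t ht => by
    have h1 : ρ t * (z t).im ≤ ‖z t‖ * ‖z t + (ρ t : ℂ)‖ := by
      have e : ρ t * (z t).im = -(starRingEnd ℂ (z t) * (z t + (ρ t : ℂ))).im := by
        simp [Complex.mul_im]; ring
      rw [e]
      refine (neg_le_abs _).trans ((Complex.abs_im_le_norm _).trans ?_)
      rw [norm_mul, Complex.norm_conj]
    have h2 : ‖z t‖ * (c * ρ t) ≤ ‖z t‖ * ‖z t + (ρ t : ℂ)‖ := by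
      have := mul_le_mul_of_nonneg_left (hc t ht) (hρ t ht).le
      linarith
    exact le_of_mul_le_mul_left h2 (hr t ht)
  have hanti : ∀ s ∈ Ico b 0, ∀ t ∈ Ico b 0, s ≤ t → ρ t ≤ ρ s := fun s hs t ht hst => by
    have := sub_le_of_hasDerivAt_le (f := ρ) (f' := ρ') (B := 0) hst
      (h.continuousOn_center.mono (Icc_subset_Icc (hsub s hs).1.le ht.2.le))
      (fun u hu => h.hasDerivAt_center u ⟨(hsub s hs).1.trans hu.1, hu.2.trans ht.2⟩)
      (fun u hu => (hrad u ⟨hs.1.trans hu.1.le, hu.2.trans ht.2⟩).1.le)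
    linarith
  -- The energy supplied by the moving centre is at most the growth of k/ρ, so E - k/ρ is
  -- nonincreasing.
  obtain ⟨C, hC⟩ : ∃ C, ∀ t ∈ Ico b 0, ‖V t‖ ^ 2 ≤ C * (1 / ρ t + 1 / ‖z t‖) := by
    set E : ℝ → ℝ := fun u => ‖V u‖ ^ 2 / 2 - μ / ‖z u‖ - m / ‖z u + (ρ u : ℂ)‖ with hE
    set k := m / c ^ 2 with hk
    have hk0 : 0 < k := by positivity
    have hEb : ∀ t ∈ Ico b 0, E t - k / ρ t ≤ E b - k / ρ b := fun t ht => by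
      have hdd : ∀ u ∈ Icc b t, HasDerivAt (fun u => E u - k / ρ u) _ u := fun u hu =>
        (h.hasDerivAt_energy (hsub u ⟨hu.1, hu.2.trans_lt ht.2⟩)).sub
        ((hasDerivAt_const u k).div (h.hasDerivAt_center u (hsub u ⟨hu.1, hu.2.trans_lt ht.2⟩))
          (hρ u ⟨hu.1, hu.2.trans_lt ht.2⟩).ne')
      have := sub_le_of_hasDerivAt_le (B := 0) ht.1
        (fun u hu => (hdd u hu).continuousAt.continuousWithinAt)
        (fun u hu => hdd u (Ioo_subset_Icc_self hu)) (fun u hu => by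
          have huI : u ∈ Ico b 0 := ⟨hu.1.le, hu.2.trans ht.2⟩
          have hρu := hρ u huI
          have hdu := hd u huI
          have hv := (hrad u huI).1
          have h1 : ρ' u * ((z u).re + ρ u) / ‖z u + (ρ u : ℂ)‖ ^ 3 ≤ -ρ' u / (c * ρ u) ^ 2 := by
            have h2 : -‖z u + (ρ u : ℂ)‖ ≤ (z u).re + ρ u := by
              have := neg_le_of_abs_le (Complex.abs_re_le_norm (z u + (ρ u : ℂ)))
              simpa using this
            have h3 : ρ' u * ((z u).re + ρ u) ≤ ρ' u * -‖z u + (ρ u : ℂ)‖ :=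
              mul_le_mul_of_nonpos_left h2 hv.le
            calc _ ≤ ρ' u * -‖z u + (ρ u : ℂ)‖ / ‖z u + (ρ u : ℂ)‖ ^ 3 := by gcongr
              _ = -ρ' u / ‖z u + (ρ u : ℂ)‖ ^ 2 := by field_simp
              _ ≤ -ρ' u / (c * ρ u) ^ 2 := by
                gcongr
                · linarith
                · exact hdρ u huI
          have h4 := mul_le_mul_of_nonneg_left h1 hm.le
          have e : m * (-ρ' u / (c * ρ u) ^ 2) = -(k * ρ' u) / ρ u ^ 2 := by
            rw [hk]; field_simp
          rw [e] at h4
          simp only [zero_mul, zero_sub]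
          linarith)
      linarith
    refine ⟨2 * (|E b| * ρ b + k + m / c + μ), fun t ht => ?_⟩
    have hρt := hρ t ht
    have hrt := hr t ht
    have h1 := hEb t ht
    have h2 : E b ≤ |E b| * ρ b / ρ t := by
      rw [le_div_iff₀ hρt]
      calc E b * ρ t ≤ |E b| * ρ t := by gcongr; exact le_abs_self _
        _ ≤ |E b| * ρ b := by gcongr; exact hanti b hbI t ht ht.1
    have h3 : m / ‖z t + (ρ t : ℂ)‖ ≤ m / (c * ρ t) := by gcongr; exact hdρ t ht
    have h4 : 0 < k / ρ b := div_pos hk0 (hρ b hbI)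
    have h5 : ‖V t‖ ^ 2 / 2 = E t + μ / ‖z t‖ + m / ‖z t + (ρ t : ℂ)‖ := by rw [hE]; ring
    have h6 : ‖V t‖ ^ 2 / 2 ≤ (|E b| * ρ b + k + m / c) * (1 / ρ t) + μ * (1 / ‖z t‖) := by
      have e : (|E b| * ρ b + k + m / c) * (1 / ρ t) + μ * (1 / ‖z t‖) =
        |E b| * ρ b / ρ t + k / ρ t + m / (c * ρ t) + μ / ‖z t‖ := by field_simp
      rw [e]; linarith
    have h7 : 0 ≤ μ * (1 / ρ t) := by positivity
    have h8 : 0 ≤ (|E b| * ρ b + k + m / c) * (1 / ‖z t‖) := by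
      have := hρ b hbI
      positivity
    linarith
  have hIoo : ∀ u ∈ Ioo b 0, u ∈ Ico b 0 := fun u hu => ⟨hu.1.le, hu.2⟩
  obtain ⟨K, hK1, hK⟩ := exists_le_mul_of_speed_bound (C := C) (r := fun t => ‖z t‖)
    (r' := fun t => ⟪z t, V t⟫_ℝ / ‖z t‖) (ρ := ρ) (ρ' := ρ') hμ
    (h.hasL2Deriv.continuousOn.norm.mono (Icc_subset_Icc_left hb.1.le))
    (h.continuousOn_center.mono (Icc_subset_Icc_left hb.1.le)) (by simp [h.zero]) h.center_zero
    hr hρ (fun t ht => hasDerivAt_norm_of_ne_zero (h.hasDerivAt t (hsub t (hIoo t ht)))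
      (norm_pos_iff.1 (hr t (hIoo t ht))))
    (fun t ht => h.hasDerivAt_center t (hsub t (hIoo t ht)))
    (fun t ht => (hrad t (hIoo t ht)).1) (fun t ht => (hrad t (hIoo t ht)).2.1)
    (fun t ht => (sq_le_sq' (neg_le_of_abs_le (abs_inner_div_norm_le _ _))
      (le_of_abs_le (abs_inner_div_norm_le _ _))).trans (hC t (hIoo t ht)))
  refine angle_not_bounded (a := b) (A := 3 / 2 * √(3 * μ)) (B := √(|C| * (K ^ 2 + K)) + 1)
    (c := m * c / (K + 1) ^ 3) (r := fun t => ‖z t‖) (ρ := ρ)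
    (θ := fun t => Complex.arg (z t)) (g := fun t => -angularMomentum z V t)
    (g' := fun t => -(m * (ρ t * (z t).im / ‖z t + (ρ t : ℂ)‖ ^ 3))) hb.2 (by positivity)
    (by positivity) (by positivity) hr hρ
    (fun t ht => neg_pos.2 (h.angularMomentum_neg hm (hsub t ht)))
    (fun t ht => (h.arg_pos (hsub t ht)).le) (fun t ht => ?_)
    (fun t ht => (h.hasDerivAt_angularMomentum (hsub t ht)).neg) (fun t ht => ?_) (fun t ht => ?_)
    hanti (fun t ht => h.center_mul_sqrt_le hb (fun t ht => ⟨(hrad t ht).1, (hrad t ht).2.2⟩) ht)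
  · refine (h.hasDerivAt_arg (hsub t ht)).congr_deriv ?_
    rw [neg_div, neg_neg]
  · have hρt := hρ t ht
    have hrt := hr t ht
    have hdt := hd t ht
    have h1 : ‖z t + (ρ t : ℂ)‖ ≤ (K + 1) * ρ t := by
      refine (norm_add_le _ _).trans ?_
      rw [Complex.norm_real, Real.norm_of_nonneg hρt.le]
      linarith [hK t ht]
    have e : m * c / (K + 1) ^ 3 * (‖z t‖ / ρ t ^ 2) =
        m * (ρ t * (c * ‖z t‖) / ((K + 1) * ρ t) ^ 3) := by field_simp
    rw [e, neg_le_neg_iff]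
    gcongr
    · have := h.im_pos t (hsub t ht); positivity
    · exact hc t ht
  · have hρt := hρ t ht
    have hrt := hr t ht
    have h1 : (-angularMomentum z V t) ^ 2 ≤ |C| * (K ^ 2 + K) * ρ t := by
      rw [neg_sq]
      calc angularMomentum z V t ^ 2 ≤ (‖z t‖ * ‖V t‖) ^ 2 :=
            sq_le_sq' (neg_le_of_abs_le (abs_angularMomentum_le z V t))
              (le_of_abs_le (abs_angularMomentum_le z V t))
        _ = ‖z t‖ ^ 2 * ‖V t‖ ^ 2 := by ring
        _ ≤ ‖z t‖ ^ 2 * (|C| * (1 / ρ t + 1 / ‖z t‖)) := by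
          gcongr
          exact (hC t ht).trans (by gcongr; exact le_abs_self C)
        _ = |C| * (‖z t‖ ^ 2 / ρ t + ‖z t‖) := by field_simp
        _ ≤ |C| * ((K * ρ t) ^ 2 / ρ t + K * ρ t) := by gcongr <;> exact hK t ht
        _ = |C| * (K ^ 2 + K) * ρ t := by field_simp
    have h2 := Real.le_sqrt_of_sq_le h1
    rw [Real.sqrt_mul (by positivity)] at h2
    have h3 := Real.sqrt_nonneg (ρ t)
    linarith

theorem tendsto_arg (h : IsUpperCollisionOrbit μ m a ρ ρ' z V) (hμ : 0 < μ) (hm : 0 < m)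
    (ha : a < 0) : Tendsto (fun t => Complex.arg (z t)) (𝓝[<] 0) (𝓝 0) := by
  rw [tendsto_order]
  refine ⟨fun l hl => ?_, fun η hη => ?_⟩
  · filter_upwards [Ioo_mem_nhdsLT ha] with t ht using hl.trans (h.arg_pos ht)
  · obtain ⟨s, hs, hsη⟩ := h.exists_arg_lt hμ hm ha hη
    filter_upwards [Ioo_mem_nhdsLT hs.2] with t ht
    exact ((h.arg_strictAnti hm) hs ⟨hs.1.trans ht.1, ht.2⟩ ht.1).trans hsη

end IsUpperCollisionOrbit

/-! ### Reflection and the sign of the imaginary part -/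

/-- A solution of `y'' = -k y` with vanishing Cauchy data vanishes. -/
theorem eq_zero_of_linear_oscillator {y w k : ℝ → ℝ} {a b t₀ : ℝ} (hk : ContinuousOn k (Ioo a b))
    (hy : ∀ t ∈ Ioo a b, HasDerivAt y (w t) t) (hw : ∀ t ∈ Ioo a b, HasDerivAt w (-(k t * y t)) t)
    (ht₀ : t₀ ∈ Ioo a b) (hy0 : y t₀ = 0) (hw0 : w t₀ = 0) : ∀ t ∈ Ioo a b, y t = 0 := by
  intro t ht
  set s := (a + min t t₀) / 2 with hs
  set e := (b + max t t₀) / 2 with he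
  have h1 := lt_min ht.1 ht₀.1
  have h2 := max_lt ht.2 ht₀.2
  have hsub : Icc s e ⊆ Ioo a b := fun u hu => ⟨by linarith [hu.1], by linarith [hu.2]⟩
  have hmem : ∀ u, min t t₀ ≤ u → u ≤ max t t₀ → u ∈ Ioo s e := fun u hu hu' =>
    ⟨by linarith, by linarith⟩
  obtain ⟨C, hC⟩ := isCompact_Icc.exists_bound_of_continuousOn (hk.mono hsub)
  have hLip : ∀ u ∈ Ioo s e, LipschitzOnWith (Real.toNNReal (max 1 C))
      (fun p : ℝ × ℝ => (p.2, -(k u * p.1))) univ := fun u hu => by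
    rw [lipschitzOnWith_univ]
    refine LipschitzWith.of_dist_le_mul fun p p' => ?_
    rw [Real.coe_toNNReal _ (le_max_of_le_left zero_le_one), Prod.dist_eq, Prod.dist_eq]
    have hku : |k u| ≤ max 1 C := (hC u (Ioo_subset_Icc_self hu)).trans (le_max_right _ _)
    refine max_le ?_ ?_
    · calc dist p.2 p'.2 ≤ 1 * max (dist p.1 p'.1) (dist p.2 p'.2) := by
            rw [one_mul]; exact le_max_right _ _
        _ ≤ _ := by gcongr; exact le_max_left _ _
    · calc dist (-(k u * p.1)) (-(k u * p'.1)) = |k u| * dist p.1 p'.1 := by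
            rw [dist_neg_neg, Real.dist_eq, Real.dist_eq, ← mul_sub, abs_mul]
        _ ≤ _ := by gcongr; exact le_max_left _ _
  have huniq := ODE_solution_unique_of_mem_Ioo (f := fun u => (y u, w u)) (g := fun _ => (0, 0))
    (v := fun u p => (p.2, -(k u * p.1))) (s := fun _ => univ) hLip
    (hmem t₀ (min_le_right _ _) (le_max_right _ _))
    (fun u hu => ⟨(hy u (hsub (Ioo_subset_Icc_self hu))).prodMk
      (hw u (hsub (Ioo_subset_Icc_self hu))), mem_univ _⟩)
    (fun u hu => ⟨(hasDerivAt_const u ((0 : ℝ), (0 : ℝ))).congr_deriv (by simp; rfl), mem_univ _⟩)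
    (by simp [hy0, hw0])
  exact congrArg Prod.fst (huniq (hmem t (min_le_left _ _) (le_max_left _ _)))

namespace IsActionMinimizer

variable {μ m T : ℝ} {q z : ℝ → ℂ} {A A₀ : Set ℂ}

theorem hasL2Deriv (hT : 0 < T) (hz : IsActionMinimizer μ m q (-T) 0 A A₀ z) :
    HasL2Deriv z (deriv z) (-T) 0 := (isH1Path_iff (by linarith)).1 hz.1.1

/-- A path with the same ends, and with the same speed and the same distances to both centres as a
minimizer, is a minimizer. -/
theorem of_norm_eq (hT : 0 < T) (hz : IsActionMinimizer μ m q (-T) 0 A A₀ z) {x h : ℝ → ℂ}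
    (hx : HasL2Deriv x h (-T) 0) (hl : x (-T) = z (-T)) (hr : x 0 = z 0)
    (hh : ∀ t ∈ Icc (-T) 0, ‖h t‖ = ‖deriv z t‖) (hn : ∀ t ∈ Icc (-T) 0, ‖x t‖ = ‖z t‖)
    (hd : ∀ t ∈ Icc (-T) 0, ‖x t - q t‖ = ‖z t - q t‖) :
    IsActionMinimizer μ m q (-T) 0 A A₀ x := by
  have hT' : -T ≤ 0 := by linarith
  have he : action μ m q (-T) 0 x = action μ m q (-T) 0 z := by
    rw [action_eq_of_hasL2Deriv hT' hx, action_eq_of_hasL2Deriv hT' (hz.hasL2Deriv hT)]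
    refine setLIntegral_congr_fun measurableSet_Icc fun t ht => ?_
    simp only [potential]
    rw [enorm_eq_iff_norm_eq.2 (hh t ht), enorm_eq_iff_norm_eq.2 (hn t ht),
      enorm_eq_iff_norm_eq.2 (hd t ht)]
  refine ⟨⟨hx.isH1Path hT', by rw [hl]; exact hz.1.2.1, by rw [hr]; exact hz.1.2.2⟩,
    isMinOn_iff.2 fun y hy => ?_⟩
  rw [he]
  exact isMinOn_iff.1 hz.2 y hy

theorem norm_conj_sub {p w : ℂ} (hp : p.im = 0) : ‖starRingEnd ℂ w - p‖ = ‖w - p‖ := by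
  rw [← Complex.norm_conj (w - p), map_sub, Complex.conj_eq_iff_im.2 hp]

theorem conj (hT : 0 < T) (hz : IsActionMinimizer μ m q (-T) 0 A A₀ z)
    (hq : ∀ t ∈ Icc (-T) 0, (q t).im = 0) (hl : (z (-T)).im = 0) (hr : (z 0).im = 0) :
    IsActionMinimizer μ m q (-T) 0 A A₀ (fun t => starRingEnd ℂ (z t)) :=
  hz.of_norm_eq hT (hz.hasL2Deriv hT).conj (Complex.conj_eq_iff_im.2 hl)
    (Complex.conj_eq_iff_im.2 hr) (fun _ _ => Complex.norm_conj _) (fun _ _ => Complex.norm_conj _)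
    (fun t ht => norm_conj_sub (hq t ht))

theorem reflect (hT : 0 < T) (hz : IsActionMinimizer μ m q (-T) 0 A A₀ z)
    (hq : ∀ t ∈ Icc (-T) 0, (q t).im = 0) (hr : (z 0).im = 0) {a : ℝ} (ha : a ∈ Ioo (-T) 0)
    (hza : (z a).im = 0) :
    IsActionMinimizer μ m q (-T) 0 A A₀ (fun t => if t ≤ a then z t else starRingEnd ℂ (z t)) := by
  have hL := hz.hasL2Deriv hT
  refine hz.of_norm_eq hT ((hL.mono le_rfl ha.2.le).glue ha.1.le ha.2.le
    (hL.mono ha.1.le le_rfl).conj (Complex.conj_eq_iff_im.2 hza).symm) (if_pos ha.1.le)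
    ((if_neg (not_le.2 ha.2)).trans (Complex.conj_eq_iff_im.2 hr)) (fun t ht => ?_)
    (fun t ht => ?_) (fun t ht => ?_)
  · split_ifs
    · rfl
    · exact Complex.norm_conj _
  · split_ifs
    · rfl
    · exact Complex.norm_conj _
  · split_ifs
    · rfl
    · exact norm_conj_sub (hq t ht)

section Motion

variable (hμ : 0 < μ) (hm : 0 < m) (hT : 0 < T) (hq : IsCollisionKepler μ T q)
  (hA : A ⊆ {w : ℂ | 0 ≤ w.im}) (h0 : (0 : ℂ) ∈ A₀)
  (hz : IsActionMinimizer μ m q (-T) 0 A A₀ z)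

include hμ hm hT hq hA h0 hz

/-- A minimizer has no interior collision, and solves the equation of motion. -/
theorem equation_of_motion {t : ℝ} (ht : t ∈ Ioo (-T) 0) :
    z t ≠ 0 ∧ z t ≠ q t ∧ HasDerivAt z (deriv z t) t ∧
      HasDerivAt (deriv z) (force μ m (fun _ => 0) q z t) t := by
  have hsub : Icc (-T) 0 ⊆ Icc (-T) T := Icc_subset_Icc_right hT.le
  have hqc : ContinuousOn q (Icc (-T) 0) := hq.continuousOn.mono hsub
  have M := hz.isTwoCenterMinimizer hμ hm hT hqc
    (fun t ht => (hq.negative_real t (hsub ht)).1) hA h0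
  obtain ⟨v, hv⟩ := hq.exists_isSmoothCenter hT
  obtain ⟨h1, h2⟩ := M.ne_centers hμ hm (isSmoothCenter_zero _ _) hv (fun u hu =>
    (hq.no_other_collision u (hsub (Ioo_subset_Icc_self hu)) hu.2.ne).symm) t ht
  exact ⟨h1, h2, M.euler_lagrange hμ hm continuousOn_const hqc ht h1 h2⟩

/-- Reflecting after `a` yields another minimizer, which has no corner at `a`; so the velocity there
is real. Then Im z has vanishing Cauchy data for a linear equation. -/
theorem im_eq_zero_of_exists (hr : (z 0).im = 0) {a : ℝ} (ha : a ∈ Ioo (-T) 0)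
    (hza : (z a).im = 0) : ∀ t ∈ Ioo (-T) 0, (z t).im = 0 := by
  have hqr : ∀ t ∈ Icc (-T) 0, (q t).im = 0 := fun t ht =>
    (hq.negative_real t ⟨ht.1, ht.2.trans hT.le⟩).1
  have hzm := fun t ht => equation_of_motion hμ hm hT hq hA h0 hz (t := t) ht
  have hconj : starRingEnd ℂ (z a) = z a := Complex.conj_eq_iff_im.2 hza
  have hva : (deriv z a).im = 0 := by
    set x : ℝ → ℂ := fun t => if t ≤ a then z t else starRingEnd ℂ (z t) with hx
    have hxd := (equation_of_motion hμ hm hT hq hA h0 (hz.reflect hT hqr hr ha hza) ha).2.2.1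
    have hl : HasDerivWithinAt x (deriv z a) (Iic a) a :=
      (hzm a ha).2.2.1.hasDerivWithinAt.congr (fun u hu => if_pos hu) (if_pos le_rfl)
    have hrt : HasDerivWithinAt x (starRingEnd ℂ (deriv z a)) (Ici a) a := by
      have : HasDerivAt (fun t => starRingEnd ℂ (z t)) (starRingEnd ℂ (deriv z a)) a :=
        Complex.conjCLE.hasFDerivAt.comp_hasDerivAt a (hzm a ha).2.2.1
      refine this.hasDerivWithinAt.congr (fun u hu => ?_) ((if_pos le_rfl).trans hconj.symm)
      rcases (mem_Ici.1 hu).eq_or_lt with rfl | h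
      · exact (if_pos le_rfl).trans hconj.symm
      · exact if_neg (not_le.2 h)
    have e1 := (uniqueDiffOn_Iic a a self_mem_Iic).eq_deriv _ hxd.hasDerivWithinAt hl
    have e2 := (uniqueDiffOn_Ici a a self_mem_Ici).eq_deriv _ hxd.hasDerivWithinAt hrt
    exact Complex.conj_eq_iff_im.1 (e2.symm.trans e1)
  have hzc : ContinuousOn z (Ioo (-T) 0) := fun t ht =>
    (hzm t ht).2.2.1.continuousAt.continuousWithinAt
  have hqc : ContinuousOn q (Ioo (-T) 0) :=
    hq.continuousOn.mono fun t ht => ⟨ht.1.le, ht.2.le.trans hT.le⟩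
  refine eq_zero_of_linear_oscillator (w := fun t => (deriv z t).im)
    (k := fun t => μ / ‖z t‖ ^ 3 + m / ‖z t - q t‖ ^ 3) ?_ (fun t ht => ?_) (fun t ht => ?_) ha hza
    hva
  · refine (continuousOn_const.div (hzc.norm.pow 3) fun t ht => ?_).add
      (continuousOn_const.div ((hzc.sub hqc).norm.pow 3) fun t ht => ?_)
    · exact pow_ne_zero 3 (norm_ne_zero_iff.2 (hzm t ht).1)
    · exact pow_ne_zero 3 (norm_ne_zero_iff.2 (sub_ne_zero.2 (hzm t ht).2.1))
  · exact Complex.imCLM.hasFDerivAt.comp_hasDerivAt t (hzm t ht).2.2.1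
  · refine HasDerivAt.congr_deriv (Complex.imCLM.hasFDerivAt.comp_hasDerivAt t (hzm t ht).2.2.2) ?_
    simp only [force, sub_zero, Complex.imCLM_apply, Complex.sub_im, Complex.smul_im, smul_eq_mul,
      hqr t (Ioo_subset_Icc_self ht)]
    ring

theorem im_trichotomy (hr : (z 0).im = 0) :
    (∀ t ∈ Ioo (-T) 0, (z t).im = 0) ∨ (∀ t ∈ Ioo (-T) 0, 0 < (z t).im) ∨
      (∀ t ∈ Ioo (-T) 0, (z t).im < 0) := by
  by_cases hex : ∃ a ∈ Ioo (-T) 0, (z a).im = 0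
  · obtain ⟨a, ha, hza⟩ := hex
    exact Or.inl (im_eq_zero_of_exists hμ hm hT hq hA h0 hz hr ha hza)
  · push Not at hex
    have hc : ContinuousOn (fun t => (z t).im) (Ioo (-T) 0) :=
      (Complex.continuous_im.comp_continuousOn (hz.hasL2Deriv hT).continuousOn).mono
        Ioo_subset_Icc_self
    right
    by_contra hcon
    push Not at hcon
    obtain ⟨⟨s, hs, hs0⟩, t, ht, ht0⟩ := hcon
    obtain ⟨a, ha, hza⟩ := isPreconnected_Ioo.intermediate_value hs ht hc ⟨hs0, ht0⟩
    exact hex a ha hza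

theorem exists_isUpperCollisionOrbit (hz0 : z 0 = 0) (him : ∀ t ∈ Ioo (-T) 0, 0 < (z t).im) :
    ∃ ρ ρ' : ℝ → ℝ, IsUpperCollisionOrbit μ m (-T) ρ ρ' z (deriv z) := by
  have hsub : ∀ t ∈ Ioo (-T) 0, t ∈ Icc (-T) T := fun t ht => ⟨ht.1.le, ht.2.le.trans hT.le⟩
  have hzm := fun t ht => equation_of_motion hμ hm hT hq hA h0 hz (t := t) ht
  obtain ⟨v, hv⟩ := hq.exists_isSmoothCenter hT
  have hqρ : ∀ t ∈ Ioo (-T) 0, q t = -((-(q t).re : ℝ) : ℂ) := fun t ht =>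
    Complex.ext (by simp) (by simp [(hq.negative_real t (hsub t ht)).1])
  have hpos : ∀ t ∈ Ioo (-T) 0, 0 < -(q t).re := fun t ht => by
    refine neg_pos.2 (lt_of_le_of_ne (hq.negative_real t (hsub t ht)).2 fun h => ?_)
    exact hq.no_other_collision t (hsub t ht) ht.2.ne
      (Complex.ext h (hq.negative_real t (hsub t ht)).1)
  refine ⟨fun t => -(q t).re, fun t => -(v t).re,
    (Complex.continuous_re.comp_continuousOn hv.continuousOn).neg, by simp [hq.collision], hpos,
    fun t ht => (HasDerivAt.congr_deriv
      (Complex.reCLM.hasFDerivAt.comp_hasDerivAt t (hv.hasDerivAt t ht)) rfl).neg, fun t ht => ?_,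
    hz.hasL2Deriv hT, hz0, him, fun t ht => (hzm t ht).2.2.1, fun t ht => ?_⟩
  · have h1 : HasDerivAt (fun t => -(v t).re) _ t :=
      (Complex.reCLM.hasFDerivAt.comp_hasDerivAt t (hv.hasDerivAt_velocity t ht)).neg
    refine h1.congr_deriv ?_
    have hn : ‖q t‖ = -(q t).re := by
      conv_lhs => rw [hqρ t ht]
      rw [norm_neg, Complex.norm_real, Real.norm_of_nonneg (hpos t ht).le]
    have hp := hpos t ht
    have hne : (q t).re ≠ 0 := by linarith
    rw [Complex.reCLM_apply, Complex.smul_re, hn, smul_eq_mul]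
    field_simp
  · refine (hzm t ht).2.2.2.congr_deriv ?_
    simp only [force]
    rw [← hqρ t ht]

theorem tendsto_arg_of_im_pos (hz0 : z 0 = 0) (him : ∀ t ∈ Ioo (-T) 0, 0 < (z t).im) :
    Tendsto (fun t => Complex.arg (z t)) (𝓝[<] 0) (𝓝 0) := by
  obtain ⟨ρ, ρ', h⟩ := exists_isUpperCollisionOrbit hμ hm hT hq hA h0 hz hz0 him
  exact h.tendsto_arg hμ hm (by linarith)

end Motion

end IsActionMinimizer

/-! ### Conclusion -/

/-- A nonvanishing real path has constant argument `0` or `π`. -/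
theorem arg_eq_zero_or_pi_of_im_eq_zero {z : ℝ → ℂ} {s : Set ℝ} (hs : IsPreconnected s)
    (hc : ContinuousOn z s) (him : ∀ t ∈ s, (z t).im = 0) (hne : ∀ t ∈ s, z t ≠ 0) :
    (∀ t ∈ s, Complex.arg (z t) = 0) ∨ ∀ t ∈ s, Complex.arg (z t) = Real.pi := by
  have hre : ∀ t ∈ s, (z t).re ≠ 0 := fun t ht h => hne t ht (Complex.ext h (him t ht))
  by_contra hcon
  push Not at hcon
  obtain ⟨⟨t, ht, ht0⟩, u, hu, huπ⟩ := hcon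
  have ht' : (z t).re ≤ 0 := by
    by_contra h
    exact ht0 (Complex.arg_eq_zero_iff.2 ⟨(not_le.1 h).le, him t ht⟩)
  have hu' : 0 ≤ (z u).re := by
    by_contra h
    exact huπ (Complex.arg_eq_pi_iff.2 ⟨not_le.1 h, him u hu⟩)
  obtain ⟨a, ha, ha0⟩ := hs.intermediate_value ht hu (Complex.continuous_re.comp_continuousOn hc)
    ⟨ht', hu'⟩
  exact hre a ha ha0

end

theorem theorem3p2 (μ m T : ℝ) (hμ : 0 < μ) (hm : 0 < m) (hT : 0 < T)
    (q : ℝ → ℂ) (hq : IsCollisionKepler μ T q)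
    (A A₀ : Set ℂ) (hAc : IsClosed A) (hA₀c : IsClosed A₀) (hdisj : Disjoint A A₀)
    (hA : A ⊆ {w : ℂ | 0 ≤ w.im}) (hA₀ : A₀ ⊆ {w : ℂ | 0 ≤ w.im}) (h0 : (0 : ℂ) ∈ A₀)
    (z : ℝ → ℂ) (hz : IsActionMinimizer μ m q (-T) 0 A A₀ z) (hz0 : z 0 = 0) :
    (∀ t ∈ Ico (-T) 0, z t ≠ 0) ∧
    ContinuousOn (fun t => Complex.arg (z t)) (Ioo (-T) 0) ∧
    ∃ θ : ℝ, Tendsto (fun t => Complex.arg (z t)) (𝓝[<] 0) (𝓝 θ) ∧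
      (θ = 0 ∨ θ = Real.pi) ∧
      ((∀ t ∈ Ico (-T) 0, Complex.arg (z t) = Real.pi) → θ = Real.pi) ∧
      (¬ (∀ t ∈ Ico (-T) 0, Complex.arg (z t) = Real.pi) → θ = 0) := by
  have hT0 : -T < 0 := by linarith
  have hqr : ∀ t ∈ Icc (-T) 0, (q t).im = 0 := fun t ht =>
    (hq.negative_real t ⟨ht.1, ht.2.trans hT.le⟩).1
  have hzc : ContinuousOn z (Icc (-T) 0) := (hz.hasL2Deriv hT).continuousOn
  have hne : ∀ t ∈ Ico (-T) 0, z t ≠ 0 := fun t ht => by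
    rcases ht.1.eq_or_lt with rfl | h
    -- At the initial time the origin is excluded because it lies in A₀, which is disjoint from A.
    · exact fun h => hdisj.le_bot ⟨hz.1.2.1, h ▸ h0⟩
    · exact (hz.equation_of_motion hμ hm hT hq hA h0 ⟨h, ht.2⟩).1
  have hr : (z 0).im = 0 := by rw [hz0, Complex.zero_im]
  have hlim : Tendsto (fun t => (z t).im) (𝓝[>] (-T)) (𝓝 (z (-T)).im) := by
    have h1 : ContinuousWithinAt (fun t => (z t).im) (Icc (-T) 0) (-T) :=
      Complex.continuous_im.continuousAt.comp_continuousWithinAt (hzc _ ⟨le_rfl, hT0.le⟩)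
    exact h1.tendsto.mono_left (nhdsWithin_Ioo_eq_nhdsGT hT0 ▸ nhdsWithin_mono _ Ioo_subset_Icc_self)
  have hl0 : (∀ t ∈ Ioo (-T) 0, (z t).im ≤ 0) → (z (-T)).im = 0 := fun h => by
    refine le_antisymm (le_of_tendsto hlim ?_) (hA hz.1.2.1)
    filter_upwards [Ioo_mem_nhdsGT hT0] with t ht using h t ht
  have hslit : (∀ t ∈ Ioo (-T) 0, (z t).im ≠ 0) →
      ContinuousOn (fun t => Complex.arg (z t)) (Ioo (-T) 0) := fun h t ht =>
    (Complex.continuousAt_arg (Or.inr (h t ht))).comp_continuousWithinAt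
      ((hzc t (Ioo_subset_Icc_self ht)).mono Ioo_subset_Icc_self)
  obtain ⟨hcont, hcases⟩ : ContinuousOn (fun t => Complex.arg (z t)) (Ioo (-T) 0) ∧
      ((∀ t ∈ Ico (-T) 0, Complex.arg (z t) = Real.pi) ∨
        Tendsto (fun t => Complex.arg (z t)) (𝓝[<] 0) (𝓝 0)) := by
    rcases hz.im_trichotomy hμ hm hT hq hA h0 hr with h | h | h
    · have him : ∀ t ∈ Ico (-T) 0, (z t).im = 0 := fun t ht => by
        rcases ht.1.eq_or_lt with rfl | h'
        · exact hl0 fun t ht => (h t ht).le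
        · exact h t ⟨h', ht.2⟩
      rcases arg_eq_zero_or_pi_of_im_eq_zero isPreconnected_Ico
        (hzc.mono Ico_subset_Icc_self) him hne with h' | h'
      · refine ⟨continuousOn_const.congr fun t ht => h' t (Ioo_subset_Ico_self ht), Or.inr ?_⟩
        refine tendsto_const_nhds.congr' ?_
        filter_upwards [Ioo_mem_nhdsLT hT0] with t ht using (h' t (Ioo_subset_Ico_self ht)).symm
      · exact ⟨continuousOn_const.congr fun t ht => h' t (Ioo_subset_Ico_self ht), Or.inl h'⟩
    · exact ⟨hslit fun t ht => (h t ht).ne',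
        Or.inr (hz.tendsto_arg_of_im_pos hμ hm hT hq hA h0 hz0 h)⟩
    -- The minimizer is not assumed to stay above the axis. Below it, z(-T) is real by continuity
    -- and hA, so the conjugate path is an admissible minimizer in the upper half plane.
    · refine ⟨hslit fun t ht => (h t ht).ne, Or.inr ?_⟩
      have h1 := (hz.conj hT hqr (hl0 fun t ht => (h t ht).le) hr).tendsto_arg_of_im_pos hμ hm hT
        hq hA h0 (by simp [hz0]) (fun t ht => by simpa using h t ht)
      have h2 := h1.neg
      rw [neg_zero] at h2
      refine h2.congr' ?_
      filter_upwards [Ioo_mem_nhdsLT hT0] with t ht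
      have h3 := h t ht
      rw [Complex.arg_conj, if_neg fun h4 => h3.ne (Complex.arg_eq_pi_iff.1 h4).2, neg_neg]
  refine ⟨hne, hcont, ?_⟩
  by_cases hall : ∀ t ∈ Ico (-T) 0, Complex.arg (z t) = Real.pi
  · refine ⟨Real.pi, tendsto_const_nhds.congr' ?_, Or.inr rfl, fun _ => rfl, fun h => (h hall).elim⟩
    filter_upwards [Ioo_mem_nhdsLT hT0] with t ht using (hall t (Ioo_subset_Ico_self ht)).symm
  · exact ⟨0, hcases.resolve_left hall, Or.inl rfl, fun h => (hall h).elim, fun _ => rfl⟩
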